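/- Let $G=\mathbb{Z}_4=\langle x\mid x^4=1\rangle$ act on $L=\mathbb{Z}^4$, the generator $x$ acting by left multiplication by the matrix $$M=\begin{pmatrix}-1&0&0&0\\0&0&0&-1\\0&1&0&1\\0&0&-1&1\end{pmatrix},\qquad M^4=I,$$ which is block diagonal with a one-dimensional block $-1$ and a three-dimensional block (the representation called $\rho_6$). Let $\Gamma=L\rtimes G$ be the corresponding 4-dimensional crystallographic group (denoted $1:4\rtimes 4$). Then $$H^4(\Gamma,\mathbb{Z})\cong \mathbb{Z}_4\oplus\mathbb{Z}_2^3,$$ whereas $$\bigoplus_{i+j=4}H^i(G,H^j(L,\mathbb{Z}))\cong \mathbb{Z}_4^2\oplus\mathbb{Z}_2^2 ,$$ where $G$ acts on $H^j(L,\mathbb{Z})$ through its action on $L$; the direct sum of the terms $E_2^{i,j}$, $i+j=4$, of the Lyndon--Hochschild--Serre spectral sequence $$E_2^{p,q}=H^p(\Gamma/L,H^q(L,\mathbb{Z}))\Rightarrow H^{p+q}(\Gamma,\mathbb{Z})$$ is likewise isomorphic to $\mathbb{Z}_4^2\oplus\mathbb{Z}_2^2$. Moreover this spectral sequence has nonzero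 differentials: there are $r\ge 2$ and $p,q$ such that $d_r^{p,q}\colon E_r^{p,q}\to E_r^{p+r,q-r+1}$ is nonzero. -/

import Mathlib

open CategoryTheory
open scoped DirectSum

noncomputable section

universe u

/-! ### The spectral sequence of a filtered cochain complex -/

/-- A filtered cochain complex of `R`-modules: a module `M` with an endomorphism `D`, `D² = 0`, the
submodules `deg n` of elements of degree `n`, and a decreasing filtration `fil p` that `D`
respects. The complex in degree `n` is `deg n`, with the filtration `deg n ⊓ fil p`. -/
structure FilteredCochains (R : Type*) [CommRing R] (M : Type*) [AddCommGroup M] [Module R M] where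
  D : M →ₗ[R] M
  D_D : ∀ x, D (D x) = 0
  deg : ℤ → Submodule R M
  D_deg : ∀ n, ∀ x ∈ deg n, D x ∈ deg (n + 1)
  fil : ℤ → Submodule R M
  fil_anti : Antitone fil
  D_fil : ∀ p, ∀ x ∈ fil p, D x ∈ fil p

namespace FilteredCochains

variable {R : Type*} [CommRing R] {M : Type*} [AddCommGroup M] [Module R M]
  (C : FilteredCochains R M)

/-- `Z_r^p` in total degree `n`: the `x ∈ Fᵖ Cⁿ` with `D x ∈ Fᵖ⁺ʳ Cⁿ⁺¹`. -/
def Z (r p n : ℤ) : Submodule R M :=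
  C.deg n ⊓ C.fil p ⊓ (C.fil (p + r)).comap C.D

/-- The denominator `Z_{r-1}^{p+1} + D (Z_{r-1}^{p-r+1})` of `E_r^p` in total degree `n`. -/
def B (r p n : ℤ) : Submodule R M :=
  C.Z (r - 1) (p + 1) n ⊔ (C.Z (r - 1) (p - r + 1) (n - 1)).map C.D

/-- The term `E_r^{p, n-p} = Z_r^p / (Z_{r-1}^{p+1} + D Z_{r-1}^{p-r+1})` of the spectral sequence
of the filtered complex, indexed by the filtration degree `p` and the total degree `n`. -/
abbrev E (r p n : ℤ) : Type _ :=
  C.Z r p n ⧸ (C.B r p n).comap (C.Z r p n).subtype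

lemma D_mem_Z (r p n : ℤ) (x : M) (hx : x ∈ C.Z r p n) : C.D x ∈ C.Z r (p + r) (n + 1) := by
  refine ⟨⟨C.D_deg n x hx.1.1, hx.2⟩, ?_⟩
  simp [C.D_D]

lemma D_mem_B (r p n : ℤ) (x : M) (hx : x ∈ C.B r p n) : C.D x ∈ C.B r (p + r) (n + 1) := by
  obtain ⟨y, hy, w, ⟨z, hz, rfl⟩, rfl⟩ := Submodule.mem_sup.1 hx
  rw [map_add, C.D_D, add_zero]
  refine Submodule.mem_sup_right ⟨y, ?_, rfl⟩
  have h1 : p + r - r + 1 = p + 1 := by ring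
  have h2 : n + 1 - 1 = n := by ring
  rw [h1, h2]
  exact hy

/-- The differential `d_r : E_r^{p, q} → E_r^{p + r, q - r + 1}`, where `n = p + q`, induced by
`D`. -/
def d (r p n : ℤ) : C.E r p n →ₗ[R] C.E r (p + r) (n + 1) :=
  Submodule.mapQ _ _ (C.D.restrict (C.D_mem_Z r p n)) fun x hx => C.D_mem_B r p n x hx

end FilteredCochains

/-! ### The Lyndon–Hochschild–Serre spectral sequence -/

namespace LHS

variable {k Γ : Type u} [CommRing k] [Group Γ] (A : Rep.{u} k Γ)

/-- The `Γ`-module `Hom_ℤ(ℤ[Γ^{q+1}], A)` of all functions `Γ^{q+1} → A`, where `ℤ[Γ^{q+1}]` is the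
`q`-th term of the bar resolution of `ℤ` over `ℤ[Γ]` in homogeneous form, with
`(γ φ)(x) = γ (φ (γ⁻¹ x))`. -/
def barHom (q : ℕ) : Rep.{u} k Γ :=
  Rep.of (X := (Fin (q + 1) → Γ) → A)
    { toFun := fun γ =>
        { toFun := fun φ x => A.ρ γ (φ fun i => γ⁻¹ * x i)
          map_add' := fun φ ψ => by ext x; simp
          map_smul' := fun c φ => by ext x; simp }
      map_one' := by ext φ x; simp
      map_mul' := fun γ δ => by ext φ x; simp [mul_assoc] }

/-- The differential `Hom(ℤ[Γ^{q+1}], A) → Hom(ℤ[Γ^{q+2}], A)` dual to the bar differential: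
`(δφ)(x₀, …, x_{q+1}) = ∑ᵢ (-1)ⁱ φ(x₀, …, x̂ᵢ, …, x_{q+1})`. -/
def barD (q : ℕ) : barHom A q ⟶ barHom A (q + 1) :=
  Rep.ofHom
    { toFun := fun φ x => ∑ i : Fin (q + 2), (-1 : k) ^ (i : ℕ) • φ fun j => x (i.succAbove j)
      map_add' := fun φ ψ => by ext x; simp [Finset.sum_add_distrib]
      map_smul' := fun c φ => by ext x; simp [Finset.smul_sum, smul_comm c]
      isIntertwining' := fun γ => by ext φ x; simp }

lemma barD_barD (q : ℕ) : barD A q ≫ barD A (q + 1) = 0 := by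
  ext φ
  funext x
  change ∑ i : Fin (q + 3), (-1 : k) ^ (i : ℕ) • ∑ l : Fin (q + 2), (-1 : k) ^ (l : ℕ) •
    φ (fun j => x (i.succAbove (l.succAbove j))) = 0
  simp only [Finset.smul_sum, smul_smul, ← pow_add]
  rw [← Finset.univ.sum_product' Finset.univ
    (fun (i : Fin (q + 3)) (l : Fin (q + 2)) => (-1 : k) ^ ((i : ℕ) + (l : ℕ)) •
      φ (fun j => x (i.succAbove (l.succAbove j))))]
  refine Finset.sum_involution (fun p _ => (p.1.succAbove p.2, p.2.predAbove p.1)) ?_ ?_ ?_ ?_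
  · rintro ⟨i, l⟩ -
    dsimp only
    have h : ∀ j, (i.succAbove l).succAbove ((l.predAbove i).succAbove j) =
        i.succAbove (l.succAbove j) := fun j =>
      Fin.succAbove_succAbove_succAbove_predAbove i l j
    simp only [h, ← add_smul]
    have : (-1 : k) ^ ((i : ℕ) + l) +
        (-1 : k) ^ (((i.succAbove l : Fin (q + 3)) : ℕ) + (l.predAbove i : Fin (q + 2))) = 0 := by
      rcases lt_or_ge l.castSucc i with h | h
      · rw [Fin.succAbove_of_castSucc_lt _ _ h, Fin.predAbove_of_castSucc_lt _ _ h]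
        have h' : (l : ℕ) < i := h
        obtain ⟨m, hm⟩ : ∃ m, (i : ℕ) = m + 1 := ⟨i - 1, by omega⟩
        simp only [Fin.val_castSucc, Fin.val_pred, hm]
        simp only [Nat.add_sub_cancel]
        ring
      · rw [Fin.succAbove_of_le_castSucc _ _ h, Fin.predAbove_of_le_castSucc _ _ h]
        simp only [Fin.val_succ, Fin.coe_castPred]
        ring
    rw [this, zero_smul]
  · rintro ⟨i, l⟩ - - h
    exact Fin.succAbove_ne i l (congrArg Prod.fst h)
  · simp
  · rintro ⟨i, l⟩ -
    exact Prod.ext (Fin.succAbove_succAbove_predAbove i l) (Fin.predAbove_predAbove_succAbove i l)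

variable (N : Subgroup Γ) [N.Normal]

/-- `Hom_N(ℤ[Γ^{q+1}], A)`, the `N`-equivariant functions `Γ^{q+1} → A`, as a `Γ ⧸ N`-module. -/
abbrev barHomInv (q : ℕ) : Rep.{u} k (Γ ⧸ N) := (barHom A q).quotientToInvariants N

/-- The differential `Hom_N(ℤ[Γ^{q+1}], A) → Hom_N(ℤ[Γ^{q+2}], A)`. -/
def barInvD (q : ℕ) : barHomInv A N q ⟶ barHomInv A N (q + 1) :=
  (Rep.quotientToInvariantsFunctor k N).map (barD A q)

/-- The double complex `K^{p,q} = C^p(Γ ⧸ N, Hom_N(ℤ[Γ^{q+1}], A))`, where `C^p(Γ ⧸ N, -)` are the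
inhomogeneous cochains of the group `Γ ⧸ N`. -/
abbrev K (p q : ℕ) : Type u := (Fin p → Γ ⧸ N) → barHomInv A N q

/-- The horizontal differential, that of the cochains of `Γ ⧸ N`. -/
def dh (p q : ℕ) : K A N p q →ₗ[k] K A N (p + 1) q :=
  (inhomogeneousCochains.d (barHomInv A N q) p).hom

/-- The vertical differential, that of the bar resolution of `Γ`. -/
def dv (p q : ℕ) : K A N p q →ₗ[k] K A N p (q + 1) :=
  (barInvD A N q).hom.toLinearMap.compLeft (Fin p → Γ ⧸ N)

lemma dh_dh (p q : ℕ) (x : K A N p q) : dh A N (p + 1) q (dh A N p q x) = 0 := by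
  have := groupCohomology.inhomogeneousCochains.d_comp_d (barHomInv A N q) (n := p)
  exact congr($(this).hom x)

lemma dv_dv (p q : ℕ) (x : K A N p q) : dv A N p (q + 1) (dv A N p q x) = 0 := by
  have h : (Rep.quotientToInvariantsFunctor k N).map (barD A q) ≫
      (Rep.quotientToInvariantsFunctor k N).map (barD A (q + 1)) = 0 := by
    rw [← Functor.map_comp, barD_barD]
    rfl
  funext g
  exact congr(($h).hom (x g))

lemma dh_dv (p q : ℕ) (x : K A N p q) :
    dh A N p (q + 1) (dv A N p q x) = dv A N (p + 1) q (dh A N p q x) := by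
  funext g
  have h : ∀ y : K A N p q, (inhomogeneousCochains.d (barHomInv A N q) p).hom y g =
      (barHomInv A N q).ρ (g 0) (y fun i => g i.succ) + Finset.univ.sum fun j : Fin (p + 1) =>
        (-1 : k) ^ ((j : ℕ) + 1) • y (Fin.contractNth j (· * ·) g) := fun y => rfl
  change _ = (barInvD A N q).hom ((inhomogeneousCochains.d (barHomInv A N q) p).hom x g)
  rw [h, map_add, map_sum, Rep.hom_comm_apply]
  simp only [map_smul]
  rfl

/-- Families of elements of all the `K^{p,q}`. Those supported on `p + q = n` form the degree `n`
part of the total complex. -/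
def Tot : Type u := ∀ p q : ℕ, K A N p q

instance : AddCommGroup (Tot A N) := inferInstanceAs (AddCommGroup (∀ p q : ℕ, K A N p q))

instance : Module k (Tot A N) := inferInstanceAs (Module k (∀ p q : ℕ, K A N p q))

lemma Tot.add_apply (c c' : Tot A N) (p q : ℕ) : (c + c') p q = c p q + c' p q := rfl

lemma Tot.neg_apply (c : Tot A N) (p q : ℕ) : (-c) p q = -c p q := rfl

lemma Tot.smul_apply (a : k) (c : Tot A N) (p q : ℕ) : (a • c) p q = a • c p q := rfl

/-- The horizontal part of the total differential. -/
def totH : Tot A N →ₗ[k] Tot A N where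
  toFun c := fun p q => match p with
    | 0 => 0
    | p + 1 => dh A N p q (c p q)
  map_add' c c' := by
    funext p q
    rcases p with _ | p
    · exact (add_zero 0).symm
    · exact map_add (dh A N p q) _ _
  map_smul' a c := by
    funext p q
    rcases p with _ | p
    · exact (smul_zero a).symm
    · exact map_smul (dh A N p q) a _

/-- The vertical part of the total differential, with the sign `(-1)^p` on the `p`-th column. -/
def totV : Tot A N →ₗ[k] Tot A N where
  toFun c := fun p q => match q with
    | 0 => 0
    | q + 1 => (-1 : k) ^ p • dv A N p q (c p q)
  map_add' c c' := by
    funext p q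
    rcases q with _ | q
    · exact (add_zero 0).symm
    · exact map_add ((-1 : k) ^ p • dv A N p q) _ _
  map_smul' a c := by
    funext p q
    rcases q with _ | q
    · exact (smul_zero a).symm
    · exact map_smul ((-1 : k) ^ p • dv A N p q) a _

lemma totH_zero (c : Tot A N) (q : ℕ) : totH A N c 0 q = 0 := rfl

lemma totH_succ (c : Tot A N) (p q : ℕ) : totH A N c (p + 1) q = dh A N p q (c p q) := rfl

lemma totV_zero (c : Tot A N) (p : ℕ) : totV A N c p 0 = 0 := rfl

lemma totV_succ (c : Tot A N) (p q : ℕ) :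
    totV A N c p (q + 1) = (-1 : k) ^ p • dv A N p q (c p q) := rfl

lemma totH_totH (c : Tot A N) : totH A N (totH A N c) = 0 := by
  funext p q
  rcases p with _ | _ | p
  · rfl
  · rw [totH_succ, totH_zero, map_zero]; rfl
  · rw [totH_succ, totH_succ, dh_dh]; rfl

lemma totV_totV (c : Tot A N) : totV A N (totV A N c) = 0 := by
  funext p q
  rcases q with _ | _ | q
  · rfl
  · rw [totV_succ, totV_zero, map_zero, smul_zero]; rfl
  · rw [totV_succ, totV_succ, map_smul, dv_dv, smul_zero, smul_zero]; rfl

lemma totH_totV (c : Tot A N) : totH A N (totV A N c) = -totV A N (totH A N c) := by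
  funext p q
  rw [Tot.neg_apply]
  rcases p with _ | p <;> rcases q with _ | q
  · rw [totH_zero, totV_zero, neg_zero]
  · rw [totH_zero, totV_succ, totH_zero, map_zero, smul_zero, neg_zero]
  · rw [totH_succ, totV_zero, totV_zero, map_zero, neg_zero]
  · rw [totH_succ, totV_succ, totV_succ, totH_succ, map_smul, dh_dv, pow_succ, mul_neg_one,
      neg_smul, neg_neg]

lemma totH_eq_zero (c : Tot A N) (p q : ℕ) (h : ∀ p', p' + 1 = p → c p' q = 0) :
    totH A N c p q = 0 := by
  rcases p with _ | p
  · rfl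
  · rw [totH_succ, h p rfl, map_zero]

lemma totV_eq_zero (c : Tot A N) (p q : ℕ) (h : ∀ q', q' + 1 = q → c p q' = 0) :
    totV A N c p q = 0 := by
  rcases q with _ | q
  · rfl
  · rw [totV_succ, h q rfl, map_zero, smul_zero]

/-- The elements of total degree `n`: those supported on `p + q = n`. -/
def totDeg (n : ℤ) : Submodule k (Tot A N) where
  carrier := {c | ∀ p q : ℕ, (p : ℤ) + q ≠ n → c p q = 0}
  add_mem' {a b} ha hb p q h := by rw [Tot.add_apply, ha p q h, hb p q h, add_zero]
  zero_mem' _ _ _ := rfl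
  smul_mem' a c hc p q h := by rw [Tot.smul_apply, hc p q h, smul_zero]

/-- The filtration by columns: the elements supported on the columns `p ≥ s`. -/
def totFil (s : ℤ) : Submodule k (Tot A N) where
  carrier := {c | ∀ p q : ℕ, (p : ℤ) < s → c p q = 0}
  add_mem' {a b} ha hb p q h := by rw [Tot.add_apply, ha p q h, hb p q h, add_zero]
  zero_mem' _ _ _ := rfl
  smul_mem' a c hc p q h := by rw [Tot.smul_apply, hc p q h, smul_zero]

/-- The total complex of the double complex `K^{p,q} = C^p(Γ ⧸ N, Hom_N(ℤ[Γ^{q+1}], A))`, filtered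
by columns. -/
def filtered : FilteredCochains k (Tot A N) where
  D := totH A N + totV A N
  D_D c := by
    simp only [LinearMap.add_apply, map_add, totH_totH, totV_totV, totH_totV]
    abel
  deg := totDeg A N
  D_deg n c hc p q h := by
    rw [LinearMap.add_apply, Tot.add_apply,
      totH_eq_zero A N c p q fun p' h' => hc p' q (by omega),
      totV_eq_zero A N c p q fun q' h' => hc p q' (by omega), add_zero]
  fil := totFil A N
  fil_anti _ _ h _ hc p q hp := hc p q (lt_of_lt_of_le hp h)
  D_fil s c hc p q h := by
    rw [LinearMap.add_apply, Tot.add_apply,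
      totH_eq_zero A N c p q fun p' h' => hc p' q (by omega),
      totV_eq_zero A N c p q fun q' h' => hc p q' (by omega), add_zero]

/-- The term `E_r^{p, q}`, `q = n - p`, of the Lyndon–Hochschild–Serre spectral sequence
`E_2^{p,q} = H^p(Γ ⧸ N, H^q(N, A)) ⇒ H^{p+q}(Γ, A)` of the normal subgroup `N` of `Γ`, the spectral
sequence of the above filtered complex. It is indexed by `p` and the total degree `n = p + q`. -/
def E (r p n : ℤ) : ModuleCat.{u} k := ModuleCat.of k ((filtered A N).E r p n)

/-- The differential `d_r : E_r^{p, q} → E_r^{p + r, q - r + 1}`, `q = n - p`, of the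
Lyndon–Hochschild–Serre spectral sequence. -/
def d (r p n : ℤ) : E A N r p n ⟶ E A N r (p + r) (n + 1) :=
  ModuleCat.ofHom ((filtered A N).d r p n)

end LHS

/-! ### The crystallographic group -/

section Conj

variable {L G : Type} [Group L] [Group G] (φ : G →* MulAut L)

/-- The `G`-module `H^j(L, ℤ)` for a group `G` acting on `L` by automorphisms: `g` acts by the map
that the automorphism `g⁻¹` of `L` induces on cohomology with trivial coefficients. -/
def cohomologyRep (j : ℕ) : Rep.{0} ℤ G :=
  Rep.of (X := groupCohomology (Rep.trivial ℤ L ℤ) j)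
    { toFun := fun g => (groupCohomology.map (A := Rep.trivial ℤ L ℤ) (B := Rep.trivial ℤ L ℤ)
        (φ g⁻¹).toMonoidHom (𝟙 (Rep.trivial ℤ L ℤ)) j).hom
      map_one' := by
        have h : (φ (1 : G)⁻¹).toMonoidHom = MonoidHom.id L := by ext; simp
        rw [h]
        exact congr(($(groupCohomology.map_id (B := Rep.trivial ℤ L ℤ) j)).hom)
      map_mul' := fun g g' => by
        have h : (φ (g * g')⁻¹).toMonoidHom =
            (φ g'⁻¹).toMonoidHom.comp (φ g⁻¹).toMonoidHom := by ext; simp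
        rw [h]
        exact congr(($(groupCohomology.map_comp (A := Rep.trivial ℤ L ℤ)
          (B := Rep.trivial ℤ L ℤ) (C := Rep.trivial ℤ L ℤ) (φ g'⁻¹).toMonoidHom
          (φ g⁻¹).toMonoidHom (𝟙 _) (𝟙 _) j)).hom) }

end Conj

/-- The generator of the holonomy representation, block diagonal with blocks `-1` (the nontrivial
one-dimensional representation) and the three-dimensional representation `ρ₆`. -/
def holonomyMatrix : Matrix (Fin 4) (Fin 4) ℤ :=
  !![-1, 0,  0,  0;
      0, 0,  0, -1;
      0, 1,  0,  1;
      0, 0, -1,  1]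

/-- The lattice `ℤ⁴`, written multiplicatively. -/
abbrev TransLattice : Type := Multiplicative (Fin 4 → ℤ)

/-- The holonomy group `ℤ₄`, cyclic of order 4, written multiplicatively. -/
abbrev Holonomy : Type := Multiplicative (ZMod 4)

lemma holonomyMatrix_pow_add (a b : ZMod 4) :
    holonomyMatrix ^ (a + b).val = holonomyMatrix ^ a.val * holonomyMatrix ^ b.val := by
  have h4 : holonomyMatrix ^ 4 = 1 := by decide
  rw [ZMod.val_add, ← pow_add]
  conv_rhs => rw [← Nat.div_add_mod (a.val + b.val) 4, pow_add, pow_mul, h4, one_pow, one_mul]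

/-- The action of `ℤ₄` on `ℤ⁴`: the class of `a` acts by left multiplication by the `a`-th power of
the holonomy matrix. -/
def holonomyAction : Holonomy →* MulAut TransLattice where
  toFun g :=
    { toFun := fun v => .ofAdd ((holonomyMatrix ^ g.toAdd.val).mulVec v.toAdd)
      invFun := fun v => .ofAdd ((holonomyMatrix ^ (-g.toAdd).val).mulVec v.toAdd)
      left_inv := fun v => by
        simp [Matrix.mulVec_mulVec, ← holonomyMatrix_pow_add]
      right_inv := fun v => by
        simp [Matrix.mulVec_mulVec, ← holonomyMatrix_pow_add]
      map_mul' := fun v w => by simp [Matrix.mulVec_add] }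
  map_one' := by ext v; simp
  map_mul' g g' := by
    ext v
    simp [Matrix.mulVec_mulVec, ← holonomyMatrix_pow_add]

/-- The four-dimensional crystallographic group `ℤ⁴ ⋊ ℤ₄`. -/
abbrev CrystGroup : Type := TransLattice ⋊[holonomyAction] Holonomy

/-- The translation lattice `ℤ⁴`, a normal subgroup of the crystallographic group. -/
abbrev translations : Subgroup CrystGroup := (SemidirectProduct.inl : TransLattice →* CrystGroup).range

instance translations_normal : translations.Normal := by
  rw [translations, SemidirectProduct.range_inl_eq_ker_rightHom]
  infer_instance

end

/-! The computation rests on a geometric model. In the coordinates `coord`, the lattice L becomes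
the index-two sublattice of ℤ⁴ where y₁ - y₂ + y₃ is even, and the generator of the holonomy group
becomes a signed permutation of the axes: it reverses axis 0, makes a quarter turn in the plane of
axes 1 and 2, and fixes axis 3. So Γ preserves the standard cubulation of ℝ⁴, whose cubes fall into
2 · 16 = 32 orbits under L. Cubical cochains are acyclic by integration along the axes
(`Cubical.exact`). They therefore compute the cohomology of L and, after taking the product with the
2-periodic resolution of ℤ/4, that of Γ.

The comparison with group cohomology (`CellResolution.cohomology`) uses the double complex of
equivariant functions on tuples with values in cellular cochains. Its rows and columns are exact, so
the augmentations by invariant homogeneous cochains and by invariant cellular cochains have the same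
cohomology, via zigzags along an antidiagonal (`ExactDouble.row_column`). Identifications of
subquotients are carried as additive relations (`SubquotientIso`). These compose without choosing
representatives and record a compatible endomorphism, which transports the action of the holonomy
generator on H^j(L, ℤ).

What remains is finite integral linear algebra on ℤ³², given by explicit matrices whose identities
are checked on basis vectors. A contraction shows that H^j(L, ℤ) is free of rank 1, 4, 6, 4, 1 and
yields the matrices 1, `A1`, `A2`, `A3`, -1 of the generator. The formulas for a cyclic group (fixed
vectors modulo norms, or norm kernel modulo the image of A - 1) then give H^i(ℤ/4, H^j) = 0, ℤ/4,
ℤ/2, ℤ/2, ℤ/4 for i = 0, …, 4 and i + j = 4. For Γ, cocycles, dual functionals and primitives in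
degree 4 exhibit four generators of orders 4, 2, 2, 2 (`productResolution_cohomology`).

For the spectral sequence, the columns of the LHS double complex compute the cohomology of L, which
identifies E₂^{p,q} with H^p(Γ/L, H^q(L)) (`LHS.secondPage_equiv`). The rows are exact beyond the
first column, so the total complex computes H^n(Γ) (`LHS.subquotientIso_tot`). If every d_r with r ≥
2 vanished, the graded pieces of H⁴(Γ) would be the E₂ terms and the order of H⁴(Γ) would be their
product (`FilteredCochains.card_eq_prod`). That product is 64, while H⁴(Γ) has order 32. The nonzero
differential is thus obtained by counting, without being located. -/

/-! ### Subquotients of abelian groups and correspondences between them -/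

section Correspondences

variable {A B C : Type*} [AddCommGroup A] [AddCommGroup B] [AddCommGroup C]

/-- An additive relation that identifies the subquotients `Z / N` of `A` and `Z' / N'` of `B`, and
the endomorphisms of them induced by `t` and `t'`. -/
def SubquotientIso (Z N : AddSubgroup A) (t : A →+ A) (Z' N' : AddSubgroup B) (t' : B →+ B) :
    Prop :=
  ∃ P : AddSubgroup (A × B), (∀ a b, (a, b) ∈ P → a ∈ Z ∧ b ∈ Z') ∧ (∀ a ∈ Z, ∃ b, (a, b) ∈ P) ∧
    (∀ b ∈ Z', ∃ a, (a, b) ∈ P) ∧ (∀ a b, (a, b) ∈ P → (a ∈ N ↔ b ∈ N')) ∧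
    ∀ a b, (a, b) ∈ P → (t a, t' b) ∈ P

namespace SubquotientIso

variable {Z N : AddSubgroup A} {t : A →+ A} {Z' N' : AddSubgroup B} {t' : B →+ B}
  {Z'' N'' : AddSubgroup C} {t'' : C →+ C}

lemma symm (h : SubquotientIso Z N t Z' N' t') : SubquotientIso Z' N' t' Z N t := by
  obtain ⟨P, h1, h2, h3, h4, h5⟩ := h
  exact ⟨P.comap (AddEquiv.prodComm : B × A ≃+ A × B).toAddMonoidHom,
    fun a b h => (h1 _ _ h).symm, h3, h2, fun a b h => (h4 _ _ h).symm, fun a b h => h5 _ _ h⟩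

lemma trans (h : SubquotientIso Z N t Z' N' t') (h' : SubquotientIso Z' N' t' Z'' N'' t'') :
    SubquotientIso Z N t Z'' N'' t'' := by
  obtain ⟨P, h1, h2, h3, h4, h5⟩ := h
  obtain ⟨Q, k1, k2, k3, k4, k5⟩ := h'
  refine ⟨⟨⟨⟨{x | ∃ b, (x.1, b) ∈ P ∧ (b, x.2) ∈ Q}, ?_⟩, ⟨0, P.zero_mem, Q.zero_mem⟩⟩, ?_⟩,
    ?_, ?_, ?_, ?_, ?_⟩
  · rintro ⟨a, c⟩ ⟨a', c'⟩ ⟨b, hb, hb'⟩ ⟨b', hc, hc'⟩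
    exact ⟨b + b', P.add_mem hb hc, Q.add_mem hb' hc'⟩
  · rintro ⟨a, c⟩ ⟨b, hb, hb'⟩
    exact ⟨-b, P.neg_mem hb, Q.neg_mem hb'⟩
  · rintro a c ⟨b, hb, hb'⟩
    exact ⟨(h1 _ _ hb).1, (k1 _ _ hb').2⟩
  · intro a ha
    obtain ⟨b, hb⟩ := h2 a ha
    obtain ⟨c, hc⟩ := k2 b (h1 _ _ hb).2
    exact ⟨c, b, hb, hc⟩
  · intro c hc
    obtain ⟨b, hb⟩ := k3 c hc
    obtain ⟨a, ha⟩ := h3 b (k1 _ _ hb).1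
    exact ⟨a, b, ha, hb⟩
  · rintro a c ⟨b, hb, hb'⟩
    exact (h4 _ _ hb).trans (k4 _ _ hb')
  · rintro a c ⟨b, hb, hb'⟩
    exact ⟨t' b, h5 _ _ hb, k5 _ _ hb'⟩

/-- A correspondence given by a homomorphism. -/
lemma of_hom (f : A →+ B) (hZ : ∀ a ∈ Z, f a ∈ Z')
    (hsurj : ∀ b ∈ Z', ∃ a ∈ Z, f a - b ∈ N') (hN : ∀ a ∈ Z, a ∈ N ↔ f a ∈ N') (hN' : N' ≤ Z')
    (ht : ∀ a ∈ Z, t a ∈ Z) (ht' : ∀ b ∈ N', t' b ∈ N') (hf : ∀ a ∈ Z, f (t a) - t' (f a) ∈ N') :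
    SubquotientIso Z N t Z' N' t' := by
  -- Congruence modulo N' replaces the graph of `f`, so that every element of Z' is related to
  -- something although `f` is surjective only modulo N'.
  refine ⟨⟨⟨⟨{x | x.1 ∈ Z ∧ f x.1 - x.2 ∈ N'}, ?_⟩, ?_⟩, ?_⟩, ?_, ?_, ?_, ?_, ?_⟩
  · rintro ⟨a, b⟩ ⟨a', b'⟩ ⟨h1, h2⟩ ⟨h3, h4⟩
    refine ⟨Z.add_mem h1 h3, ?_⟩
    have := N'.add_mem h2 h4
    simp only [Prod.fst_add, Prod.snd_add, map_add] at this ⊢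
    convert this using 1; abel
  · exact ⟨Z.zero_mem, by simp [N'.zero_mem]⟩
  · rintro ⟨a, b⟩ ⟨h1, h2⟩
    refine ⟨Z.neg_mem h1, ?_⟩
    have := N'.neg_mem h2
    simp only [Prod.fst_neg, Prod.snd_neg, map_neg] at this ⊢
    convert this using 1; abel
  · rintro a b ⟨h1, h2⟩
    refine ⟨h1, ?_⟩
    have := Z'.sub_mem (hZ a h1) (hN' h2)
    simpa using this
  · exact fun a ha => ⟨f a, ha, by simp [N'.zero_mem]⟩
  · intro b hb
    obtain ⟨a, ha, h⟩ := hsurj b hb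
    exact ⟨a, ha, h⟩
  · rintro a b ⟨h1, h2⟩
    dsimp only at h1 h2
    rw [hN a h1]
    constructor
    · intro h; simpa using N'.sub_mem h h2
    · intro h; simpa using N'.add_mem h2 h
  · rintro a b ⟨h1, h2⟩
    refine ⟨ht a h1, ?_⟩
    have := N'.add_mem (hf a h1) (ht' _ h2)
    simpa [map_sub] using this

/-- A correspondence with a whole group is given by a surjective homomorphism. -/
lemma exists_hom (h : SubquotientIso Z N t (⊤ : AddSubgroup B) ⊥ t') :
    ∃ θ : Z →+ B, Function.Surjective θ ∧ (∀ z, θ z = 0 ↔ (z : A) ∈ N) ∧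
      ∀ z w : Z, (w : A) = t z → θ w = t' (θ z) := by
  obtain ⟨P, h1, h2, h3, h4, h5⟩ := h
  choose f hf using fun z : Z => h2 z z.2
  have huniq : ∀ a b b', (a, b) ∈ P → (a, b') ∈ P → b = b' := by
    intro a b b' h h'
    have := P.sub_mem h h'
    simp only [Prod.mk_sub_mk, sub_self] at this
    have h0 := (h4 _ _ P.zero_mem).2 (zero_mem _)
    simpa [sub_eq_zero] using (h4 _ _ this).1 h0
  refine ⟨AddMonoidHom.mk' f fun z w =>
    huniq _ _ _ (hf (z + w)) (P.add_mem (hf z) (hf w)), ?_, ?_, ?_⟩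
  · intro b
    obtain ⟨a, ha⟩ := h3 b trivial
    exact ⟨⟨a, (h1 _ _ ha).1⟩, huniq _ _ _ (hf ⟨a, _⟩) ha⟩
  · intro z
    exact (AddSubgroup.mem_bot.symm.trans (h4 _ _ (hf z)).symm)
  · intro z w hw
    refine huniq _ _ _ (hf w) ?_
    rw [hw]
    exact h5 _ _ (hf z)

/-- A correspondence between whole groups is an isomorphism. -/
lemma exists_equiv (h : SubquotientIso (⊤ : AddSubgroup A) ⊥ t (⊤ : AddSubgroup B) ⊥ t') :
    ∃ e : A ≃+ B, ∀ a, e (t a) = t' (e a) := by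
  obtain ⟨θ, h1, h2, h3⟩ := h.exists_hom
  refine ⟨(AddSubgroup.topEquiv (G := A)).symm.trans (AddEquiv.ofBijective θ
    ⟨(injective_iff_map_eq_zero θ).2 fun z hz => ?_, h1⟩), ?_⟩
  · simpa using (h2 z).1 hz
  · intro a
    exact h3 ⟨a, trivial⟩ ⟨t a, trivial⟩ rfl

/-- A subquotient is identified with the target of a surjective homomorphism with the right
kernel. -/
lemma of_surjective (θ : A →+ B) (hsurj : ∀ b, ∃ a ∈ Z, θ a = b)
    (hN : ∀ a ∈ Z, θ a = 0 ↔ a ∈ N) (ht : ∀ a ∈ Z, t a ∈ Z) (hθ : ∀ a ∈ Z, θ (t a) = t' (θ a)) :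
    SubquotientIso Z N t (⊤ : AddSubgroup B) ⊥ t' := by
  refine of_hom θ (fun _ _ => trivial) (fun b _ => ?_) (fun a ha => ?_) bot_le ht ?_ ?_
  · obtain ⟨a, ha, h⟩ := hsurj b
    exact ⟨a, ha, by simp [h]⟩
  · simp [← hN a ha]
  · rintro b rfl
    simp
  · intro a ha
    simp [hθ a ha]

end SubquotientIso

end Correspondences

/-! ### Graded cochains -/

section Cochains

variable {A : ℕ → Type*} [∀ n, AddCommGroup (A n)] (S : ∀ n, AddSubgroup (A n))
  (d : ∀ n, A n →+ A (n + 1))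

/-- The cocycles of degree `n` of the complex with terms `S n ≤ A n`. -/
def cocyc (n : ℕ) : AddSubgroup (A n) := S n ⊓ (d n).ker

/-- The coboundaries of degree `n` of the complex with terms `S n ≤ A n`. -/
def cobound : ∀ n : ℕ, AddSubgroup (A n)
  | 0 => ⊥
  | n + 1 => (S n).map (d n)

lemma mem_cobound_zero {x : A 0} : x ∈ cobound S d 0 ↔ x = 0 := Iff.rfl

lemma mem_cobound_succ {n : ℕ} {x : A (n + 1)} :
    x ∈ cobound S d (n + 1) ↔ ∃ y ∈ S n, d n y = x := Iff.rfl

end Cochains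

/-! ### Double complexes with exact rows and columns -/

/-- A commutative double complex of abelian groups `D q s ≤ M q`, with an endomorphism, whose rows
and columns are exact except at the beginning. -/
structure ExactDouble (M : ℕ → Type*) [∀ q, AddCommGroup (M q)] where
  D : ∀ q : ℕ, ℕ → AddSubgroup (M q)
  h : ∀ q, M q →+ M (q + 1)
  v : ∀ q, M q →+ M q
  t : ∀ q, M q →+ M q
  h_mem : ∀ {q s x}, x ∈ D q s → h q x ∈ D (q + 1) s
  v_mem : ∀ {q s x}, x ∈ D q s → v q x ∈ D q (s + 1)
  t_mem : ∀ {q s x}, x ∈ D q s → t q x ∈ D q s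
  h_h : ∀ q x, h (q + 1) (h q x) = 0
  v_v : ∀ q x, v q (v q x) = 0
  h_v : ∀ q x, h q (v q x) = v (q + 1) (h q x)
  h_t : ∀ q x, h q (t q x) = t (q + 1) (h q x)
  v_t : ∀ q x, v q (t q x) = t q (v q x)
  exact_h : ∀ {q s x}, x ∈ D (q + 1) s → h (q + 1) x = 0 → ∃ y ∈ D q s, h q y = x
  exact_v : ∀ {q s x}, x ∈ D q (s + 1) → v q x = 0 → ∃ y ∈ D q s, v q y = x

namespace ExactDouble

variable {M : ℕ → Type*} [∀ q, AddCommGroup (M q)] (X : ExactDouble M)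

/-- The elements on which the diagonal map `h ∘ v` vanishes. -/
def diagKer (q s : ℕ) : AddSubgroup (M q) := X.D q s ⊓ ((X.h q).comp (X.v q)).ker

/-- The sum of the kernels of the horizontal and the vertical map. -/
def sumKer (q s : ℕ) : AddSubgroup (M q) := (X.D q s ⊓ (X.h q).ker) ⊔ (X.D q s ⊓ (X.v q).ker)

lemma mem_sumKer {q s : ℕ} {x : M q} : x ∈ X.sumKer q s ↔
    ∃ a, (a ∈ X.D q s ∧ X.h q a = 0) ∧ ∃ b, (b ∈ X.D q s ∧ X.v q b = 0) ∧ a + b = x :=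
  AddSubgroup.mem_sup

/-- This is one zigzag step: x at (q+1, s) is related to y at (q, s+1) when v x = h y. If h v x = 0,
row exactness produces y from v x; if h v y = 0, column exactness produces x from h y. The ambiguity
is ker h on one side and ker v on the other, which is why the sum of the two kernels is divided out.
-/
lemma diagKer_succ (q s : ℕ) : SubquotientIso (X.diagKer (q + 1) s) (X.sumKer (q + 1) s)
    (X.t (q + 1)) (X.diagKer q (s + 1)) (X.sumKer q (s + 1)) (X.t q) := by
  refine ⟨⟨⟨⟨{x | (x.1 ∈ X.diagKer (q + 1) s ∧ x.2 ∈ X.diagKer q (s + 1)) ∧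
    X.v (q + 1) x.1 = X.h q x.2}, ?_⟩, ?_⟩, ?_⟩, ?_, ?_, ?_, ?_, ?_⟩
  · rintro ⟨a, b⟩ ⟨a', b'⟩ ⟨⟨h1, h2⟩, h3⟩ ⟨⟨h4, h5⟩, h6⟩
    exact ⟨⟨add_mem h1 h4, add_mem h2 h5⟩, by simp_all⟩
  · exact ⟨⟨zero_mem _, zero_mem _⟩, by simp⟩
  · rintro ⟨a, b⟩ ⟨⟨h1, h2⟩, h3⟩
    exact ⟨⟨neg_mem h1, neg_mem h2⟩, by simp_all⟩
  · exact fun a b h => h.1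
  · intro x hx
    obtain ⟨y, hy, h⟩ := X.exact_h (X.v_mem hx.1) hx.2
    exact ⟨y, ⟨hx, hy, by simp [X.h_v, h, X.v_v]⟩, h.symm⟩
  · intro y hy
    obtain ⟨x, hx, h⟩ := X.exact_v (X.h_mem hy.1) (by rw [← X.h_v]; exact hy.2)
    exact ⟨x, ⟨⟨hx, by simp [h, X.h_h]⟩, hy⟩, h⟩
  · rintro x y ⟨⟨hx, hy⟩, hxy⟩
    dsimp only at hx hy hxy
    simp only [mem_sumKer]
    constructor
    · rintro ⟨a, ⟨ha, ha'⟩, b, ⟨hb, hb'⟩, rfl⟩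
      obtain ⟨c, hc, rfl⟩ := X.exact_h ha ha'
      -- With x = h c + b and v b = 0, commutativity gives h y = v x = v h c = h v c, so y - v c
      -- lies in ker h.
      refine ⟨y - X.v q c, ⟨sub_mem hy.1 (X.v_mem hc), ?_⟩, X.v q c, ⟨X.v_mem hc, X.v_v _ _⟩,
        by abel⟩
      rw [map_sub, ← hxy, map_add, hb', X.h_v]; simp
    · rintro ⟨a, ⟨ha, ha'⟩, b, ⟨hb, hb'⟩, rfl⟩
      obtain ⟨c, hc, rfl⟩ := X.exact_v hb hb'
      refine ⟨X.h q c, ⟨X.h_mem hc, X.h_h _ _⟩, x - X.h q c, ⟨sub_mem hx.1 (X.h_mem hc), ?_⟩,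
        by abel⟩
      rw [map_sub, hxy, map_add, ha', X.h_v]; simp
  · rintro x y ⟨⟨hx, hy⟩, hxy⟩
    refine ⟨⟨⟨X.t_mem hx.1, ?_⟩, X.t_mem hy.1, ?_⟩, ?_⟩
    · have := hx.2
      simp_all [X.h_t, X.v_t]
    · have := hy.2
      simp_all [X.h_t, X.v_t]
    · simp_all [X.h_t, X.v_t]

/-- Iterated zigzags move the subquotient along its antidiagonal to the first column. -/
lemma diagKer_antidiagonal (n q s : ℕ) (hn : q + s = n) :
    SubquotientIso (X.diagKer q s) (X.sumKer q s) (X.t q)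
      (X.diagKer 0 n) (X.sumKer 0 n) (X.t 0) := by
  induction q generalizing s with
  | zero =>
    obtain rfl : s = n := by omega
    refine SubquotientIso.of_hom (AddMonoidHom.id _) (fun _ h => h)
      (fun b hb => ⟨b, hb, by simp [zero_mem]⟩) (fun _ _ => Iff.rfl) ?_ ?_ ?_ ?_
    · intro x hx
      obtain ⟨a, ⟨ha, ha'⟩, b, ⟨hb, hb'⟩, rfl⟩ := X.mem_sumKer.1 hx
      exact ⟨add_mem ha hb, by simp [X.h_v, ha', hb']⟩
    · exact fun x hx => ⟨X.t_mem hx.1, by have := hx.2; simp_all [X.h_t, X.v_t]⟩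
    · intro x hx
      obtain ⟨a, ⟨ha, ha'⟩, b, ⟨hb, hb'⟩, rfl⟩ := X.mem_sumKer.1 hx
      exact X.mem_sumKer.2 ⟨X.t 0 a, ⟨X.t_mem ha, by simp [X.h_t, ha']⟩, X.t 0 b,
        ⟨X.t_mem hb, by simp [X.v_t, hb']⟩, by simp⟩
    · intro a _
      simp [zero_mem]
  | succ q ih => exact (X.diagKer_succ q s).trans (ih (s + 1) (by omega))

/-! ### Cohomology of the augmentations at the two ends of a zigzag -/

section Augmentations

variable {A : ℕ → Type*} [∀ n, AddCommGroup (A n)] (S : ∀ n, AddSubgroup (A n))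
  (d : ∀ n, A n →+ A (n + 1)) (tA : ∀ n, A n →+ A n)
  (S_t : ∀ n, ∀ a ∈ S n, tA n a ∈ S n)
  (d_t : ∀ n a, d n (tA n a) = tA (n + 1) (d n a))

include S_t d_t

/-- The cohomology of the augmentation of the first row. -/
lemma row (α : ∀ n, A n →+ M n) (α_inj : ∀ n, Function.Injective (α n))
    (α_h : ∀ n a, X.h n (α n a) = α (n + 1) (d n a)) (α_t : ∀ n a, X.t n (α n a) = α n (tA n a))
    (α_mem : ∀ n, ∀ a ∈ S n, α n a ∈ X.D n 0 ∧ X.v n (α n a) = 0)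
    (α_exact : ∀ n, ∀ x ∈ X.D n 0, X.v n x = 0 → ∃ a ∈ S n, α n a = x) (n : ℕ) :
    SubquotientIso (cocyc S d (n + 1)) (cobound S d (n + 1)) (tA (n + 1))
      (X.diagKer n 0) (X.sumKer n 0) (X.t n) := by
  -- The connecting relation: the image of a cocycle in the first row is h-closed, hence equal to h
  -- y for some y one step to the left.
  refine ⟨⟨⟨⟨{x | (x.1 ∈ cocyc S d (n + 1) ∧ x.2 ∈ X.diagKer n 0) ∧
    α (n + 1) x.1 = X.h n x.2}, ?_⟩, ?_⟩, ?_⟩, ?_, ?_, ?_, ?_, ?_⟩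
  · rintro ⟨a, b⟩ ⟨a', b'⟩ ⟨⟨h1, h2⟩, h3⟩ ⟨⟨h4, h5⟩, h6⟩
    exact ⟨⟨add_mem h1 h4, add_mem h2 h5⟩, by simp_all⟩
  · exact ⟨⟨zero_mem _, zero_mem _⟩, by simp⟩
  · rintro ⟨a, b⟩ ⟨⟨h1, h2⟩, h3⟩
    exact ⟨⟨neg_mem h1, neg_mem h2⟩, by simp_all⟩
  · exact fun a b h => h.1
  · intro a ha
    obtain ⟨y, hy, h⟩ := X.exact_h (α_mem _ a ha.1).1 (by
      rw [α_h, show d (n + 1) a = 0 from ha.2, map_zero])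
    exact ⟨y, ⟨ha, hy, by simp [X.h_v, h, (α_mem _ a ha.1).2]⟩, h.symm⟩
  · intro y hy
    obtain ⟨a, ha, h⟩ := α_exact _ _ (X.h_mem hy.1) (by rw [← X.h_v]; exact hy.2)
    refine ⟨a, ⟨⟨ha, ?_⟩, hy⟩, h⟩
    apply α_inj
    rw [← α_h, h, X.h_h, map_zero]
  · rintro x y ⟨⟨hx, hy⟩, hxy⟩
    dsimp only at hx hy hxy
    simp only [mem_sumKer, mem_cobound_succ]
    constructor
    · rintro ⟨w, hw, rfl⟩
      refine ⟨y - α n w, ⟨sub_mem hy.1 (α_mem _ w hw).1, ?_⟩, α n w, α_mem _ w hw, by abel⟩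
      rw [map_sub, ← hxy, α_h, sub_self]
    · rintro ⟨a, ⟨ha, ha'⟩, b, ⟨hb, hb'⟩, rfl⟩
      obtain ⟨c, hc, rfl⟩ := α_exact _ _ hb hb'
      refine ⟨c, hc, α_inj _ ?_⟩
      rw [← α_h, hxy, map_add, ha', zero_add]
  · rintro x y ⟨⟨hx, hy⟩, hxy⟩
    dsimp only at hx hy hxy
    refine ⟨⟨⟨S_t _ _ hx.1, ?_⟩, X.t_mem hy.1, ?_⟩, ?_⟩
    · have : d (n + 1) x = 0 := hx.2
      change d (n + 1) (tA (n + 1) x) = 0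
      rw [d_t, this, map_zero]
    · have := hy.2
      simp_all [X.h_t, X.v_t]
    · simp only [← α_t, hxy, X.h_t]

end Augmentations

section

variable {J : Type*} [AddCommGroup J] (S : ℕ → AddSubgroup J) (d tJ : J →+ J)
  (S_t : ∀ n, ∀ a ∈ S n, tJ a ∈ S n)
  (d_t : ∀ a, d (tJ a) = tJ (d a))

include S_t d_t

/-- The cohomology of the augmentation of the first column. -/
lemma column (α : J →+ M 0) (α_inj : Function.Injective α)
    (α_v : ∀ a, X.v 0 (α a) = α (d a)) (α_t : ∀ a, X.t 0 (α a) = α (tJ a))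
    (α_mem : ∀ n, ∀ a ∈ S n, α a ∈ X.D 0 n ∧ X.h 0 (α a) = 0)
    (α_exact : ∀ n, ∀ x ∈ X.D 0 n, X.h 0 x = 0 → ∃ a ∈ S n, α a = x) (n : ℕ) :
    SubquotientIso (cocyc S (fun _ => d) (n + 1)) (cobound S (fun _ => d) (n + 1)) tJ
      (X.diagKer 0 n) (X.sumKer 0 n) (X.t 0) := by
  refine ⟨⟨⟨⟨{x | (x.1 ∈ cocyc S (fun _ => d) (n + 1) ∧ x.2 ∈ X.diagKer 0 n) ∧
    α x.1 = X.v 0 x.2}, ?_⟩, ?_⟩, ?_⟩, ?_, ?_, ?_, ?_, ?_⟩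
  · rintro ⟨a, b⟩ ⟨a', b'⟩ ⟨⟨h1, h2⟩, h3⟩ ⟨⟨h4, h5⟩, h6⟩
    exact ⟨⟨add_mem h1 h4, add_mem h2 h5⟩, by simp_all⟩
  · exact ⟨⟨zero_mem _, zero_mem _⟩, by simp⟩
  · rintro ⟨a, b⟩ ⟨⟨h1, h2⟩, h3⟩
    exact ⟨⟨neg_mem h1, neg_mem h2⟩, by simp_all⟩
  · exact fun a b h => h.1
  · intro a ha
    obtain ⟨y, hy, h⟩ := X.exact_v (α_mem _ a ha.1).1 (by
      rw [α_v, show d a = 0 from ha.2, map_zero])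
    exact ⟨y, ⟨ha, hy, by simp [h, (α_mem _ a ha.1).2]⟩, h.symm⟩
  · intro y hy
    obtain ⟨a, ha, h⟩ := α_exact _ _ (X.v_mem hy.1) hy.2
    refine ⟨a, ⟨⟨ha, ?_⟩, hy⟩, h⟩
    apply α_inj
    rw [← α_v, h, X.v_v, map_zero]
  · rintro x y ⟨⟨hx, hy⟩, hxy⟩
    dsimp only at hx hy hxy
    simp only [mem_sumKer, mem_cobound_succ]
    constructor
    · rintro ⟨w, hw, rfl⟩
      refine ⟨α w, α_mem _ w hw, y - α w, ⟨sub_mem hy.1 (α_mem _ w hw).1, ?_⟩, by abel⟩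
      rw [map_sub, ← hxy, α_v, sub_self]
    · rintro ⟨a, ⟨ha, ha'⟩, b, ⟨hb, hb'⟩, rfl⟩
      obtain ⟨c, hc, rfl⟩ := α_exact _ _ ha ha'
      refine ⟨c, hc, α_inj ?_⟩
      rw [← α_v, hxy, map_add, hb', add_zero]
  · rintro x y ⟨⟨hx, hy⟩, hxy⟩
    dsimp only at hx hy hxy
    refine ⟨⟨⟨S_t _ _ hx.1, ?_⟩, X.t_mem hy.1, ?_⟩, ?_⟩
    · have : d x = 0 := hx.2
      change d (tJ x) = 0
      rw [d_t, this, map_zero]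
    · have := hy.2
      simp_all [X.h_t, X.v_t]
    · simp only [← α_t, hxy, X.v_t]

end

/-- In a double complex with exact rows and columns, the augmentations of the first row and of the
first column have the same cohomology. -/
lemma row_column {A : ℕ → Type*} [∀ n, AddCommGroup (A n)] (S : ∀ n, AddSubgroup (A n))
    (d : ∀ n, A n →+ A (n + 1)) (tA : ∀ n, A n →+ A n)
    (S_t : ∀ n, ∀ a ∈ S n, tA n a ∈ S n) (d_t : ∀ n a, d n (tA n a) = tA (n + 1) (d n a))
    (α : ∀ n, A n →+ M n) (α_inj : ∀ n, Function.Injective (α n))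
    (α_h : ∀ n a, X.h n (α n a) = α (n + 1) (d n a)) (α_t : ∀ n a, X.t n (α n a) = α n (tA n a))
    (α_mem : ∀ n, ∀ a ∈ S n, α n a ∈ X.D n 0 ∧ X.v n (α n a) = 0)
    (α_exact : ∀ n, ∀ x ∈ X.D n 0, X.v n x = 0 → ∃ a ∈ S n, α n a = x)
    {J : Type*} [AddCommGroup J] (SJ : ℕ → AddSubgroup J) (dJ tJ : J →+ J)
    (SJ_t : ∀ n, ∀ a ∈ SJ n, tJ a ∈ SJ n) (dJ_t : ∀ a, dJ (tJ a) = tJ (dJ a))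
    (β : J →+ M 0) (β_inj : Function.Injective β)
    (β_v : ∀ a, X.v 0 (β a) = β (dJ a)) (β_t : ∀ a, X.t 0 (β a) = β (tJ a))
    (β_mem : ∀ n, ∀ a ∈ SJ n, β a ∈ X.D 0 n ∧ X.h 0 (β a) = 0)
    (β_exact : ∀ n, ∀ x ∈ X.D 0 n, X.h 0 x = 0 → ∃ a ∈ SJ n, β a = x) (n : ℕ) :
    SubquotientIso (cocyc S d n) (cobound S d n) (tA n)
      (cocyc SJ (fun _ => dJ) n) (cobound SJ (fun _ => dJ) n) tJ := by
  -- In degree 0 there is no zigzag: both kinds of cocycles are the elements of the corner killed by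
  -- h and v.
  rcases n with _ | n
  · refine ⟨⟨⟨⟨{x | (x.1 ∈ cocyc S d 0 ∧ x.2 ∈ cocyc SJ (fun _ => dJ) 0) ∧
      α 0 x.1 = β x.2}, ?_⟩, ?_⟩, ?_⟩, ?_, ?_, ?_, ?_, ?_⟩
    · rintro ⟨a, b⟩ ⟨a', b'⟩ ⟨⟨h1, h2⟩, h3⟩ ⟨⟨h4, h5⟩, h6⟩
      exact ⟨⟨add_mem h1 h4, add_mem h2 h5⟩, by simp_all⟩
    · exact ⟨⟨zero_mem _, zero_mem _⟩, by simp⟩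
    · rintro ⟨a, b⟩ ⟨⟨h1, h2⟩, h3⟩
      exact ⟨⟨neg_mem h1, neg_mem h2⟩, by simp_all⟩
    · exact fun a b h => h.1
    · intro a ha
      obtain ⟨b, hb, h⟩ := β_exact 0 _ (α_mem 0 a ha.1).1
        (by rw [α_h, show d 0 a = 0 from ha.2, map_zero])
      refine ⟨b, ⟨ha, hb, β_inj ?_⟩, h.symm⟩
      rw [← β_v, h, (α_mem 0 a ha.1).2, map_zero]
    · intro b hb
      obtain ⟨a, ha, h⟩ := α_exact 0 _ (β_mem 0 b hb.1).1
        (by rw [β_v, show dJ b = 0 from hb.2, map_zero])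
      refine ⟨a, ⟨⟨ha, α_inj _ ?_⟩, hb⟩, h⟩
      rw [← α_h, h, (β_mem 0 b hb.1).2, map_zero]
    · rintro x y ⟨-, hxy⟩
      dsimp only at hxy
      rw [mem_cobound_zero, mem_cobound_zero]
      constructor
      · rintro rfl
        exact β_inj (by rw [← hxy, map_zero, map_zero])
      · rintro rfl
        exact α_inj 0 (by rw [hxy, map_zero, map_zero])
    · rintro x y ⟨⟨hx, hy⟩, hxy⟩
      dsimp only at hx hy hxy
      refine ⟨⟨⟨S_t _ _ hx.1, ?_⟩, SJ_t _ _ hy.1, ?_⟩, ?_⟩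
      · change d 0 (tA 0 x) = 0
        rw [d_t, show d 0 x = 0 from hx.2, map_zero]
      · change dJ (tJ y) = 0
        rw [dJ_t, show dJ y = 0 from hy.2, map_zero]
      · simp only [← α_t, ← β_t, hxy]
  · exact ((X.row S d tA S_t d_t α α_inj α_h α_t α_mem α_exact n).trans
      (X.diagKer_antidiagonal n n 0 rfl)).trans
      (X.column SJ dJ tJ SJ_t dJ_t β β_inj β_v β_t β_mem β_exact n).symm

end ExactDouble

/-! ### Homogeneous cochains of a set -/

section HomogeneousCochains

variable (S : Type*) (V : Type*) [AddCommGroup V]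

/-- The coboundary of functions on tuples of elements of a set. -/
def tupleD (n : ℕ) : ((Fin (n + 1) → S) → V) →+ ((Fin (n + 1 + 1) → S) → V) where
  toFun φ x := ∑ i : Fin (n + 2), (-1 : ℤ) ^ (i : ℕ) • φ fun j => x (i.succAbove j)
  map_zero' := by ext; simp
  map_add' φ ψ := by ext; simp [Finset.sum_add_distrib]

variable {S V}

lemma tupleD_apply (n : ℕ) (φ : (Fin (n + 1) → S) → V) (x : Fin (n + 2) → S) :
    tupleD S V n φ x = ∑ i : Fin (n + 2), (-1 : ℤ) ^ (i : ℕ) • φ fun j => x (i.succAbove j) := rfl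

lemma tupleD_zero_apply (φ : (Fin (0 + 1) → S) → V) (x : Fin (0 + 2) → S) :
    tupleD S V 0 φ x = φ (fun _ => x 1) - φ fun _ => x 0 := by
  have h (i : Fin 2) : (fun j : Fin (0 + 1) => x (i.succAbove j)) = fun _ => x (i.succAbove 0) := by
    funext j
    rw [show j = 0 from Fin.fin_one_eq_zero j]
  rw [tupleD_apply, Fin.sum_univ_two, h, h]
  simp only [Fin.val_zero, pow_zero, one_smul, Fin.val_one, pow_one, neg_smul]
  exact (sub_eq_add_neg _ _).symm

/-- Two entries can be omitted in two orders. The involution exchanging the orders pairs equal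
values with opposite signs. -/
lemma tupleD_tupleD (n : ℕ) (φ : (Fin (n + 1) → S) → V) :
    tupleD S V (n + 1) (tupleD S V n φ) = 0 := by
  funext x
  change ∑ i : Fin (n + 3), (-1 : ℤ) ^ (i : ℕ) • ∑ l : Fin (n + 2), (-1 : ℤ) ^ (l : ℕ) •
    φ (fun j => x (i.succAbove (l.succAbove j))) = 0
  simp only [Finset.smul_sum, smul_smul, ← pow_add]
  rw [← Finset.univ.sum_product' Finset.univ
    (fun (i : Fin (n + 3)) (l : Fin (n + 2)) => (-1 : ℤ) ^ ((i : ℕ) + (l : ℕ)) •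
      φ (fun j => x (i.succAbove (l.succAbove j))))]
  refine Finset.sum_involution (fun p _ => (p.1.succAbove p.2, p.2.predAbove p.1)) ?_ ?_ ?_ ?_
  · rintro ⟨i, l⟩ -
    dsimp only
    have h : ∀ j, (i.succAbove l).succAbove ((l.predAbove i).succAbove j) =
        i.succAbove (l.succAbove j) := fun j =>
      Fin.succAbove_succAbove_succAbove_predAbove i l j
    simp only [h, ← add_smul]
    have : (-1 : ℤ) ^ ((i : ℕ) + l) +
        (-1 : ℤ) ^ (((i.succAbove l : Fin (n + 3)) : ℕ) + (l.predAbove i : Fin (n + 2))) = 0 := by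
      rcases lt_or_ge l.castSucc i with h | h
      · rw [Fin.succAbove_of_castSucc_lt _ _ h, Fin.predAbove_of_castSucc_lt _ _ h]
        have h' : (l : ℕ) < i := h
        obtain ⟨m, hm⟩ : ∃ m, (i : ℕ) = m + 1 := ⟨i - 1, by omega⟩
        simp only [Fin.val_castSucc, Fin.val_pred, hm]
        simp only [Nat.add_sub_cancel]
        ring
      · rw [Fin.succAbove_of_le_castSucc _ _ h, Fin.predAbove_of_le_castSucc _ _ h]
        simp only [Fin.val_succ, Fin.coe_castPred]
        ring
    rw [this, zero_smul]
  · rintro ⟨i, l⟩ - - h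
    exact Fin.succAbove_ne i l (congrArg Prod.fst h)
  · simp
  · rintro ⟨i, l⟩ -
    exact Prod.ext (Fin.succAbove_succAbove_predAbove i l) (Fin.predAbove_predAbove_succAbove i l)

/-- The cone construction: inserting a fixed element at the front contracts the coboundary. -/
lemma tupleD_cons (n : ℕ) (φ : (Fin (n + 1 + 1) → S) → V) (s : S) (x : Fin (n + 2) → S) :
    tupleD S V (n + 1) φ (Fin.cons s x) =
      φ x - tupleD S V n (fun y => φ (Fin.cons s y)) x := by
  have h : ∀ i : Fin (n + 2), (fun j => (Fin.cons s x : Fin (n + 3) → S) (i.succ.succAbove j)) =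
      Fin.cons s fun j => x (i.succAbove j) := by
    intro i
    funext j
    refine Fin.cases ?_ (fun j => ?_) j
    · simp
    · simp [Fin.succ_succAbove_succ]
  rw [tupleD_apply, Fin.sum_univ_succ]
  simp only [h, tupleD_apply, Fin.val_succ, pow_succ, mul_neg_one, neg_smul, Finset.sum_neg_distrib]
  simp [sub_eq_add_neg]

end HomogeneousCochains

/-- Data that exhibit the functions on a set of cells, graded by the degree of a cell, as an acyclic
resolution of `ℤ` by modules over the group `H`, together with a compatible endomorphism. -/
structure CellResolution (H S Cell : Type*) [Group H] [MulAction H S] where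
  ρ : H →* AddMonoid.End (Cell → ℤ)
  d : (Cell → ℤ) →+ (Cell → ℤ)
  dim : Cell → ℕ
  base : Cell
  base_dim : dim base = 0
  pos : Cell → S
  frame : S → H
  T : (Cell → ℤ) →+ (Cell → ℤ)
  tS : S → S
  β : H → H
  d_d : ∀ f, d (d f) = 0
  d_supp : ∀ f n, (∀ c, dim c ≠ n → f c = 0) → ∀ c, dim c ≠ n + 1 → d f c = 0
  ρ_supp : ∀ h f n, (∀ c, dim c ≠ n → f c = 0) → ∀ c, dim c ≠ n → ρ h f c = 0
  T_supp : ∀ f n, (∀ c, dim c ≠ n → f c = 0) → ∀ c, dim c ≠ n → T f c = 0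
  ρ_d : ∀ h f, ρ h (d f) = d (ρ h f)
  T_d : ∀ f, T (d f) = d (T f)
  exact : ∀ f n, (∀ c, dim c ≠ n + 1 → f c = 0) → d f = 0 →
    ∃ g, (∀ c, dim c ≠ n → g c = 0) ∧ d g = f
  exact_zero : ∀ f, (∀ c, dim c ≠ 0 → f c = 0) → d f = 0 → ∀ c, dim c = 0 → f c = f base
  d_one : d (fun c => if dim c = 0 then 1 else 0) = 0
  ρ_one : ∀ h, ρ h (fun c => if dim c = 0 then 1 else 0) = fun c => if dim c = 0 then 1 else 0
  T_one : T (fun c => if dim c = 0 then 1 else 0) = fun c => if dim c = 0 then 1 else 0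
  -- Locality ties a value of a translated function to a value at one translated cell. It is what
  -- makes insertion of `pos c` into a tuple an equivariant operation.
  ρ_local : ∀ h c, ∃ c' : Cell, ∃ ε : ℤ, pos c' = h⁻¹ • pos c ∧ ∀ f, ρ h f c = ε * f c'
  frame_smul : ∀ h s, frame (h • s) = h * frame s
  tS_smul : ∀ h s, tS (h • s) = β h • tS s
  T_ρ : ∀ h f, T (ρ (β h) f) = ρ h (T f)

namespace CellResolution

variable {H S Cell : Type*} [Group H] [MulAction H S] (R : CellResolution H S Cell)

/-- The functions supported on the cells of dimension `n`. -/
def deg (n : ℕ) : AddSubgroup (Cell → ℤ) where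
  carrier := {f | ∀ c, R.dim c ≠ n → f c = 0}
  zero_mem' _ _ := rfl
  add_mem' h h' c hc := by simp [h c hc, h' c hc]
  neg_mem' h c hc := by simp [h c hc]

/-- The invariant functions supported on the cells of dimension `n`. -/
def inv (n : ℕ) : AddSubgroup (Cell → ℤ) where
  carrier := {f | f ∈ R.deg n ∧ ∀ h, R.ρ h f = f}
  zero_mem' := ⟨zero_mem _, fun h => map_zero _⟩
  add_mem' h h' := ⟨add_mem h.1 h'.1, fun g => by rw [map_add, h.2, h'.2]⟩
  neg_mem' h := ⟨neg_mem h.1, fun g => by rw [map_neg, h.2]⟩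

/-- The constant function on the cells of dimension `0`. -/
def one : Cell → ℤ := fun c => if R.dim c = 0 then 1 else 0

/-- The double complex of equivariant cochains with values in the resolution. -/
def double : ExactDouble fun q => (Fin (q + 1) → S) → (Cell → ℤ) where
  D q s :=
    { carrier := {φ | (∀ x, φ x ∈ R.deg s) ∧ ∀ h x, φ (fun i => h • x i) = R.ρ h (φ x)}
      zero_mem' := ⟨fun x => zero_mem _, fun h x => (map_zero (R.ρ h)).symm⟩
      add_mem' := fun h h' => ⟨fun x => add_mem (h.1 x) (h'.1 x), fun g x => by
        simp only [Pi.add_apply, h.2 g x, h'.2 g x, map_add]⟩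
      neg_mem' := fun h => ⟨fun x => neg_mem (h.1 x), fun g x => by
        simp only [Pi.neg_apply, h.2 g x, map_neg]⟩ }
  h q := tupleD S _ q
  v q := R.d.compLeft _
  t q := AddMonoidHom.mk' (fun φ x => R.T (φ fun i => R.tS (x i))) fun φ ψ => by ext; simp
  h_mem {q s φ} h := by
    refine ⟨fun x => ?_, fun g x => ?_⟩
    · rw [tupleD_apply]
      exact sum_mem fun i _ => zsmul_mem (h.1 _) _
    · simp only [tupleD_apply, map_sum, map_zsmul]
      exact Finset.sum_congr rfl fun i _ => congrArg _ (h.2 g _)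
  v_mem {q s φ} h := ⟨fun x => R.d_supp _ _ (h.1 x), fun g x => by
    simp [h.2 g x, R.ρ_d]⟩
  t_mem {q s φ} h := ⟨fun x => R.T_supp _ _ (h.1 _), fun g x => by
    simp only [AddMonoidHom.mk'_apply, R.tS_smul]
    rw [h.2 (R.β g) fun i => R.tS (x i), R.T_ρ]⟩
  h_h q φ := tupleD_tupleD q φ
  v_v q φ := by funext x; exact R.d_d _
  h_v q φ := by
    funext x
    simp only [AddMonoidHom.compLeft_apply, Function.comp_apply, tupleD_apply, map_sum, map_zsmul]
  h_t q φ := by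
    funext x
    simp only [AddMonoidHom.mk'_apply, tupleD_apply, map_sum, map_zsmul]
  v_t q φ := by funext x; exact (R.T_d _).symm
  exact_h {q s φ} h h0 := by
    -- The cone contraction with an apex that depends on the cell at which the value is read. A
    -- fixed apex would destroy equivariance; the apex `pos c` moves along with the cell.
    refine ⟨fun x c => φ (Fin.cons (R.pos c) x) c, ⟨fun x c hc => h.1 _ c hc, fun g x => ?_⟩, ?_⟩
    · funext c
      obtain ⟨c', ε, h1, h2⟩ := R.ρ_local g c
      rw [h2]
      dsimp only
      rw [h1]
      have := h.2 g (Fin.cons (g⁻¹ • R.pos c) x)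
      rw [← h2, ← this]
      congr 2
      funext i
      refine Fin.cases ?_ (fun i => ?_) i <;> simp
    · funext x c
      have := congrFun (congrFun h0 (Fin.cons (R.pos c) x)) c
      rw [tupleD_cons] at this
      rw [Pi.zero_apply, Pi.zero_apply, Pi.sub_apply, sub_eq_zero] at this
      rw [this]
      simp [tupleD_apply]
  exact_v {q s φ} h h0 := by
    -- A primitive is chosen for each closed cellular cochain with no regard to the group. The
    -- default 0 covers the cochains that are not closed of the right degree.
    have hw : ∀ f : Cell → ℤ, ∃ g : Cell → ℤ, f ∈ R.deg (s + 1) → R.d f = 0 →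
        g ∈ R.deg s ∧ R.d g = f := by
      intro f
      by_cases hf : f ∈ R.deg (s + 1) ∧ R.d f = 0
      · obtain ⟨g, hg⟩ := R.exact f s hf.1 hf.2
        exact ⟨g, fun _ _ => hg⟩
      · exact ⟨0, fun h1 h2 => (hf ⟨h1, h2⟩).elim⟩
    choose w hw using hw
    have h1 : ∀ (g : H) x, R.ρ g (φ x) ∈ R.deg (s + 1) := fun g x => R.ρ_supp g _ _ (h.1 x)
    have h2 : ∀ (g : H) x, R.d (R.ρ g (φ x)) = 0 := fun g x => by
      rw [← R.ρ_d, show R.d (φ x) = 0 from congrFun h0 x, map_zero]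
    have h3 : ∀ (g g' : H) f, R.ρ g (R.ρ g' f) = R.ρ (g * g') f := fun g g' f => by
      rw [map_mul]; rfl
    -- Equivariance is forced by moving the first entry of the tuple to standard position, taking
    -- the chosen primitive there, and moving back.
    refine ⟨fun x => R.ρ (R.frame (x 0)) (w (R.ρ (R.frame (x 0))⁻¹ (φ x))), ⟨fun x =>
      R.ρ_supp _ _ _ (hw _ (h1 _ _) (h2 _ _)).1, fun g x => ?_⟩, ?_⟩
    · simp only [R.frame_smul]
      rw [h.2, h3, h3]
      simp
    · funext x
      change R.d (R.ρ _ _) = _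
      rw [← R.ρ_d, (hw _ (h1 _ _) (h2 _ _)).2, h3]
      simp

/-- The invariant homogeneous cochains with integer values. -/
def tupleInv (H S : Type*) [Group H] [MulAction H S] (n : ℕ) :
    AddSubgroup ((Fin (n + 1) → S) → ℤ) where
  carrier := {f | ∀ (h : H) x, f (fun i => h • x i) = f x}
  zero_mem' _ _ := rfl
  add_mem' h h' g x := by simp [h g x, h' g x]
  neg_mem' h g x := by simp [h g x]

/-- The endomorphism of the homogeneous cochains induced by a map of the underlying set. -/
def tupleMap {S : Type*} (t : S → S) (n : ℕ) :
    ((Fin (n + 1) → S) → ℤ) →+ ((Fin (n + 1) → S) → ℤ) :=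
  AddMonoidHom.mk' (fun f x => f fun i => t (x i)) fun _ _ => rfl

/-- The homogeneous cochains and the invariants of the resolution have the same cohomology. -/
theorem cohomology (n : ℕ) :
    SubquotientIso (cocyc (tupleInv H S) (tupleD S ℤ) n) (cobound (tupleInv H S) (tupleD S ℤ) n)
      (tupleMap R.tS n) (cocyc R.inv (fun _ => R.d) n) (cobound R.inv (fun _ => R.d) n) R.T := by
  have hone : ∀ a : ℤ, a • R.one ∈ R.deg 0 := fun a c hc => by simp [one, hc]
  -- The row augmentation sends an integer-valued function to its multiples of the constant
  -- 0-cochain; the column augmentation regards a cellular cochain as constant in the point of S.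
  refine R.double.row_column (tupleInv H S) (tupleD S ℤ) (tupleMap R.tS) ?_ ?_
    (fun n => AddMonoidHom.mk' (fun f x => f x • R.one) fun f g => by ext; simp [add_mul])
    ?_ ?_ ?_ ?_ ?_ R.inv R.d R.T ?_ ?_
    (AddMonoidHom.mk' (fun f _ => f) fun _ _ => rfl) ?_ ?_ ?_ ?_ ?_ n
  · intro n f hf h x
    change f _ = f _
    simp only [R.tS_smul]
    exact hf (R.β h) _
  · intro n f
    funext x
    simp [tupleD_apply, tupleMap]
  · intro n f g h
    funext x
    have := congrFun (congrFun h x) R.base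
    simpa [one, R.base_dim] using this
  · intro n f
    funext x
    simp only [double, AddMonoidHom.mk'_apply, tupleD_apply, Finset.sum_smul, smul_smul,
      smul_eq_mul]
  · intro n f
    funext x
    simp only [double, AddMonoidHom.mk'_apply, tupleMap, map_zsmul]
    exact congrArg _ R.T_one
  · intro n f hf
    refine ⟨⟨fun x => hone _, fun h x => ?_⟩, ?_⟩
    · simp only [AddMonoidHom.mk'_apply, map_zsmul, hf h x]
      exact congrArg _ (R.ρ_one h).symm
    · funext x
      change R.d (f x • R.one) = 0
      rw [map_zsmul, show R.d R.one = 0 from R.d_one, smul_zero]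
  · intro n φ hφ h0
    have key : ∀ x, φ x = φ x R.base • R.one := by
      intro x
      funext c
      by_cases hc : R.dim c = 0
      · simpa [one, hc] using R.exact_zero _ (hφ.1 x) (congrFun h0 x) c hc
      · simpa [one, hc] using hφ.1 x c hc
    refine ⟨fun x => φ x R.base, fun h x => ?_, funext fun x => (key x).symm⟩
    dsimp only
    rw [hφ.2 h x, key x, map_zsmul]
    have : R.ρ h R.one = R.one := R.ρ_one h
    rw [this]
  · intro n f hf
    refine ⟨R.T_supp _ _ hf.1, fun h => ?_⟩
    rw [← R.T_ρ, hf.2]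
  · exact fun f => (R.T_d f).symm
  · exact fun f g h => congrFun h fun _ => R.pos R.base
  · exact fun f => rfl
  · exact fun f => rfl
  · intro n f hf
    refine ⟨⟨fun x => hf.1, fun h x => (hf.2 h).symm⟩, ?_⟩
    funext x
    simp [double, tupleD_zero_apply]
  · intro n φ hφ h0
    -- Closedness makes the value at `c` independent of the point, so it may be read at `pos c`. The
    -- formula for the invariant cochain then mentions no chosen point.
    have key : ∀ x, φ x = fun c => φ (fun _ => R.pos c) c := by
      intro x
      funext c
      have := congrFun (congrFun h0 (Fin.cons (R.pos c) x)) c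
      simp only [double, tupleD_zero_apply, Fin.cons_zero] at this
      have e1 : (fun _ : Fin 1 => (Fin.cons (R.pos c) x : Fin 2 → S) 1) = x := by
        funext j
        obtain rfl : j = 0 := Subsingleton.elim _ _
        rfl
      rw [e1] at this
      simpa [sub_eq_zero] using this
    refine ⟨fun c => φ (fun _ => R.pos c) c, ⟨?_, fun h => ?_⟩, ?_⟩
    · rw [← key fun _ => R.pos R.base]
      exact hφ.1 _
    · conv_lhs => rw [← key fun _ => R.pos R.base]
      rw [← hφ.2]
      exact key _
    · funext x
      exact (key x).symm

end CellResolution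

/-! ### Cubical cochains of the integral lattice

The cubes of the standard cubulation of `ℝⁿ` are encoded by their barycentres, multiplied by two:
the directions of the cube are the odd coordinates. -/

/-- The discrete antiderivative of a function on `ℤ` that vanishes at `0`. -/
def antidiff (g : ℤ → ℤ) : ℤ → ℤ
  | Int.ofNat n => ∑ k ∈ Finset.range n, g k
  | Int.negSucc n => -∑ k ∈ Finset.range (n + 1), g (-(k + 1 : ℤ))

lemma antidiff_zero (g : ℤ → ℤ) : antidiff g 0 = 0 := rfl

lemma antidiff_succ (g : ℤ → ℤ) (m : ℤ) : antidiff g (m + 1) = antidiff g m + g m := by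
  rcases m with n | n
  · change ∑ k ∈ Finset.range (n + 1), g k = _
    rw [Finset.sum_range_succ]
    rfl
  · rcases n with _ | n
    · change (0 : ℤ) = -∑ k ∈ Finset.range 1, g (-(k + 1 : ℤ)) + g (-1)
      simp
    · change -∑ k ∈ Finset.range (n + 1), g (-(k + 1 : ℤ)) =
        -∑ k ∈ Finset.range (n + 1 + 1), g (-(k + 1 : ℤ)) + g (Int.negSucc (n + 1))
      rw [Finset.sum_range_succ _ (n + 1), Int.negSucc_eq]
      abel

lemma antidiff_unique {g F : ℤ → ℤ} (h0 : F 0 = 0) (h : ∀ m, F (m + 1) = F m + g m) (m : ℤ) :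
    antidiff g m = F m := by
  induction m using Int.induction_on with
  | zero => rw [h0, antidiff_zero]
  | succ n ih => rw [antidiff_succ, h, ih]
  | pred n ih =>
    have h1 := antidiff_succ g (-n - 1)
    have h2 := h (-n - 1)
    rw [sub_add_cancel] at h1 h2
    linarith

namespace Cubical

variable {n : ℕ}

/-- The number of directions of a cube. -/
def dim (c : Fin n → ℤ) : ℕ := (Finset.univ.filter fun i => Odd (c i)).card

/-- The sign of the `j`-th direction of a cube. -/
def sign (j : Fin n) (c : Fin n → ℤ) : ℤ :=
  ∏ k ∈ Finset.univ.filter (· < j), if Odd (c k) then -1 else 1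

lemma sign_mul_self (j : Fin n) (c : Fin n → ℤ) : sign j c * sign j c = 1 := by
  rw [sign, ← Finset.prod_mul_distrib]
  refine Finset.prod_eq_one fun k _ => ?_
  split <;> rfl

lemma sign_update_of_le {i j : Fin n} (h : j ≤ i) (c : Fin n → ℤ) (a : ℤ) :
    sign j (Function.update c i a) = sign j c := by
  refine Finset.prod_congr rfl fun k hk => ?_
  have : k ≠ i := (lt_of_lt_of_le (Finset.mem_filter.1 hk).2 h).ne
  rw [Function.update_of_ne this]

lemma sign_update_of_lt {i j : Fin n} (h : i < j) (c : Fin n → ℤ) (a : ℤ)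
    (ha : Odd a ↔ ¬Odd (c i)) : sign j (Function.update c i a) = -sign j c := by
  have hi : i ∈ Finset.univ.filter (· < j) := by simpa using h
  rw [sign, sign, ← Finset.mul_prod_erase _ _ hi, ← Finset.mul_prod_erase _ _ hi]
  have : ∀ k ∈ (Finset.univ.filter (· < j)).erase i,
      (if Odd (Function.update c i a k) then (-1 : ℤ) else 1) = if Odd (c k) then -1 else 1 :=
    fun k hk => by rw [Function.update_of_ne (Finset.ne_of_mem_erase hk)]
  rw [Finset.prod_congr rfl this, Function.update_self]
  by_cases h1 : Odd (c i) <;> simp [ha, h1]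

lemma dim_update_of_odd {i : Fin n} {c : Fin n → ℤ} {a : ℤ} (hc : Odd (c i)) (ha : ¬Odd a) :
    dim (Function.update c i a) + 1 = dim c := by
  have h : (Finset.univ.filter fun j => Odd (Function.update c i a j)) =
      (Finset.univ.filter fun j => Odd (c j)).erase i := by
    ext j
    by_cases hj : j = i
    · subst hj; simp [ha]
    · simp [hj]
  rw [dim, dim, h, Finset.card_erase_add_one (by simpa using hc)]

lemma dim_update_of_even {i : Fin n} {c : Fin n → ℤ} {a : ℤ} (hc : ¬Odd (c i)) (ha : Odd a) :
    dim (Function.update c i a) = dim c + 1 := by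
  rw [← dim_update_of_odd (c := Function.update c i a) (a := c i) (i := i) (by simpa using ha) hc]
  simp

/-- The partial coboundary in the direction `j`. -/
def dAxis (j : Fin n) : ((Fin n → ℤ) → ℤ) →+ ((Fin n → ℤ) → ℤ) :=
  AddMonoidHom.mk' (fun f c => if Odd (c j) then
    sign j c * (f (Function.update c j (c j + 1)) - f (Function.update c j (c j - 1))) else 0)
    fun f g => by
      ext c
      by_cases h : Odd (c j) <;> simp [h]
      ring

/-- The cubical coboundary. -/
def d : ((Fin n → ℤ) → ℤ) →+ ((Fin n → ℤ) → ℤ) := ∑ j, dAxis j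

/-- Integration in the direction `i`. -/
def contract (i : Fin n) (f : (Fin n → ℤ) → ℤ) (c : Fin n → ℤ) : ℤ :=
  if Odd (c i) then 0 else
    sign i c * antidiff (fun k => f (Function.update c i (2 * k + 1))) (c i / 2)

/-- Restriction to the hyperplane `c i = 0`, extended constantly. -/
def flatten (i : Fin n) (f : (Fin n → ℤ) → ℤ) (c : Fin n → ℤ) : ℤ :=
  if Odd (c i) then 0 else f (Function.update c i 0)

lemma dAxis_apply (j : Fin n) (f : (Fin n → ℤ) → ℤ) (c : Fin n → ℤ) :
    dAxis j f c = if Odd (c j) then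
      sign j c * (f (Function.update c j (c j + 1)) - f (Function.update c j (c j - 1))) else 0 :=
  rfl

lemma d_apply (f : (Fin n → ℤ) → ℤ) (c : Fin n → ℤ) : d f c = ∑ j, dAxis j f c := by
  simp [d]

lemma odd_succ_iff (a : ℤ) : Odd (a + 1) ↔ ¬Odd a := by
  rw [Int.odd_iff, Int.odd_iff]; omega

lemma odd_pred_iff (a : ℤ) : Odd (a - 1) ↔ ¬Odd a := by
  rw [Int.odd_iff, Int.odd_iff]; omega

lemma dAxis_self (j : Fin n) (f : (Fin n → ℤ) → ℤ) : dAxis j (dAxis j f) = 0 := by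
  funext c
  by_cases h : Odd (c j)
  · simp [dAxis_apply, Int.not_even_iff_odd.2 h]
  · simp [dAxis_apply, h]

/-- Removing direction i changes the number of directions before j by one, hence flips the sign of
j, while the sign of i does not see j. -/
lemma dAxis_comm_of_lt {i j : Fin n} (hij : i < j) (f : (Fin n → ℤ) → ℤ) :
    dAxis i (dAxis j f) = -dAxis j (dAxis i f) := by
  funext c
  have h1 : j ≠ i := hij.ne'
  have h2 : i ≠ j := hij.ne
  by_cases hi : Odd (c i)
  · by_cases hj : Odd (c j)
    · simp only [dAxis_apply, hi, hj, if_true, Pi.neg_apply, Function.update_of_ne h1,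
        Function.update_of_ne h2, sign_update_of_lt hij c _ (odd_succ_iff _),
        sign_update_of_lt hij c _ (odd_pred_iff _), sign_update_of_le hij.le,
        Function.update_comm h2]
      ring
    · simp [dAxis_apply, hi, hj, h1]
  · simp [dAxis_apply, hi, h2]

/-- By anticommutation of the partial coboundaries, d d equals its own negative, and ℤ has no
2-torsion. -/
lemma d_d (f : (Fin n → ℤ) → ℤ) : d (d f) = 0 := by
  have h : d (d f) = ∑ i, ∑ j, dAxis i (dAxis j f) := by
    simp only [d, AddMonoidHom.finsetSum_apply, map_sum]
    exact Finset.sum_comm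
  have h' : d (d f) = -d (d f) := by
    conv_lhs => rw [h, Finset.sum_comm]
    rw [h, ← Finset.sum_neg_distrib]
    refine Finset.sum_congr rfl fun j _ => ?_
    rw [← Finset.sum_neg_distrib]
    refine Finset.sum_congr rfl fun i _ => ?_
    rcases lt_trichotomy i j with hij | rfl | hij
    · exact dAxis_comm_of_lt hij f
    · simp [dAxis_self]
    · rw [dAxis_comm_of_lt hij f, neg_neg]
  funext c
  have := congrFun h' c
  rw [Pi.neg_apply] at this
  rw [Pi.zero_apply]
  omega

lemma dAxis_supp (j : Fin n) {f : (Fin n → ℤ) → ℤ} {m : ℕ} (hf : ∀ c, dim c ≠ m → f c = 0)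
    (c : Fin n → ℤ) (hc : dim c ≠ m + 1) : dAxis j f c = 0 := by
  by_cases h : Odd (c j)
  · have h1 : ¬Odd (c j + 1) := by simpa [odd_succ_iff] using h
    have h2 : ¬Odd (c j - 1) := by simpa [odd_pred_iff] using h
    rw [dAxis_apply, if_pos h, hf _ (by have := dim_update_of_odd h h1; omega),
      hf _ (by have := dim_update_of_odd h h2; omega)]
    simp
  · rw [dAxis_apply, if_neg h]

lemma d_supp (f : (Fin n → ℤ) → ℤ) (m : ℕ) (hf : ∀ c, dim c ≠ m → f c = 0)
    (c : Fin n → ℤ) (hc : dim c ≠ m + 1) : d f c = 0 := by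
  rw [d_apply]
  exact Finset.sum_eq_zero fun j _ => dAxis_supp j hf c hc

lemma d_one : d (fun c : Fin n → ℤ => if dim c = 0 then 1 else 0) = 0 := by
  funext c
  rw [d_apply]
  refine Finset.sum_eq_zero fun j _ => ?_
  by_cases h : Odd (c j)
  · have h1 : ¬Odd (c j + 1) := by simpa [odd_succ_iff] using h
    have h2 : ¬Odd (c j - 1) := by simpa [odd_pred_iff] using h
    have : dim (Function.update c j (c j + 1)) = dim (Function.update c j (c j - 1)) := by
      have := dim_update_of_odd h h1
      have := dim_update_of_odd h h2
      omega
    simp [dAxis_apply, this]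
  · rw [dAxis_apply, if_neg h]

/-- This is the fundamental theorem of calculus along one axis. On cubes extended in direction i,
differences undo summation; on the others, summing differences leaves the value minus the value on
the hyperplane. -/
lemma contract_dAxis_self (i : Fin n) (f : (Fin n → ℤ) → ℤ) (c : Fin n → ℤ) :
    dAxis i (contract i f) c + contract i (dAxis i f) c = f c - flatten i f c := by
  by_cases h : Odd (c i)
  · obtain ⟨m, hm⟩ := h
    have h1 : (c i + 1) / 2 = m + 1 := by omega
    have h2 : (c i - 1) / 2 = m := by omega
    have h : Odd (c i) := ⟨m, hm⟩
    simp only [dAxis_apply, contract, flatten, h, if_true, Function.update_self, odd_succ_iff,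
      odd_pred_iff, not_true, if_false, Function.update_idem, sign_update_of_le le_rfl, h1, h2,
      antidiff_succ]
    rw [← hm, Function.update_eq_self]
    linear_combination f c * sign_mul_self i c
  · have h' : ∀ k : ℤ, Odd (2 * k + 1) := fun k => ⟨k, rfl⟩
    obtain ⟨m, hm⟩ := Int.not_odd_iff_even.1 h
    have key : ∀ k, antidiff (fun k => sign i c *
        (f (Function.update c i (2 * k + 1 + 1)) - f (Function.update c i (2 * k + 1 - 1)))) k =
        sign i c * (f (Function.update c i (2 * k)) - f (Function.update c i 0)) := by
      refine antidiff_unique (by simp) fun k => ?_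
      rw [show 2 * (k + 1) = 2 * k + 1 + 1 by ring, show 2 * k + 1 - 1 = 2 * k by ring]
      ring
    simp only [dAxis_apply, contract, flatten, h, if_false, Function.update_self, h', if_true,
      sign_update_of_le le_rfl, Function.update_idem, key]
    rw [show 2 * (c i / 2) = c i by omega, Function.update_eq_self]
    linear_combination (f c - f (Function.update c i 0)) * sign_mul_self i c

/-- Along different axes, summation and difference commute up to the orientation signs. The later of
the two directions changes its sign when the earlier one is added or removed, so the two terms
cancel. -/
lemma contract_dAxis_of_ne {i j : Fin n} (hij : i ≠ j) (f : (Fin n → ℤ) → ℤ) (c : Fin n → ℤ) :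
    dAxis j (contract i f) c + contract i (dAxis j f) c = 0 := by
  by_cases hi : Odd (c i)
  · simp [contract, dAxis_apply, hij, hi]
  by_cases hj : Odd (c j)
  · have h' : ∀ k : ℤ, Odd (2 * k + 1) := fun k => ⟨k, rfl⟩
    have key : ∀ (e : ℤ) k, antidiff (fun k => e *
        (f (Function.update (Function.update c i (2 * k + 1)) j (c j + 1)) -
          f (Function.update (Function.update c i (2 * k + 1)) j (c j - 1)))) k =
        e * (antidiff (fun k => f (Function.update (Function.update c i (2 * k + 1)) j (c j + 1))) k
        - antidiff (fun k => f (Function.update (Function.update c i (2 * k + 1)) j (c j - 1)))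
          k) := by
      refine fun e => antidiff_unique (by simp [antidiff_zero]) fun k => ?_
      rw [antidiff_succ, antidiff_succ]
      ring
    rcases lt_or_gt_of_ne hij with h | h
    · have h2 : ∀ k : ℤ, sign j (Function.update c i (2 * k + 1)) = -sign j c := fun k =>
        sign_update_of_lt h c _ (by simp [hi])
      simp only [dAxis_apply, contract, Function.update_of_ne hij, Function.update_of_ne hij.symm,
        hi, hj, if_true, if_false, Function.update_comm hij.symm, sign_update_of_le h.le, h2, key]
      ring
    · simp only [dAxis_apply, contract, Function.update_of_ne hij, Function.update_of_ne hij.symm,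
        hi, hj, if_true, if_false, Function.update_comm hij.symm, sign_update_of_le h.le,
        sign_update_of_lt h c _ (odd_succ_iff _), sign_update_of_lt h c _ (odd_pred_iff _), key]
      ring
  · have key : ∀ k, antidiff (fun _ => 0) k = 0 :=
      antidiff_unique (F := fun _ => 0) rfl fun _ => rfl
    simp [contract, dAxis_apply, hij.symm, hi, hj, key]

/-- Integration along axis i is a cochain homotopy from the identity to restriction to the
hyperplane c i = 0. -/
lemma d_contract (i : Fin n) (f : (Fin n → ℤ) → ℤ) (c : Fin n → ℤ) :
    d (contract i f) c + contract i (d f) c = f c - flatten i f c := by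
  have h : contract i (d f) c = ∑ j, contract i (dAxis j f) c := by
    by_cases hi : Odd (c i)
    · simp [contract, hi]
    · simp only [contract, hi, if_false, ← Finset.mul_sum]
      congr 1
      refine antidiff_unique (F := fun m => ∑ j, antidiff
        (fun k => dAxis j f (Function.update c i (2 * k + 1))) m) (by simp [antidiff_zero])
        (fun m => ?_) _
      simp only [antidiff_succ, d_apply, Finset.sum_add_distrib]
  rw [h, d_apply, ← Finset.sum_add_distrib, ← contract_dAxis_self i f c]
  exact Finset.sum_eq_single i (fun j _ hj => contract_dAxis_of_ne hj.symm f c) (by simp)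

lemma contract_supp (i : Fin n) {f : (Fin n → ℤ) → ℤ} {m : ℕ} (hf : ∀ c, dim c ≠ m → f c = 0)
    (c : Fin n → ℤ) (hc : dim c + 1 ≠ m) : contract i f c = 0 := by
  by_cases h : Odd (c i)
  · simp [contract, h]
  · have : (fun k : ℤ => f (Function.update c i (2 * k + 1))) = fun _ => 0 := by
      funext k
      refine hf _ ?_
      rw [dim_update_of_even h ⟨k, rfl⟩]
      exact hc
    have key : ∀ k, antidiff (fun _ => 0) k = 0 :=
      antidiff_unique (F := fun _ => 0) rfl fun _ => rfl
    simp [contract, h, this, key]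

lemma flatten_supp (i : Fin n) {f : (Fin n → ℤ) → ℤ} {m : ℕ} (hf : ∀ c, dim c ≠ m → f c = 0)
    (c : Fin n → ℤ) (hc : dim c ≠ m) : flatten i f c = 0 := by
  by_cases h : Odd (c i)
  · simp [flatten, h]
  · have : dim (Function.update c i 0) = dim c := by
      have h1 := dim_update_of_odd (c := Function.update c i 1) (i := i) (a := 0) (by simp) (by simp)
      have h2 := dim_update_of_even (a := 1) h (by simp)
      simp only [Function.update_idem] at h1
      omega
    rw [flatten, if_neg h, hf _ (by rwa [this])]

/-- Every cocycle is cohomologous to a multiple of the constant function on the vertices. -/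
lemma exists_flat {f : (Fin n → ℤ) → ℤ} {m : ℕ} (hf : ∀ c, dim c ≠ m → f c = 0) (h0 : d f = 0) :
    ∃ g : (Fin n → ℤ) → ℤ, (∀ c, dim c + 1 ≠ m → g c = 0) ∧
      ∀ c, (f - d g) c = if dim c = 0 then (f - d g) 0 else 0 := by
  -- The axes are flattened one at a time; the homotopy formula changes the cocycle only by
  -- coboundaries. Once all axes are flat, nothing of positive dimension survives and the vertex
  -- values are constant.
  have key : ∀ s : Finset (Fin n), ∃ g : (Fin n → ℤ) → ℤ, (∀ c, dim c + 1 ≠ m → g c = 0) ∧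
      (∀ c, dim c ≠ m → (f - d g) c = 0) ∧ ∀ i ∈ s, ∀ c, (f - d g) c = flatten i (f - d g) c := by
    intro s
    induction s using Finset.induction_on with
    | empty => exact ⟨0, by simp, by simpa using hf, by simp⟩
    | insert i s his ih =>
      obtain ⟨g, hg, hfg, hs⟩ := ih
      have h1 : f - d (g + contract i (f - d g)) = flatten i (f - d g) := by
        funext c
        have := d_contract i (f - d g) c
        have h2 : d (f - d g) = 0 := by rw [map_sub, h0, d_d, sub_zero]
        have key : ∀ k, antidiff (fun _ => 0) k = 0 :=
          antidiff_unique (F := fun _ => 0) rfl fun _ => rfl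
        have h3 : contract i (0 : (Fin n → ℤ) → ℤ) c = 0 := by simp [contract, key]
        rw [h2, h3] at this
        rw [map_add, ← sub_sub, Pi.sub_apply]
        linarith
      refine ⟨g + contract i (f - d g), fun c hc => ?_, fun c hc => ?_, fun j hj c => ?_⟩
      · rw [Pi.add_apply, hg c hc, contract_supp i hfg c hc, add_zero]
      · rw [h1]
        exact flatten_supp i hfg c hc
      · rw [h1]
        rcases eq_or_ne j i with rfl | hji
        · by_cases hc : Odd (c j) <;> simp [flatten, hc]
        -- Flattenings along different axes commute, so the new one preserves flatness along the
        -- axes already treated.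
        · have h := hs j ((Finset.mem_insert.1 hj).resolve_left hji)
          by_cases hi : Odd (c i)
          · simp [flatten, hi, hji.symm]
          · simp only [flatten, hi, if_false, Function.update_of_ne hji.symm]
            rw [h]
            simp [flatten, Function.update_of_ne hji, Function.update_comm hji]
  obtain ⟨g, hg, -, h⟩ := key Finset.univ
  refine ⟨g, hg, fun c => ?_⟩
  split_ifs with hc
  · have hev : ∀ i, ¬Odd (c i) := by
      intro i hi
      have := Finset.card_eq_zero.1 hc
      exact Finset.notMem_empty i (this ▸ Finset.mem_filter.2 ⟨Finset.mem_univ _, hi⟩)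
    have : ∀ s : Finset (Fin n), (f - d g) c = (f - d g) (s.piecewise 0 c) := by
      intro s
      induction s using Finset.induction_on with
      | empty => simp
      | insert i s his ih =>
        have h2 : ¬Odd (s.piecewise 0 c i) := by
          rw [Finset.piecewise_eq_of_notMem _ _ _ his]; exact hev i
        rw [ih, h i (Finset.mem_univ _), flatten, if_neg h2, Finset.piecewise_insert, Pi.zero_apply]
    rw [this Finset.univ, Finset.piecewise_univ]
  · obtain ⟨i, hi⟩ := Finset.card_pos.1 (Nat.pos_of_ne_zero hc)
    rw [h i (Finset.mem_univ _), flatten, if_pos (Finset.mem_filter.1 hi).2]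

lemma exact (f : (Fin n → ℤ) → ℤ) (m : ℕ) (hf : ∀ c, dim c ≠ m + 1 → f c = 0) (h0 : d f = 0) :
    ∃ g : (Fin n → ℤ) → ℤ, (∀ c, dim c ≠ m → g c = 0) ∧ d g = f := by
  obtain ⟨g, hg, h⟩ := exists_flat hf h0
  have hg' : ∀ c, dim c ≠ m → g c = 0 := fun c hc => hg c (by omega)
  have hz : dim (0 : Fin n → ℤ) = 0 := by simp [dim]
  have h1 : (f - d g) 0 = 0 := by
    rw [Pi.sub_apply, hf _ (by omega), d_supp g m hg' _ (by omega), sub_zero]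
  refine ⟨g, hg', ?_⟩
  funext c
  have := h c
  rw [h1, ite_self, Pi.sub_apply] at this
  linarith

lemma exact_zero (f : (Fin n → ℤ) → ℤ) (hf : ∀ c, dim c ≠ 0 → f c = 0) (h0 : d f = 0)
    (c : Fin n → ℤ) (hc : dim c = 0) : f c = f 0 := by
  obtain ⟨g, hg, h⟩ := exists_flat hf h0
  obtain rfl : g = 0 := funext fun c => hg c (by omega)
  simpa [hc] using h c

end Cubical

/-! ### The action of the crystallographic group on the cubulation -/

namespace Crystal

/-- The inverse of the rotation of the cubulation by which the generator of the holonomy group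
acts. -/
def rot (c : Fin 4 → ℤ) : Fin 4 → ℤ := ![-c 0, c 2, -c 1, c 3]

/-- The change of orientation of a cube under the rotation. -/
def rotSign (c : Fin 4 → ℤ) : ℤ :=
  (if Odd (c 0) then -1 else 1) * if Odd (c 1) ∧ ¬Odd (c 2) then -1 else 1

/-- The action of the generator of the holonomy group on cubical cochains. -/
def T : ((Fin 4 → ℤ) → ℤ) →+ ((Fin 4 → ℤ) → ℤ) :=
  AddMonoidHom.mk' (fun f c => rotSign c * f (rot c)) fun f g => by
    funext c
    simp [mul_add]

lemma T_apply (f : (Fin 4 → ℤ) → ℤ) (c : Fin 4 → ℤ) : T f c = rotSign c * f (rot c) := rfl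

lemma sign_zero (c : Fin 4 → ℤ) : Cubical.sign 0 c = 1 := by
  simp [Cubical.sign]

lemma sign_one (c : Fin 4 → ℤ) : Cubical.sign 1 c = if Odd (c 0) then -1 else 1 := by
  rw [Cubical.sign, show Finset.univ.filter (· < (1 : Fin 4)) = {0} by decide,
    Finset.prod_singleton]

lemma sign_two (c : Fin 4 → ℤ) : Cubical.sign 2 c =
    (if Odd (c 0) then -1 else 1) * if Odd (c 1) then -1 else 1 := by
  rw [Cubical.sign, show Finset.univ.filter (· < (2 : Fin 4)) = {0, 1} by decide,
    Finset.prod_pair (by decide)]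

lemma sign_three (c : Fin 4 → ℤ) : Cubical.sign 3 c = (if Odd (c 0) then -1 else 1) *
    ((if Odd (c 1) then -1 else 1) * if Odd (c 2) then -1 else 1) := by
  rw [Cubical.sign, show Finset.univ.filter (· < (3 : Fin 4)) = {0, 1, 2} by decide,
    Finset.prod_insert (by decide), Finset.prod_pair (by decide)]

lemma rot_update_zero (c : Fin 4 → ℤ) (a : ℤ) :
    rot (Function.update c 0 a) = Function.update (rot c) 0 (-a) := by
  funext i; fin_cases i <;> simp [rot]

lemma rot_update_one (c : Fin 4 → ℤ) (a : ℤ) :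
    rot (Function.update c 1 a) = Function.update (rot c) 2 (-a) := by
  funext i; fin_cases i <;> simp [rot]

lemma rot_update_two (c : Fin 4 → ℤ) (a : ℤ) :
    rot (Function.update c 2 a) = Function.update (rot c) 1 a := by
  funext i; fin_cases i <;> simp [rot]

lemma rot_update_three (c : Fin 4 → ℤ) (a : ℤ) :
    rot (Function.update c 3 a) = Function.update (rot c) 3 a := by
  funext i; fin_cases i <;> simp [rot]

/-- For this and the next three lemmas: the rotation exchanges axes 1 and 2 and preserves axes 0 and
3, up to direction. Reversing an axis swaps the endpoints in the difference, and `rotSign` changes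
between a cube and its face exactly so as to compensate this and the reordering of axes 1 and 2. -/
lemma dAxis_T_zero (f : (Fin 4 → ℤ) → ℤ) (c : Fin 4 → ℤ) :
    Cubical.dAxis 0 (T f) c = rotSign c * Cubical.dAxis 0 f (rot c) := by
  simp only [Cubical.dAxis_apply, T_apply, rot_update_zero, sign_zero, rotSign,
    Function.update_self, Function.update_of_ne (show (1 : Fin 4) ≠ 0 by decide),
    Function.update_of_ne (show (2 : Fin 4) ≠ 0 by decide), Cubical.odd_succ_iff,
    Cubical.odd_pred_iff]
  have h0 : rot c 0 = -c 0 := rfl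
  simp only [h0, odd_neg, neg_add', neg_sub', sub_neg_eq_add]
  by_cases h : Odd (c 0) <;> simp only [h, not_true, if_true, if_false, mul_zero]
  ring

lemma dAxis_T_one (f : (Fin 4 → ℤ) → ℤ) (c : Fin 4 → ℤ) :
    Cubical.dAxis 1 (T f) c = rotSign c * Cubical.dAxis 2 f (rot c) := by
  simp only [Cubical.dAxis_apply, T_apply, rot_update_one, sign_one, sign_two, rotSign,
    Function.update_self, Function.update_of_ne (show (0 : Fin 4) ≠ 1 by decide),
    Function.update_of_ne (show (2 : Fin 4) ≠ 1 by decide), Cubical.odd_succ_iff,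
    Cubical.odd_pred_iff]
  have h0 : rot c 0 = -c 0 := rfl
  have h1 : rot c 1 = c 2 := rfl
  have h2 : rot c 2 = -c 1 := rfl
  simp only [h0, h1, h2, odd_neg, neg_add', neg_sub', sub_neg_eq_add]
  by_cases h : Odd (c 1) <;> by_cases h' : Odd (c 0) <;> by_cases h'' : Odd (c 2) <;>
    simp only [h, h', h'', not_true, not_false_iff, if_true, if_false, mul_zero, and_true,
      and_false] <;> ring

lemma dAxis_T_two (f : (Fin 4 → ℤ) → ℤ) (c : Fin 4 → ℤ) :
    Cubical.dAxis 2 (T f) c = rotSign c * Cubical.dAxis 1 f (rot c) := by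
  simp only [Cubical.dAxis_apply, T_apply, rot_update_two, sign_one, sign_two, rotSign,
    Function.update_self, Function.update_of_ne (show (0 : Fin 4) ≠ 2 by decide),
    Function.update_of_ne (show (1 : Fin 4) ≠ 2 by decide), Cubical.odd_succ_iff,
    Cubical.odd_pred_iff]
  have h0 : rot c 0 = -c 0 := rfl
  have h1 : rot c 1 = c 2 := rfl
  simp only [h0, h1, odd_neg]
  by_cases h : Odd (c 1) <;> by_cases h' : Odd (c 0) <;> by_cases h'' : Odd (c 2) <;>
    simp only [h, h', h'', not_true, not_false_iff, if_true, if_false, mul_zero, and_true,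
      and_false] <;> ring

lemma dAxis_T_three (f : (Fin 4 → ℤ) → ℤ) (c : Fin 4 → ℤ) :
    Cubical.dAxis 3 (T f) c = rotSign c * Cubical.dAxis 3 f (rot c) := by
  simp only [Cubical.dAxis_apply, T_apply, rot_update_three, sign_three, rotSign,
    Function.update_of_ne (show (0 : Fin 4) ≠ 3 by decide),
    Function.update_of_ne (show (1 : Fin 4) ≠ 3 by decide),
    Function.update_of_ne (show (2 : Fin 4) ≠ 3 by decide)]
  have h0 : rot c 0 = -c 0 := rfl
  have h1 : rot c 1 = c 2 := rfl
  have h2 : rot c 2 = -c 1 := rfl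
  have h3 : rot c 3 = c 3 := rfl
  simp only [h0, h1, h2, h3, odd_neg]
  by_cases h : Odd (c 3)
  · rw [if_pos h, if_pos h]; ring
  · rw [if_neg h, if_neg h, mul_zero]

lemma T_d (f : (Fin 4 → ℤ) → ℤ) : T (Cubical.d f) = Cubical.d (T f) := by
  funext c
  rw [T_apply, Cubical.d_apply, Cubical.d_apply, Fin.sum_univ_four, Fin.sum_univ_four,
    dAxis_T_zero, dAxis_T_one, dAxis_T_two, dAxis_T_three]
  ring

lemma rot_four (c : Fin 4 → ℤ) : rot (rot (rot (rot c))) = c := by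
  funext i; fin_cases i <;> simp [rot]

lemma T_four (f : (Fin 4 → ℤ) → ℤ) : T (T (T (T f))) = f := by
  funext c
  simp only [T_apply, rot_four, ← mul_assoc]
  have : rotSign c * rotSign (rot c) * rotSign (rot (rot c)) * rotSign (rot (rot (rot c))) = 1 := by
    simp only [rotSign, rot, Matrix.cons_val, odd_neg]
    by_cases h : Odd (c 1) <;> by_cases h' : Odd (c 0) <;> by_cases h'' : Odd (c 2) <;>
      simp only [h, h', h'', not_true, not_false_iff, if_true, if_false, and_true,
        and_false] <;> rfl
  rw [this, one_mul]

lemma dim_eq (c : Fin 4 → ℤ) : Cubical.dim c = (if Odd (c 0) then 1 else 0) +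
    (if Odd (c 1) then 1 else 0) + (if Odd (c 2) then 1 else 0) + if Odd (c 3) then 1 else 0 := by
  rw [Cubical.dim, Finset.card_filter, Fin.sum_univ_four]

lemma dim_rot (c : Fin 4 → ℤ) : Cubical.dim (rot c) = Cubical.dim c := by
  simp only [dim_eq, rot, Matrix.cons_val, odd_neg]
  by_cases h0 : Odd (c 0) <;> by_cases h1 : Odd (c 1) <;> by_cases h2 : Odd (c 2) <;>
    by_cases h3 : Odd (c 3) <;> simp only [h0, h1, h2, h3, if_true, if_false, add_zero, zero_add]

lemma T_supp (f : (Fin 4 → ℤ) → ℤ) (n : ℕ) (hf : ∀ c, Cubical.dim c ≠ n → f c = 0)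
    (c : Fin 4 → ℤ) (hc : Cubical.dim c ≠ n) : T f c = 0 := by
  rw [T_apply, hf _ (by rwa [dim_rot]), mul_zero]

lemma T_one : T (fun c => if Cubical.dim c = 0 then 1 else 0) =
    fun c => if Cubical.dim c = 0 then 1 else 0 := by
  funext c
  rw [T_apply, dim_rot]
  split_ifs with h
  · have : ∀ i, ¬Odd (c i) := fun i hi =>
      Finset.notMem_empty i ((Finset.card_eq_zero.1 h) ▸ Finset.mem_filter.2 ⟨Finset.mem_univ _, hi⟩)
    simp only [rotSign, this, if_false, false_and]
    rfl
  · rw [mul_zero]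

/-! ### Translations of the cubulation and their fundamental domain -/

/-- The coordinates of a vector of the lattice with respect to the cubulation. -/
def coord (l : Fin 4 → ℤ) : Fin 4 → ℤ := ![l 0, l 1 + l 3, l 2, l 1 + l 2 - l 3]

lemma coord_add (l l' : Fin 4 → ℤ) : coord (l + l') = coord l + coord l' := by
  funext i; fin_cases i <;> simp [coord] <;> ring

lemma coord_zero : coord 0 = 0 := by
  funext i; fin_cases i <;> simp [coord]

/-- This identity is the reason for the coordinates: they turn the holonomy matrix into a signed
permutation of the axes. The price is that the lattice fills only half of ℤ⁴, since the coordinates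
satisfy y₁ - y₂ + y₃ = 2 l₁. -/
lemma rot_coord (l : Fin 4 → ℤ) : rot (coord (holonomyMatrix.mulVec l)) = coord l := by
  funext i
  fin_cases i <;>
    simp [coord, rot, holonomyMatrix, Matrix.mulVec, dotProduct, Fin.sum_univ_four]
  ring

/-- The action of a translation on cubical cochains. -/
def shift (l : Fin 4 → ℤ) : ((Fin 4 → ℤ) → ℤ) →+ ((Fin 4 → ℤ) → ℤ) :=
  AddMonoidHom.mk' (fun f c => f (c - 2 • coord l)) fun _ _ => rfl

lemma shift_apply (l : Fin 4 → ℤ) (f : (Fin 4 → ℤ) → ℤ) (c : Fin 4 → ℤ) :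
    shift l f c = f (c - 2 • coord l) := rfl

lemma odd_sub_two_smul (c e : Fin 4 → ℤ) (i : Fin 4) : Odd ((c - 2 • e) i) ↔ Odd (c i) := by
  rw [Pi.sub_apply, Pi.smul_apply, Int.odd_iff, Int.odd_iff, nsmul_eq_mul, Nat.cast_ofNat]
  omega

lemma dim_sub (c e : Fin 4 → ℤ) : Cubical.dim (c - 2 • e) = Cubical.dim c := by
  simp only [Cubical.dim, odd_sub_two_smul]

lemma shift_dAxis (l : Fin 4 → ℤ) (j : Fin 4) (f : (Fin 4 → ℤ) → ℤ) :
    shift l (Cubical.dAxis j f) = Cubical.dAxis j (shift l f) := by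
  funext c
  have h : ∀ e : ℤ, Function.update (c - 2 • coord l) j ((c - 2 • coord l) j + e) =
      Function.update c j (c j + e) - 2 • coord l := by
    intro e
    funext i
    rcases eq_or_ne i j with rfl | hi
    · simp only [Function.update_self, Pi.sub_apply]; ring
    · simp [hi]
  have h1 := h 1
  have h2 := h (-1)
  rw [← sub_eq_add_neg, ← sub_eq_add_neg] at h2
  simp only [shift_apply, Cubical.dAxis_apply, h1, h2, odd_sub_two_smul, Cubical.sign]

lemma shift_d (l : Fin 4 → ℤ) (f : (Fin 4 → ℤ) → ℤ) :
    shift l (Cubical.d f) = Cubical.d (shift l f) := by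
  funext c
  rw [shift_apply, Cubical.d_apply, Cubical.d_apply]
  exact Finset.sum_congr rfl fun j _ => congrFun (shift_dAxis l j f) c

lemma shift_supp (l : Fin 4 → ℤ) (f : (Fin 4 → ℤ) → ℤ) (n : ℕ)
    (hf : ∀ c, Cubical.dim c ≠ n → f c = 0) (c : Fin 4 → ℤ) (hc : Cubical.dim c ≠ n) :
    shift l f c = 0 := hf _ (by rwa [dim_sub])

lemma shift_add (l l' : Fin 4 → ℤ) (f : (Fin 4 → ℤ) → ℤ) :
    shift (l + l') f = shift l (shift l' f) := by
  funext c
  simp only [shift_apply, coord_add, smul_add, sub_sub]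

lemma shift_zero (f : (Fin 4 → ℤ) → ℤ) : shift 0 f = f := by
  funext c
  simp [shift_apply, coord_zero]

/-- The commutation relation of the semidirect product, realised on cubical cochains. -/
lemma T_shift (l : Fin 4 → ℤ) (f : (Fin 4 → ℤ) → ℤ) :
    T (shift l f) = shift (holonomyMatrix.mulVec l) (T f) := by
  funext c
  have h : rot (c - 2 • coord (holonomyMatrix.mulVec l)) = rot c - 2 • coord l := by
    rw [← rot_coord l]
    funext i
    fin_cases i <;> simp [rot] <;> ring
  rw [T_apply, shift_apply, shift_apply, T_apply, h]
  simp only [rotSign, odd_sub_two_smul]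

/-- The lattice vector of the fundamental domain that a cube belongs to. -/
def anchor (c : Fin 4 → ℤ) : Fin 4 → ℤ :=
  ![c 0 / 2, (c 1 / 2 - c 2 / 2 + c 3 / 2) / 2, c 2 / 2,
    c 1 / 2 - (c 1 / 2 - c 2 / 2 + c 3 / 2) / 2]

/-- Translation by l lowers c₁/2 - c₂/2 + c₃/2 by exactly 2 l₁, so its half drops by l₁ despite the
rounding. The other coordinates shift by integers. -/
lemma anchor_sub (c l : Fin 4 → ℤ) : anchor (c - 2 • coord l) = anchor c - l := by
  funext i
  fin_cases i <;> simp [anchor, coord] <;> omega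

/-- The cubical cochains as a resolution for a group of translations that acts on a set `S`. -/
def cubicalResolution {H S : Type*} [Group H] [MulAction H S] (lat : H →* TransLattice)
    (pos : TransLattice → S) (hpos : ∀ h l, pos (lat h * l) = h • pos l)
    (frame : S → H) (hframe : ∀ h s, frame (h • s) = h * frame s)
    (tS : S → S) (β : H → H) (htS : ∀ h s, tS (h • s) = β h • tS s)
    (hβ : ∀ h, holonomyMatrix.mulVec (lat (β h)).toAdd = (lat h).toAdd) :
    CellResolution H S (Fin 4 → ℤ) where
  ρ :=
    { toFun := fun h => shift (lat h).toAdd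
      map_one' := by ext1 f; rw [map_one]; exact shift_zero f
      map_mul' := fun h h' => by ext1 f; rw [map_mul]; exact shift_add _ _ f }
  d := Cubical.d
  dim := Cubical.dim
  base := 0
  base_dim := by simp [Cubical.dim]
  pos c := pos (.ofAdd (anchor c))
  frame := frame
  T := T
  tS := tS
  β := β
  d_d := Cubical.d_d
  d_supp := Cubical.d_supp
  ρ_supp h := shift_supp _
  T_supp := T_supp
  ρ_d h := shift_d _
  T_d := T_d
  exact := Cubical.exact
  exact_zero := Cubical.exact_zero
  d_one := Cubical.d_one
  ρ_one h := by
    funext c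
    change shift _ _ c = _
    rw [shift_apply, dim_sub]
  T_one := T_one
  ρ_local h c := ⟨c - 2 • coord (lat h).toAdd, 1, by
    rw [anchor_sub, ← hpos, map_inv]
    congr 1
    rw [sub_eq_neg_add]
    rfl, fun f => (one_mul _).symm⟩
  frame_smul := hframe
  tS_smul := htS
  T_ρ h f := by
    change T (shift _ f) = shift _ (T f)
    rw [T_shift, hβ]

end Crystal

/-! ### The resolution for the crystallographic group -/

namespace Crystal

/-- The cells of the product of the periodic resolution of the holonomy group with the cubulation.
-/
abbrev PCell : Type := ℕ × Holonomy × (Fin 4 → ℤ)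

/-- The generator of the holonomy group. -/
abbrev gen : Holonomy := .ofAdd 1

/-- The restriction of a cochain to a copy of the cubulation. -/
def slice (p : ℕ) (g : Holonomy) : (PCell → ℤ) →+ ((Fin 4 → ℤ) → ℤ) :=
  AddMonoidHom.mk' (fun φ c => φ (p, g, c)) fun _ _ => rfl

lemma slice_apply (p : ℕ) (g : Holonomy) (φ : PCell → ℤ) (c : Fin 4 → ℤ) :
    slice p g φ c = φ (p, g, c) := rfl

lemma ext_slice {φ ψ : PCell → ℤ} (h : ∀ p g, slice p g φ = slice p g ψ) : φ = ψ := by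
  funext ⟨p, g, c⟩
  exact congrFun (h p g) c

/-- The cochain with given restrictions. -/
def unslice (F : ℕ → Holonomy → (PCell → ℤ) →+ ((Fin 4 → ℤ) → ℤ)) :
    (PCell → ℤ) →+ (PCell → ℤ) :=
  AddMonoidHom.mk' (fun φ x => F x.1 x.2.1 φ x.2.2) fun φ ψ => by funext x; simp

lemma slice_unslice (F : ℕ → Holonomy → (PCell → ℤ) →+ ((Fin 4 → ℤ) → ℤ)) (p : ℕ) (g : Holonomy)
    (φ : PCell → ℤ) : slice p g (unslice F φ) = F p g φ := rfl

/-- The horizontal differential in the periodic direction. -/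
def horizontal : ℕ → Holonomy → (PCell → ℤ) →+ ((Fin 4 → ℤ) → ℤ)
  | 0, _ => 0
  | p + 1, g => if Even p then T.comp (slice p (g * gen)) - slice p g else
      slice p g + T.comp (slice p (g * gen)) + T.comp (T.comp (slice p (g * gen * gen))) +
        T.comp (T.comp (T.comp (slice p (g * gen * gen * gen))))

/-- The differential of the product resolution. -/
def totalD : (PCell → ℤ) →+ (PCell → ℤ) :=
  unslice fun p g => horizontal p g + (-1 : ℤ) ^ p • Cubical.d.comp (slice p g)

lemma slice_zero_totalD (g : Holonomy) (φ : PCell → ℤ) :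
    slice 0 g (totalD φ) = Cubical.d (slice 0 g φ) := by
  simp [totalD, slice_unslice, horizontal]

lemma slice_succ_totalD_of_even {p : ℕ} (hp : Even p) (g : Holonomy) (φ : PCell → ℤ) :
    slice (p + 1) g (totalD φ) =
      T (slice p (g * gen) φ) - slice p g φ - Cubical.d (slice (p + 1) g φ) := by
  simp [totalD, slice_unslice, horizontal, hp, pow_succ, sub_eq_add_neg]

lemma slice_succ_totalD_of_odd {p : ℕ} (hp : ¬Even p) (g : Holonomy) (φ : PCell → ℤ) :
    slice (p + 1) g (totalD φ) =
      slice p g φ + T (slice p (g * gen) φ) + T (T (slice p (g * gen * gen) φ)) +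
        T (T (T (slice p (g * gen * gen * gen) φ))) + Cubical.d (slice (p + 1) g φ) := by
  simp [totalD, slice_unslice, horizontal, hp, pow_succ, Nat.not_even_iff_odd.1 hp]

/-- The dimension of a cell. -/
def pdim (x : PCell) : ℕ := x.1 + Cubical.dim x.2.2

lemma gen_four (g : Holonomy) : g * gen * gen * gen * gen = g := by
  revert g; decide

lemma totalD_totalD (φ : PCell → ℤ) : totalD (totalD φ) = 0 := by
  refine ext_slice fun p g => ?_
  rcases p with _ | _ | p
  · rw [slice_zero_totalD, slice_zero_totalD, Cubical.d_d, map_zero]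
  · rw [slice_succ_totalD_of_even Even.zero, slice_succ_totalD_of_even Even.zero]
    simp only [slice_zero_totalD, map_sub, T_d, Cubical.d_d, map_zero]
    abel
  · by_cases hp : Even p
    · have hp' : ¬Even (p + 1) := by simpa [Nat.even_add_one] using hp
      rw [slice_succ_totalD_of_odd hp', slice_succ_totalD_of_odd hp']
      simp only [slice_succ_totalD_of_even hp, map_add, map_sub, map_zero, T_d, Cubical.d_d,
        T_four, gen_four]
      abel
    · have hp' : Even (p + 1) := by simpa [Nat.even_add_one] using hp
      rw [slice_succ_totalD_of_even hp', slice_succ_totalD_of_even hp']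
      simp only [slice_succ_totalD_of_odd hp, map_add, map_sub, map_zero, T_d, Cubical.d_d,
        T_four, gen_four]
      abel

/-- A cochain is supported on cells of dimension `n`. -/
lemma supp_iff {φ : PCell → ℤ} {n : ℕ} : (∀ x, pdim x ≠ n → φ x = 0) ↔
    ∀ p g c, p + Cubical.dim c ≠ n → slice p g φ c = 0 :=
  ⟨fun h p g c => h (p, g, c), fun h x => h x.1 x.2.1 x.2.2⟩

lemma totalD_supp (φ : PCell → ℤ) (n : ℕ) (h : ∀ x, pdim x ≠ n → φ x = 0) (x : PCell)
    (hx : pdim x ≠ n + 1) : totalD φ x = 0 := by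
  obtain ⟨p, g, c⟩ := x
  change slice p g (totalD φ) c = 0
  have h' := supp_iff.1 h
  have hd : ∀ g, Cubical.d (slice p g φ) c = 0 := by
    intro g
    rcases le_or_gt p n with hpn | hpn
    · exact Cubical.d_supp _ (n - p) (fun c hc => h' p g c (by omega)) c
        (fun h => hx (by simp only [pdim]; omega))
    · have : slice p g φ = 0 := by
        funext c
        exact h' p g c (by omega)
      rw [this, map_zero, Pi.zero_apply]
  rcases p with _ | p
  · rw [slice_zero_totalD, hd]
  · have h0 : ∀ g c', Cubical.dim c' = Cubical.dim c → slice p g φ c' = 0 := fun g c' hc' =>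
      h' p g c' fun h => hx (by simp only [pdim]; omega)
    have h1 : ∀ g c', Cubical.dim c' = Cubical.dim c → T (slice p g φ) c' = 0 := fun g c' hc' => by
      rw [T_apply, h0 _ _ (by rw [dim_rot, hc']), mul_zero]
    have h2 : ∀ g c', Cubical.dim c' = Cubical.dim c → T (T (slice p g φ)) c' = 0 :=
      fun g c' hc' => by rw [T_apply, h1 _ _ (by rw [dim_rot, hc']), mul_zero]
    have h3 : ∀ g c', Cubical.dim c' = Cubical.dim c → T (T (T (slice p g φ))) c' = 0 :=
      fun g c' hc' => by rw [T_apply, h2 _ _ (by rw [dim_rot, hc']), mul_zero]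
    by_cases hp : Even p
    · rw [slice_succ_totalD_of_even hp]
      simp [h0 _ c rfl, h1 _ c rfl, hd]
    · rw [slice_succ_totalD_of_odd hp]
      simp [h0 _ c rfl, h1 _ c rfl, h2 _ c rfl, h3 _ c rfl, hd]

/-- The copy of the cubulation at g is described in coordinates turned back by g, so that a
translation l acts on it by g⁻¹ l. Passing from the copy at `g * gen` to the copy at g therefore
costs one application of `T`; this makes the periodic differential equivariant. -/
lemma T_shift_action (g : Holonomy) (l : TransLattice) (f : (Fin 4 → ℤ) → ℤ) :
    T (shift (holonomyAction (g * gen)⁻¹ l).toAdd f) =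
      shift (holonomyAction g⁻¹ l).toAdd (T f) := by
  rw [T_shift]
  have h : holonomyAction g⁻¹ l = holonomyAction gen (holonomyAction (g * gen)⁻¹ l) := by
    rw [← MulAut.mul_apply, ← map_mul, mul_inv_rev, mul_inv_cancel_left]
  rw [h]
  congr 2
  change holonomyMatrix.mulVec _ = (holonomyMatrix ^ (1 : ZMod 4).val).mulVec _
  rw [show (1 : ZMod 4).val = 1 from rfl, pow_one]

/-- The action of the crystallographic group on the product resolution. -/
def action (γ : CrystGroup) : (PCell → ℤ) →+ (PCell → ℤ) :=
  unslice fun p g => (shift (holonomyAction g⁻¹ γ.left).toAdd).comp (slice p (γ.right⁻¹ * g))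

lemma slice_action (γ : CrystGroup) (p : ℕ) (g : Holonomy) (φ : PCell → ℤ) :
    slice p g (action γ φ) =
      shift (holonomyAction g⁻¹ γ.left).toAdd (slice p (γ.right⁻¹ * g) φ) := rfl

lemma action_one (φ : PCell → ℤ) : action 1 φ = φ := by
  refine ext_slice fun p g => ?_
  rw [slice_action, SemidirectProduct.one_left, map_one, SemidirectProduct.one_right, inv_one,
    one_mul]
  exact shift_zero _

lemma action_mul (γ δ : CrystGroup) (φ : PCell → ℤ) :
    action (γ * δ) φ = action γ (action δ φ) := by
  refine ext_slice fun p g => ?_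
  rw [slice_action, slice_action, slice_action, ← shift_add, SemidirectProduct.mul_left,
    SemidirectProduct.mul_right, map_mul, ← MulAut.mul_apply, ← map_mul, mul_inv_rev, mul_inv_rev,
    inv_inv, mul_assoc]
  rfl

lemma totalD_action (γ : CrystGroup) (φ : PCell → ℤ) :
    totalD (action γ φ) = action γ (totalD φ) := by
  refine ext_slice fun p g => ?_
  rcases p with _ | p
  · simp only [slice_action, slice_zero_totalD, shift_d]
  · by_cases hp : Even p
    · simp only [slice_action, slice_succ_totalD_of_even hp, shift_d, map_sub, T_shift_action,
        mul_assoc]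
    · simp only [slice_action, slice_succ_totalD_of_odd hp, shift_d, map_add, T_shift_action,
        ← mul_assoc]

/-! ### Contraction of the periodic direction -/

/-- The inverse power of `T` that corresponds to an element of the holonomy group. -/
def untwist (g : Holonomy) : ((Fin 4 → ℤ) → ℤ) →+ ((Fin 4 → ℤ) → ℤ) :=
  if g = 1 then AddMonoidHom.id _ else if g = gen then T.comp (T.comp T) else
    if g = gen * gen then T.comp T else T

lemma forall_holonomy {P : Holonomy → Prop} (h0 : P 1) (h1 : P gen) (h2 : P (gen * gen))
    (h3 : P (gen * gen * gen)) (g : Holonomy) : P g := by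
  have : g = 1 ∨ g = gen ∨ g = gen * gen ∨ g = gen * gen * gen := by revert g; decide
  rcases this with rfl | rfl | rfl | rfl <;> assumption

lemma untwist_one (f : (Fin 4 → ℤ) → ℤ) : untwist 1 f = f := rfl

lemma untwist_gen (f : (Fin 4 → ℤ) → ℤ) : untwist gen f = T (T (T f)) := rfl

lemma untwist_gen_two (f : (Fin 4 → ℤ) → ℤ) : untwist (gen * gen) f = T (T f) := rfl

lemma untwist_gen_three (f : (Fin 4 → ℤ) → ℤ) : untwist (gen * gen * gen) f = T f := rfl

/-- The twist at g is the power of `T` inverse to g, because T⁴ = 1. Hence equivariantly extended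
cochains are killed by the first periodic differential. -/
lemma T_untwist (g : Holonomy) (f : (Fin 4 → ℤ) → ℤ) : T (untwist (g * gen) f) = untwist g f := by
  revert g
  refine forall_holonomy ?_ rfl rfl ?_
  · rw [one_mul, untwist_gen, T_four, untwist_one]
  · rw [show gen * gen * gen * gen = (1 : Holonomy) by decide]
    rfl

lemma d_untwist (g : Holonomy) (f : (Fin 4 → ℤ) → ℤ) :
    Cubical.d (untwist g f) = untwist g (Cubical.d f) := by
  revert g
  refine forall_holonomy ?_ ?_ ?_ ?_ <;>
    simp only [untwist_one, untwist_gen, untwist_gen_two, untwist_gen_three, T_d]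

lemma untwist_supp (g : Holonomy) (f : (Fin 4 → ℤ) → ℤ) (n : ℕ)
    (hf : ∀ c, Cubical.dim c ≠ n → f c = 0) :
    ∀ c, Cubical.dim c ≠ n → untwist g f c = 0 := by
  revert g
  refine forall_holonomy hf ?_ ?_ ?_
  · exact T_supp _ n (T_supp _ n (T_supp _ n hf))
  · exact T_supp _ n (T_supp _ n hf)
  · exact T_supp _ n hf

lemma untwist_const (g : Holonomy) : untwist g (fun c => if Cubical.dim c = 0 then 1 else 0) =
    fun c => if Cubical.dim c = 0 then 1 else 0 := by
  revert g
  refine forall_holonomy rfl ?_ ?_ T_one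
  · rw [untwist_gen, T_one, T_one, T_one]
  · rw [untwist_gen_two, T_one, T_one]

/-- The cochain that extends a cubical cochain equivariantly. -/
def extend : ((Fin 4 → ℤ) → ℤ) →+ (PCell → ℤ) :=
  AddMonoidHom.mk' (fun f x => if x.1 = 0 then untwist x.2.1 f x.2.2 else 0) fun f g => by
    funext x
    by_cases h : x.1 = 0 <;> simp [h]

lemma slice_zero_extend (g : Holonomy) (f : (Fin 4 → ℤ) → ℤ) :
    slice 0 g (extend f) = untwist g f := rfl

lemma slice_succ_extend (p : ℕ) (g : Holonomy) (f : (Fin 4 → ℤ) → ℤ) :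
    slice (p + 1) g (extend f) = 0 := rfl

lemma totalD_extend (f : (Fin 4 → ℤ) → ℤ) : totalD (extend f) = extend (Cubical.d f) := by
  refine ext_slice fun p g => ?_
  rcases p with _ | _ | p
  · rw [slice_zero_totalD, slice_zero_extend, slice_zero_extend, d_untwist]
  · rw [slice_succ_totalD_of_even Even.zero, slice_zero_extend, slice_zero_extend, T_untwist,
      slice_succ_extend, slice_succ_extend]
    simp
  · by_cases hp : Even (p + 1)
    · rw [slice_succ_totalD_of_even hp]
      simp [slice_succ_extend]
    · rw [slice_succ_totalD_of_odd hp]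
      simp [slice_succ_extend]

/-- The contraction of the periodic direction. -/
def pcontract : (PCell → ℤ) →+ (PCell → ℤ) :=
  unslice fun p g => if Even p then
    if g = 1 then 0 else if g = gen then T.comp (T.comp (T.comp (slice (p + 1) 1))) else
      if g = gen * gen then
        T.comp (T.comp (slice (p + 1) 1)) + T.comp (T.comp (T.comp (slice (p + 1) gen))) else
      T.comp (slice (p + 1) 1) + T.comp (T.comp (slice (p + 1) gen)) +
        T.comp (T.comp (T.comp (slice (p + 1) (gen * gen))))
    else if g = gen * gen * gen then T.comp (slice (p + 1) 1) else 0

section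

variable {p : ℕ} (φ : PCell → ℤ)

lemma slice_pcontract_one (hp : Even p) : slice p 1 (pcontract φ) = 0 := by
  simp [pcontract, slice_unslice, hp]

lemma slice_pcontract_gen (hp : Even p) :
    slice p gen (pcontract φ) = T (T (T (slice (p + 1) 1 φ))) := by
  simp only [pcontract, slice_unslice, hp, if_true]
  rfl

lemma slice_pcontract_gen_two (hp : Even p) : slice p (gen * gen) (pcontract φ) =
    T (T (slice (p + 1) 1 φ)) + T (T (T (slice (p + 1) gen φ))) := by
  simp only [pcontract, slice_unslice, hp, if_true]
  rfl

lemma slice_pcontract_gen_three (hp : Even p) : slice p (gen * gen * gen) (pcontract φ) =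
    T (slice (p + 1) 1 φ) + T (T (slice (p + 1) gen φ)) +
      T (T (T (slice (p + 1) (gen * gen) φ))) := by
  simp only [pcontract, slice_unslice, hp, if_true]
  rfl

lemma slice_pcontract_one' (hp : ¬Even p) : slice p 1 (pcontract φ) = 0 := by
  simp only [pcontract, slice_unslice, hp, if_false]
  rfl

lemma slice_pcontract_gen' (hp : ¬Even p) : slice p gen (pcontract φ) = 0 := by
  simp only [pcontract, slice_unslice, hp, if_false]
  rfl

lemma slice_pcontract_gen_two' (hp : ¬Even p) : slice p (gen * gen) (pcontract φ) = 0 := by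
  simp only [pcontract, slice_unslice, hp, if_false]
  rfl

lemma slice_pcontract_gen_three' (hp : ¬Even p) :
    slice p (gen * gen * gen) (pcontract φ) = T (slice (p + 1) 1 φ) := by
  simp only [pcontract, slice_unslice, hp, if_false]
  rfl

end

/-- In an even column, `pcontract` is the solution s of T s(g · gen) - s(g) = φ(g) by recursion from
s(1) = 0, with T³ serving as T⁻¹. In an odd column it is concentrated at gen³, where the twisted
norm recovers φ(1). The alternating sign of the cubical differential makes its contributions cancel,
and only the bottom copy at 1 is left over. -/
lemma totalD_pcontract (φ : PCell → ℤ) :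
    totalD (pcontract φ) + pcontract (totalD φ) = φ - extend (slice 0 1 φ) := by
  have e4 : gen * gen * gen * gen = (1 : Holonomy) := by decide
  refine ext_slice fun p => ?_
  rcases p with _ | p
  · have h0 : Even 0 := Even.zero
    simp only [map_add, map_sub, slice_zero_totalD, slice_zero_extend]
    refine forall_holonomy ?_ ?_ ?_ ?_
    · simp [slice_pcontract_one _ h0, untwist_one]
    · simp only [slice_pcontract_gen _ h0, untwist_gen, slice_succ_totalD_of_even h0, map_sub, T_d,
        T_four, one_mul]
      abel
    · simp only [slice_pcontract_gen_two _ h0, untwist_gen_two, slice_succ_totalD_of_even h0,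
        map_sub, map_add, T_d, T_four, one_mul]
      abel
    · simp only [slice_pcontract_gen_three _ h0, untwist_gen_three, slice_succ_totalD_of_even h0,
        map_sub, map_add, T_d, T_four, one_mul]
      abel
  · by_cases hp : Even p
    · have hp' : ¬Even (p + 1) := by simpa [Nat.even_add_one] using hp
      simp only [map_add, map_sub, slice_succ_totalD_of_even hp, slice_succ_extend]
      refine forall_holonomy ?_ ?_ ?_ ?_
      · simp only [slice_pcontract_one _ hp, slice_pcontract_gen _ hp, one_mul,
          slice_pcontract_one' _ hp', T_four, map_zero]
        abel
      · simp only [slice_pcontract_gen _ hp, slice_pcontract_gen_two _ hp,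
          slice_pcontract_gen' _ hp', T_four, map_zero, map_add]
        abel
      · simp only [slice_pcontract_gen_two _ hp, slice_pcontract_gen_three _ hp,
          slice_pcontract_gen_two' _ hp', T_four, map_zero, map_add]
        abel
      · simp only [slice_pcontract_gen_three _ hp, slice_pcontract_one _ hp, e4,
          slice_pcontract_gen_three' _ hp', slice_succ_totalD_of_odd hp', T_four, T_d, map_zero,
          map_add, one_mul]
        abel
    · have hp' : Even (p + 1) := by simpa [Nat.even_add_one] using hp
      simp only [map_add, map_sub, slice_succ_totalD_of_odd hp, slice_succ_extend]
      refine forall_holonomy ?_ ?_ ?_ ?_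
      · simp only [slice_pcontract_one' _ hp, slice_pcontract_gen' _ hp,
          slice_pcontract_gen_two' _ hp, slice_pcontract_gen_three' _ hp, one_mul,
          slice_pcontract_one _ hp', T_four, map_zero]
        abel
      · simp only [e4, slice_pcontract_one' _ hp, slice_pcontract_gen' _ hp,
          slice_pcontract_gen_two' _ hp, slice_pcontract_gen_three' _ hp, one_mul,
          slice_pcontract_gen _ hp', slice_succ_totalD_of_even hp', T_four, T_d, map_zero, map_sub]
        abel
      · simp only [e4, slice_pcontract_one' _ hp, slice_pcontract_gen' _ hp,
          slice_pcontract_gen_two' _ hp, slice_pcontract_gen_three' _ hp, one_mul,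
          slice_pcontract_gen_two _ hp', slice_succ_totalD_of_even hp', T_four, T_d, map_zero,
          map_sub, map_add]
        abel
      · simp only [e4, slice_pcontract_one' _ hp, slice_pcontract_gen' _ hp,
          slice_pcontract_gen_two' _ hp, slice_pcontract_gen_three' _ hp, one_mul,
          slice_pcontract_gen_three _ hp', slice_succ_totalD_of_even hp', T_four, T_d, map_zero,
          map_sub, map_add]
        abel

lemma pcontract_supp (φ : PCell → ℤ) (n : ℕ) (h : ∀ x, pdim x ≠ n → φ x = 0) (x : PCell)
    (hx : pdim x + 1 ≠ n) : pcontract φ x = 0 := by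
  obtain ⟨p, g, c⟩ := x
  have h' := supp_iff.1 h
  have h0 : ∀ g c', Cubical.dim c' = Cubical.dim c → slice (p + 1) g φ c' = 0 := fun g c' hc' =>
    h' (p + 1) g c' fun h => hx (by simp only [pdim]; omega)
  have h1 : ∀ g c', Cubical.dim c' = Cubical.dim c → T (slice (p + 1) g φ) c' = 0 :=
    fun g c' hc' => by rw [T_apply, h0 _ _ (by rw [dim_rot, hc']), mul_zero]
  have h2 : ∀ g c', Cubical.dim c' = Cubical.dim c → T (T (slice (p + 1) g φ)) c' = 0 :=
    fun g c' hc' => by rw [T_apply, h1 _ _ (by rw [dim_rot, hc']), mul_zero]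
  have h3 : ∀ g c', Cubical.dim c' = Cubical.dim c → T (T (T (slice (p + 1) g φ))) c' = 0 :=
    fun g c' hc' => by rw [T_apply, h2 _ _ (by rw [dim_rot, hc']), mul_zero]
  change slice p g (pcontract φ) c = 0
  clear hx
  revert g
  by_cases hp : Even p
  · refine forall_holonomy ?_ ?_ ?_ ?_
    · simp [slice_pcontract_one _ hp]
    · rw [slice_pcontract_gen _ hp, h3 _ c rfl]
    · rw [slice_pcontract_gen_two _ hp, Pi.add_apply, h3 _ c rfl, h2 _ c rfl, add_zero]
    · rw [slice_pcontract_gen_three _ hp, Pi.add_apply, Pi.add_apply, h3 _ c rfl, h2 _ c rfl,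
        h1 _ c rfl, add_zero, add_zero]
  · refine forall_holonomy ?_ ?_ ?_ ?_
    · simp [slice_pcontract_one' _ hp]
    · simp [slice_pcontract_gen' _ hp]
    · simp [slice_pcontract_gen_two' _ hp]
    · rw [slice_pcontract_gen_three' _ hp, h1 _ c rfl]

/-- The product resolution as a resolution for the crystallographic group. -/
def productResolution : CellResolution CrystGroup CrystGroup PCell where
  ρ :=
    { toFun := action
      map_one' := by ext1 f; exact action_one f
      map_mul' := fun γ δ => by ext1 f; exact action_mul γ δ f }
  d := totalD
  dim := pdim
  base := (0, 1, 0)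
  base_dim := by simp [pdim, Cubical.dim]
  pos x := SemidirectProduct.inr x.2.1 * SemidirectProduct.inl (.ofAdd (anchor x.2.2))
  frame γ := γ
  T := AddMonoidHom.id _
  tS γ := γ
  β γ := γ
  d_d := totalD_totalD
  d_supp := totalD_supp
  ρ_supp γ φ n h x hx := by
    obtain ⟨p, g, c⟩ := x
    change φ _ = 0
    refine h _ ?_
    simp only [pdim, dim_sub]
    exact hx
  T_supp _ _ h := h
  ρ_d γ φ := (totalD_action γ φ).symm
  T_d _ := rfl
  exact φ n h h0 := by
    -- A cocycle differs by a coboundary from the extension of its restriction to one copy of the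
    -- cubulation. There cubical exactness supplies a primitive, which is extended back.
    have h1 := totalD_pcontract φ
    rw [h0, map_zero, add_zero] at h1
    have h2 : Cubical.d (slice 0 1 φ) = 0 := by rw [← slice_zero_totalD, h0, map_zero]
    obtain ⟨g, hg, h3⟩ := Cubical.exact (slice 0 1 φ) n
      (fun c hc => supp_iff.1 h 0 1 c (by omega)) h2
    refine ⟨pcontract φ + extend g, fun x hx => ?_, ?_⟩
    · rw [Pi.add_apply, pcontract_supp φ _ h x (by omega), zero_add]
      change (if x.1 = 0 then untwist x.2.1 g x.2.2 else 0) = 0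
      split_ifs with hx0
      · exact untwist_supp _ g n hg _ (by simpa [pdim, hx0] using hx)
      · rfl
    · rw [map_add, h1, totalD_extend, h3, sub_add_cancel]
  exact_zero φ h h0 x hx := by
    have h1 : φ = extend (slice 0 1 φ) := by
      have h1 := totalD_pcontract φ
      have h2 : pcontract φ = 0 := funext fun x => pcontract_supp φ 0 h x (by omega)
      rw [h0, h2, map_zero, map_zero, add_zero] at h1
      exact sub_eq_zero.1 h1.symm
    have h2 : Cubical.d (slice 0 1 φ) = 0 := by rw [← slice_zero_totalD, h0, map_zero]
    have h3 : slice 0 1 φ = φ (0, 1, 0) • fun c => if Cubical.dim c = 0 then 1 else 0 := by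
      funext c
      by_cases hc : Cubical.dim c = 0
      · have := Cubical.exact_zero _ (fun c hc => supp_iff.1 h 0 1 c (by omega)) h2 c hc
        simpa [hc, slice_apply] using this
      · simpa [hc] using supp_iff.1 h 0 1 c (by omega)
    obtain ⟨p, g, c⟩ := x
    obtain ⟨rfl, hc⟩ : p = 0 ∧ Cubical.dim c = 0 := by simp only [pdim] at hx; omega
    rw [h1, h3, map_zsmul]
    rw [Pi.smul_apply, Pi.smul_apply, ← slice_apply 0 g (extend _), ← slice_apply 0 1 (extend _),
      slice_zero_extend, slice_zero_extend, untwist_const, untwist_const]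
    have hz : Cubical.dim (0 : Fin 4 → ℤ) = 0 := by simp [Cubical.dim]
    simp only [hc, hz]
  d_one := by
    have : (fun c : PCell => if pdim c = 0 then (1 : ℤ) else 0) =
        extend fun c => if Cubical.dim c = 0 then 1 else 0 := by
      funext ⟨p, g, c⟩
      rcases p with _ | p
      · rw [← slice_apply 0 g (extend _), slice_zero_extend, untwist_const]
        simp [pdim]
      · rw [← slice_apply (p + 1) g (extend _), slice_succ_extend]
        simp [pdim]
    rw [this, totalD_extend, Cubical.d_one, map_zero]
  ρ_one γ := by
    funext ⟨p, g, c⟩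
    change (if p + Cubical.dim (c - 2 • _) = 0 then (1 : ℤ) else 0) =
      if p + Cubical.dim c = 0 then 1 else 0
    rw [dim_sub]
  T_one := rfl
  ρ_local γ x := ⟨(x.1, γ.right⁻¹ * x.2.1, x.2.2 - 2 • coord (holonomyAction x.2.1⁻¹ γ.left).toAdd),
    1, by
      obtain ⟨p, g, c⟩ := x
      rw [anchor_sub, smul_eq_mul]
      have h : (SemidirectProduct.inr g : CrystGroup) *
          SemidirectProduct.inl (holonomyAction g⁻¹ γ.left)⁻¹ =
          SemidirectProduct.inl γ.left⁻¹ * SemidirectProduct.inr g := by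
        ext1 <;> simp
      rw [ofAdd_sub, ofAdd_toAdd, div_eq_inv_mul, map_mul, map_mul, mul_assoc,
        ← mul_assoc (SemidirectProduct.inr g), h]
      conv_rhs => rw [← SemidirectProduct.inl_left_mul_inr_right γ]
      simp only [map_inv, mul_inv_rev, mul_assoc], fun f => (one_mul _).symm⟩
  frame_smul _ _ := rfl
  tS_smul _ _ := rfl
  T_ρ _ _ := rfl

end Crystal

/-! ### Cocycles that represent cohomology classes -/

section Homology

variable {k : Type} [CommRing k] (X : CochainComplex (ModuleCat.{0} k) ℕ)

/-- The differential of a cochain complex as an additive map. -/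
def complexD (n : ℕ) : X.X n →+ X.X (n + 1) := (X.d n (n + 1)).hom.toAddMonoidHom

/-- The kernel of the projection to homology is the image of the incoming differential. In degree 0
the predecessor in the complex shape is degenerate, with zero differential, which matches the
convention that there are no coboundaries. -/
lemma CochainComplex.homologyπ_eq_zero_iff (n : ℕ) (z : X.cycles n) :
    X.homologyπ n z = 0 ↔ X.iCycles n z ∈ cobound (fun n => (⊤ : AddSubgroup (X.X n)))
      (complexD X) n := by
  have hinj := (ModuleCat.mono_iff_injective (X.iCycles n)).1 inferInstance
  have hex := ShortComplex.exact_of_g_is_cokernel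
    (ShortComplex.mk (X.toCycles _ n) (X.homologyπ n) (X.toCycles_comp_homologyπ _ n))
    (X.homologyIsCokernel _ n rfl)
  rw [ShortComplex.moduleCat_exact_iff] at hex
  have hi (i : ℕ) (y : X.X i) : X.iCycles n (X.toCycles i n y) = X.d i n y :=
    congr(($(X.toCycles_i i n)).hom y)
  have hπ (i : ℕ) (y : X.X i) : X.homologyπ n (X.toCycles i n y) = 0 :=
    congr(($(X.toCycles_comp_homologyπ i n)).hom y)
  constructor
  · intro hz
    obtain ⟨y, hy⟩ := hex z hz
    change X.toCycles _ n y = z at hy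
    subst hy
    rw [hi]
    rcases n with _ | n
    · rw [X.shape _ _ (by simp)]
      rfl
    · have hp : (ComplexShape.up ℕ).prev (n + 1) = n := CochainComplex.prev_nat_succ n
      revert y
      rw [hp]
      exact fun y _ => ⟨y, trivial, rfl⟩
  · intro hz
    rcases n with _ | n
    · have : z = 0 := hinj (hz.trans (map_zero _).symm)
      rw [this, map_zero]
    · obtain ⟨y, -, hy⟩ := hz
      rw [← hinj ((hi n y).trans hy), hπ]

/-- The cohomology of a complex of modules is the group of cocycles modulo coboundaries. -/
lemma CochainComplex.subquotientIso_homology (F : X ⟶ X) (n : ℕ) :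
    SubquotientIso (cocyc (fun n => (⊤ : AddSubgroup (X.X n))) (complexD X) n)
      (cobound (fun n => (⊤ : AddSubgroup (X.X n))) (complexD X) n)
      (F.f n).hom.toAddMonoidHom (⊤ : AddSubgroup (X.homology n)) ⊥
      (HomologicalComplex.homologyMap F n).hom.toAddMonoidHom := by
  have hinj := (ModuleCat.mono_iff_injective (X.iCycles n)).1 inferInstance
  have hF (z : X.cycles n) : X.iCycles n (HomologicalComplex.cyclesMap F n z) =
      F.f n (X.iCycles n z) := congr(($(HomologicalComplex.cyclesMap_i F n)).hom z)
  have hπ (z : X.cycles n) : X.homologyπ n (HomologicalComplex.cyclesMap F n z) =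
      HomologicalComplex.homologyMap F n (X.homologyπ n z) :=
    congr(($(HomologicalComplex.homologyπ_naturality F n)).hom z).symm
  refine ⟨⟨⟨⟨{x | ∃ z : X.cycles n, X.iCycles n z = x.1 ∧ X.homologyπ n z = x.2}, ?_⟩,
    ⟨0, map_zero _, map_zero _⟩⟩, ?_⟩, ?_, ?_, ?_, ?_, ?_⟩
  · rintro ⟨a, b⟩ ⟨a', b'⟩ ⟨z, rfl, rfl⟩ ⟨z', rfl, rfl⟩
    exact ⟨z + z', map_add _ _ _, map_add _ _ _⟩
  · rintro ⟨a, b⟩ ⟨z, rfl, rfl⟩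
    exact ⟨-z, map_neg _ _, map_neg _ _⟩
  · rintro a b ⟨z, rfl, rfl⟩
    exact ⟨⟨trivial, congr(($(X.iCycles_d n (n + 1))).hom z)⟩, trivial⟩
  · intro a ha
    exact ⟨_, X.cyclesMk a (n + 1) (by simp) ha.2,
      X.i_cyclesMk (i := n) a (n + 1) (by simp) ha.2, rfl⟩
  · intro b _
    obtain ⟨z, rfl⟩ := (ModuleCat.epi_iff_surjective (X.homologyπ n)).1 inferInstance b
    exact ⟨_, z, rfl, rfl⟩
  · rintro a b ⟨z, rfl, rfl⟩
    exact (CochainComplex.homologyπ_eq_zero_iff X n z).symm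
  · rintro a b ⟨z, rfl, rfl⟩
    exact ⟨_, hF z, hπ z⟩

end Homology

/-! ### Homogeneous and inhomogeneous cochains -/

section Inhomogeneous

variable {H : Type} [Group H]

/-- The differential of the inhomogeneous cochains with trivial integral coefficients. -/
def inhomogeneousD (H : Type) [Group H] (n : ℕ) :
    ((Fin n → H) → ℤ) →+ ((Fin (n + 1) → H) → ℤ) :=
  (inhomogeneousCochains.d (Rep.trivial ℤ H ℤ) n).hom.toAddMonoidHom

lemma inhomogeneousD_apply (n : ℕ) (f : (Fin n → H) → ℤ) (g : Fin (n + 1) → H) :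
    inhomogeneousD H n f g = f (fun i => g i.succ) +
      ∑ j : Fin (n + 1), (-1 : ℤ) ^ ((j : ℕ) + 1) • f (Fin.contractNth j (· * ·) g) := rfl

/-- The group cohomology with trivial integral coefficients, as inhomogeneous cocycles modulo
coboundaries. -/
lemma subquotientIso_groupCohomology (α : H →* H) (n : ℕ) :
    SubquotientIso (cocyc (fun n => (⊤ : AddSubgroup ((Fin n → H) → ℤ))) (inhomogeneousD H) n)
      (cobound (fun n => (⊤ : AddSubgroup ((Fin n → H) → ℤ))) (inhomogeneousD H) n)
      (AddMonoidHom.mk' (fun f x => f (α ∘ x)) fun _ _ => rfl)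
      (⊤ : AddSubgroup (groupCohomology (Rep.trivial ℤ H ℤ) n)) ⊥
      (groupCohomology.map (A := Rep.trivial ℤ H ℤ) (B := Rep.trivial ℤ H ℤ) α
        (𝟙 (Rep.trivial ℤ H ℤ)) n).hom.toAddMonoidHom := by
  have hd : complexD (groupCohomology.inhomogeneousCochains (Rep.trivial ℤ H ℤ)) =
      inhomogeneousD H := by
    funext n
    exact congrArg (fun f : (_ ⟶ _) => (ModuleCat.Hom.hom f).toAddMonoidHom)
      (groupCohomology.inhomogeneousCochains.d_def (A := Rep.trivial ℤ H ℤ) n)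
  have := CochainComplex.subquotientIso_homology
    (groupCohomology.inhomogeneousCochains (Rep.trivial ℤ H ℤ))
    (groupCohomology.cochainsMap (A := Rep.trivial ℤ H ℤ) (B := Rep.trivial ℤ H ℤ) α
        (𝟙 (Rep.trivial ℤ H ℤ))) n
  rw [hd] at this
  exact this

/-- The inhomogeneous cochain of an invariant homogeneous cochain. -/
def dehomogenize (H : Type) [Group H] (n : ℕ) :
    ((Fin (n + 1) → H) → ℤ) →+ ((Fin n → H) → ℤ) :=
  AddMonoidHom.mk' (fun φ x => φ (Fin.partialProd x)) fun _ _ => rfl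

open CellResolution

/-- Omitting an entry other than the first from the partial products multiplies two neighbours or
drops the last argument. Omitting the first gives partial products starting at x₀, which invariance
translates back to 1. -/
lemma dehomogenize_tupleD (n : ℕ) (φ : (Fin (n + 1) → H) → ℤ) (hφ : φ ∈ tupleInv H H n) :
    dehomogenize H (n + 1) (tupleD H ℤ n φ) = inhomogeneousD H n (dehomogenize H n φ) := by
  funext x
  rw [inhomogeneousD_apply]
  change tupleD H ℤ n φ (Fin.partialProd x) = φ (Fin.partialProd (Fin.tail x)) +
    ∑ j : Fin (n + 1), (-1 : ℤ) ^ ((j : ℕ) + 1) • φ (Fin.partialProd (Fin.contractNth j (· * ·) x))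
  rw [tupleD_apply, Fin.sum_univ_succ]
  congr 1
  · rw [← hφ (x 0) (Fin.partialProd (Fin.tail x))]
    simp only [Fin.val_zero, pow_zero, Fin.zero_succAbove, Fin.partialProd_succ', smul_eq_mul,
      one_mul]
  · refine Finset.sum_congr rfl fun j _ => ?_
    rw [Fin.partialProd_contractNth]
    rfl

lemma dehomogenize_injective (n : ℕ) (φ : (Fin (n + 1) → H) → ℤ) (hφ : φ ∈ tupleInv H H n)
    (h : dehomogenize H n φ = 0) : φ = 0 := by
  funext x
  rw [← Fin.partialProd_left_inv x]
  exact (hφ (x 0) _).trans (congrFun h _)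

lemma exists_dehomogenize (n : ℕ) (f : (Fin n → H) → ℤ) :
    ∃ φ ∈ tupleInv H H n, dehomogenize H n φ = f := by
  refine ⟨fun x => f fun i => (x i.castSucc)⁻¹ * x i.succ, fun h x => ?_, ?_⟩
  · simp [mul_assoc]
  · funext x
    exact congrArg f (funext fun i => Fin.partialProd_right_inv x i)

lemma tupleD_mem_tupleInv (n : ℕ) (φ : (Fin (n + 1) → H) → ℤ) (hφ : φ ∈ tupleInv H H n) :
    tupleD H ℤ n φ ∈ tupleInv H H (n + 1) := fun h x => by
  rw [tupleD_apply, tupleD_apply]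
  exact Finset.sum_congr rfl fun i _ => congrArg _ (hφ h fun j => x (i.succAbove j))

/-- The cohomology of the homogeneous cochains of a group is its group cohomology. -/
lemma subquotientIso_dehomogenize (α : H →* H) (n : ℕ) :
    SubquotientIso (cocyc (tupleInv H H) (tupleD H ℤ) n) (cobound (tupleInv H H) (tupleD H ℤ) n)
      (tupleMap α n) (cocyc (fun n => (⊤ : AddSubgroup ((Fin n → H) → ℤ))) (inhomogeneousD H) n)
      (cobound (fun n => (⊤ : AddSubgroup ((Fin n → H) → ℤ))) (inhomogeneousD H) n)
      (AddMonoidHom.mk' (fun f x => f (α ∘ x)) fun _ _ => rfl) := by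
  have hα (n : ℕ) (φ) (hφ : φ ∈ tupleInv H H n) : tupleMap α n φ ∈ tupleInv H H n := by
    intro h x
    simpa [tupleMap] using hφ (α h) fun i => α (x i)
  have hαD (n : ℕ) (φ : (Fin (n + 1) → H) → ℤ) :
      tupleD H ℤ n (tupleMap α n φ) = tupleMap α (n + 1) (tupleD H ℤ n φ) := rfl
  have hD (n : ℕ) (f : (Fin n → H) → ℤ) :
      inhomogeneousD H (n + 1) (inhomogeneousD H n f) = 0 := by
    obtain ⟨φ, hφ, rfl⟩ := exists_dehomogenize n f
    rw [← dehomogenize_tupleD n φ hφ, ← dehomogenize_tupleD _ _ (tupleD_mem_tupleInv n φ hφ),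
      tupleD_tupleD, map_zero]
  have hmap (n : ℕ) (φ : (Fin (n + 1) → H) → ℤ) : dehomogenize H n (tupleMap α n φ) =
      fun x => dehomogenize H n φ (α ∘ x) := by
    funext x
    refine congrArg φ (funext fun i => ?_)
    simp only [Fin.partialProd, map_list_prod, List.map_take, List.map_ofFn]
  refine SubquotientIso.of_hom (dehomogenize H n) ?_ ?_ ?_ ?_ ?_ ?_ ?_
  · intro φ hφ
    exact ⟨trivial, (dehomogenize_tupleD n φ hφ.1).symm.trans
      (by rw [show tupleD H ℤ n φ = 0 from hφ.2, map_zero])⟩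
  · intro f hf
    obtain ⟨φ, hφ, rfl⟩ := exists_dehomogenize n f
    refine ⟨φ, ⟨hφ, dehomogenize_injective _ _ (tupleD_mem_tupleInv n φ hφ) ?_⟩, ?_⟩
    · rw [dehomogenize_tupleD n φ hφ]
      exact hf.2
    · rw [sub_self]
      exact zero_mem _
  · intro φ hφ
    rcases n with _ | n
    · rw [mem_cobound_zero, mem_cobound_zero]
      exact ⟨fun h => h ▸ map_zero _, dehomogenize_injective 0 φ hφ.1⟩
    · rw [mem_cobound_succ, mem_cobound_succ]
      constructor
      · rintro ⟨ψ, hψ, rfl⟩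
        exact ⟨_, trivial, (dehomogenize_tupleD n ψ hψ).symm⟩
      · rintro ⟨f, -, hf⟩
        obtain ⟨ψ, hψ, rfl⟩ := exists_dehomogenize n f
        refine ⟨ψ, hψ, sub_eq_zero.1 (dehomogenize_injective _ _
          (sub_mem (tupleD_mem_tupleInv n ψ hψ) hφ.1) ?_)⟩
        rw [map_sub, dehomogenize_tupleD n ψ hψ, hf, sub_self]
  · rcases n with _ | n
    · exact bot_le
    · rintro _ ⟨f, -, rfl⟩
      exact ⟨trivial, hD n f⟩
  · intro φ hφ
    exact ⟨hα n φ hφ.1, (hαD n φ).trans (by rw [show tupleD H ℤ n φ = 0 from hφ.2, map_zero])⟩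
  · intro f hf
    rcases n with _ | n
    · rw [mem_cobound_zero] at hf ⊢
      rw [hf, map_zero]
    · obtain ⟨g, -, rfl⟩ := hf
      obtain ⟨ψ, hψ, rfl⟩ := exists_dehomogenize n g
      refine ⟨dehomogenize H n (tupleMap α n ψ), trivial, ?_⟩
      rw [← dehomogenize_tupleD n _ (hα n ψ hψ), hαD, hmap, dehomogenize_tupleD n ψ hψ]
      rfl
  · intro φ _
    rw [hmap, AddMonoidHom.mk'_apply, sub_self]
    exact zero_mem _

/-- The group cohomology with trivial integral coefficients, computed from a resolution. -/
theorem CellResolution.subquotientIso_groupCohomology {Cell : Type*} (R : CellResolution H H Cell)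
    (α : H →* H) (hα : R.tS = α) (n : ℕ) :
    SubquotientIso (cocyc R.inv (fun _ => R.d) n) (cobound R.inv (fun _ => R.d) n) R.T
      (⊤ : AddSubgroup (groupCohomology (Rep.trivial ℤ H ℤ) n)) ⊥
      (groupCohomology.map (A := Rep.trivial ℤ H ℤ) (B := Rep.trivial ℤ H ℤ) α
        (𝟙 (Rep.trivial ℤ H ℤ)) n).hom.toAddMonoidHom := by
  have := R.cohomology n
  rw [hα] at this
  exact this.symm.trans
    ((subquotientIso_dehomogenize α n).trans (_root_.subquotientIso_groupCohomology α n))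

end Inhomogeneous

/-! ### Cochains invariant under the lattice -/

namespace Crystal

/-- The cochains on the cubulation that are invariant under all translations. -/
def periodic : AddSubgroup ((Fin 4 → ℤ) → ℤ) where
  carrier := {f | ∀ l, shift l f = f}
  zero_mem' _ := map_zero _
  add_mem' h h' l := by rw [map_add, h, h']
  neg_mem' h l := by rw [map_neg, h]

/-- Representatives of the orbits of cubes under translations. -/
def rep (k : Fin 32) : Fin 4 → ℤ :=
  ![((k.1 % 2 : ℕ) : ℤ), ((k.1 / 2 % 2 : ℕ) : ℤ), ((k.1 / 4 % 2 : ℕ) : ℤ), ((k.1 / 8 : ℕ) : ℤ)]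

/-- The orbit of a cube under translations. -/
def cls (c : Fin 4 → ℤ) : Fin 32 :=
  Fin.ofNat 32 (c 0 % 2 + 2 * (c 1 % 2) + 4 * (c 2 % 2) +
    8 * (c 3 % 2 + 2 * ((c 1 / 2 - c 2 / 2 + c 3 / 2) % 2))).toNat

/-- Translating by the anchor reduces coordinates 0, 1, 2 to their parities. As the lattice has
index two, the last coordinate keeps one further bit, the parity of c₁/2 - c₂/2 + c₃/2, and runs
through 0, …, 3; hence 8 · 4 = 32 orbits. -/
lemma rep_cls (c : Fin 4 → ℤ) : rep (cls c) = c - 2 • coord (anchor c) := by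
  have h : (cls c).1 = (c 0 % 2 + 2 * (c 1 % 2) + 4 * (c 2 % 2) +
      8 * (c 3 % 2 + 2 * ((c 1 / 2 - c 2 / 2 + c 3 / 2) % 2))).toNat := by
    refine Nat.mod_eq_of_lt ?_
    omega
  funext i
  fin_cases i <;> simp [rep, h, coord, anchor] <;> omega

lemma cls_sub (c l : Fin 4 → ℤ) : cls (c - 2 • coord l) = cls c := by
  refine Fin.ext ?_
  have h (i : Fin 4) : (c - 2 • coord l) i = c i - 2 * coord l i := by simp
  simp only [cls, h, Fin.val_ofNat]
  have h0 : coord l 0 = l 0 := rfl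
  have h1 : coord l 1 = l 1 + l 3 := rfl
  have h2 : coord l 2 = l 2 := rfl
  have h3 : coord l 3 = l 1 + l 2 - l 3 := rfl
  rw [h0, h1, h2, h3]
  congr 2
  omega

lemma cls_rep (k : Fin 32) : cls (rep k) = k := by
  revert k
  decide +kernel

lemma mem_periodic_iff {f : (Fin 4 → ℤ) → ℤ} : f ∈ periodic ↔ ∀ c, f c = f (rep (cls c)) := by
  constructor
  · intro h c
    rw [rep_cls]
    exact (congrFun (h (anchor c)) c).symm
  · intro h l
    funext c
    rw [shift_apply, h, cls_sub, ← h]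

/-- The cochain with given values on the orbits of cubes. -/
def pull : (Fin 32 → ℤ) →+ ((Fin 4 → ℤ) → ℤ) :=
  AddMonoidHom.mk' (fun v x => v (cls x)) fun _ _ => rfl

/-- The values of a cochain on the representatives of the orbits. -/
def push : ((Fin 4 → ℤ) → ℤ) →+ (Fin 32 → ℤ) :=
  AddMonoidHom.mk' (fun f i => f (rep i)) fun _ _ => rfl

lemma pull_mem (v : Fin 32 → ℤ) : pull v ∈ periodic :=
  mem_periodic_iff.2 fun _ => congrArg v (cls_rep _).symm

lemma push_pull (v : Fin 32 → ℤ) : push (pull v) = v := funext fun k => congrArg v (cls_rep k)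

lemma pull_push {f : (Fin 4 → ℤ) → ℤ} (hf : f ∈ periodic) : pull (push f) = f :=
  funext fun c => (mem_periodic_iff.1 hf c).symm

lemma d_mem_periodic {f : (Fin 4 → ℤ) → ℤ} (hf : f ∈ periodic) : Cubical.d f ∈ periodic :=
  fun l => by rw [shift_d, hf]

lemma T_mem_periodic {f : (Fin 4 → ℤ) → ℤ} (hf : f ∈ periodic) : T f ∈ periodic := fun l => by
  have h : holonomyMatrix.mulVec ((holonomyMatrix ^ 3).mulVec l) = l := by
    rw [Matrix.mulVec_mulVec, show holonomyMatrix * holonomyMatrix ^ 3 = 1 by decide,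
      Matrix.one_mulVec]
  rw [← h, ← T_shift, hf]

/-! ### Explicit integral matrices for the cohomology of the lattice -/

/-- The cubical differential on the values on the orbits. -/
def D32 : (Fin 32 → ℤ) →+ (Fin 32 → ℤ) := push.comp (Cubical.d.comp pull)

/-- The action of the generator of the holonomy group on the values on the orbits. -/
def T32 : (Fin 32 → ℤ) →+ (Fin 32 → ℤ) := push.comp (T.comp pull)

/-- The homomorphism given by the nonzero entries of the rows of a matrix. -/
def sparse {m n : ℕ} (rows : List (List (ℤ × Fin m))) : (Fin m → ℤ) →+ (Fin n → ℤ) :=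
  AddMonoidHom.mk' (fun v k => ((rows.getD k []).map fun t => t.1 * v t.2).sum) fun v w => by
    funext k
    simp [mul_add, List.sum_map_add]

lemma hom_ext {m n : ℕ} {F G : (Fin m → ℤ) →+ (Fin n → ℤ)}
    (h : ∀ j k, F (Pi.single j 1) k = G (Pi.single j 1) k) : F = G := by
  ext j k
  exact h j k

lemma hom_apply {m n : ℕ} (F : (Fin m → ℤ) →+ (Fin n → ℤ)) (v : Fin m → ℤ) (k : Fin n) :
    F v k = ∑ j, v j * F (Pi.single j 1) k := by
  conv_lhs => rw [← Finset.univ_sum_single v, map_sum, Finset.sum_apply]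
  refine Finset.sum_congr rfl fun j _ => ?_
  have : Pi.single j (v j) = v j • (Pi.single j 1 : Fin m → ℤ) := by
    rw [← Pi.single_smul, smul_eq_mul, mul_one]
  rw [this, map_zsmul]
  rfl

lemma hom_supp {m n : ℕ} (F : (Fin m → ℤ) →+ (Fin n → ℤ)) (P : Fin m → Prop) (Q : Fin n → Prop)
    (h : ∀ j k, P j → ¬Q k → F (Pi.single j 1) k = 0) (v : Fin m → ℤ) (hv : ∀ j, ¬P j → v j = 0)
    (k : Fin n) (hk : ¬Q k) : F v k = 0 := by
  rw [hom_apply]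
  refine Finset.sum_eq_zero fun j _ => ?_
  by_cases hj : P j
  · rw [h j k hj hk, mul_zero]
  · rw [hv j hj, zero_mul]

/-- The dimension of an orbit of cubes. -/
def dim32 (k : Fin 32) : ℕ := Cubical.dim (rep k)

/-- The degrees of the basis of the cohomology of the lattice. -/
def dim16 (i : Fin 16) : ℕ := [0, 1, 1, 1, 1, 2, 2, 2, 2, 2, 2, 3, 3, 3, 3, 4].getD i 0

/-- The values of a cocycle on a basis of the homology of the lattice. -/
def period : (Fin 32 → ℤ) →+ (Fin 16 → ℤ) := sparse
  [[(1, 16)], [(1, 4), (1, 20)], [(1, 8), (1, 20)], [(1, 17)], [(1, 18), (-1, 20)],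
   [(1, 5), (1, 21)], [(1, 6), (1, 22)], [(1, 19), (-1, 21)], [(-1, 21), (1, 25)],
   [(1, 12), (-1, 22), (1, 26)], [(1, 12), (1, 28)], [(1, 13), (1, 29)], [(1, 7), (1, 23)],
   [(1, 7), (1, 27), (-1, 29)], [(1, 14), (1, 30)], [(1, 15), (1, 31)]]

/-- Cocycles that represent a basis of the cohomology of the lattice. -/
def cocycleBasis : (Fin 16 → ℤ) →+ (Fin 32 → ℤ) := sparse
  [[(1, 0)], [(1, 3)], [(1, 1), (1, 4)], [(1, 5), (1, 7)], [(1, 1)], [(1, 5)], [(1, 6)], [],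
   [(1, 2)], [(1, 5), (1, 8)], [(1, 6), (1, 9), (-1, 10)], [(1, 11), (-1, 12), (1, 13)], [],
   [(1, 11)], [], [], [(1, 0)], [(1, 3)], [(1, 4)], [(1, 7)], [], [], [], [(1, 12)],
   [(-1, 1), (1, 2)], [(1, 8)], [(1, 9)], [(1, 13)], [(1, 10)], [], [(1, 14)], [(1, 15)]]

/-- A contraction of the cochains of the lattice to the cohomology. -/
def homotopy32 : (Fin 32 → ℤ) →+ (Fin 32 → ℤ) := sparse
  [[(1, 20)], [(-1, 21)], [(-1, 22)], [(-1, 7)], [], [], [], [], [], [(-1, 29)], [(1, 14)],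
   [(-1, 15)], [], [], [], [], [], [], [], [], [], [], [], [], [(1, 12)], [], [], [], [], [],
   [], []]

-- The identity map is homotopic to the projection onto the span of the chosen cocycles. Together
-- with `period_D32` and `period_cocycleBasis` this makes the cohomology free, with the periods as
-- coordinates. Additivity reduces the claim to evaluation on the 32 basis vectors.
set_option maxRecDepth 10000 in
lemma homotopy32_identity :
    cocycleBasis.comp period + D32.comp homotopy32 + homotopy32.comp D32 = AddMonoidHom.id _ :=
  hom_ext (by decide +kernel)

lemma period_D32 : period.comp D32 = 0 := hom_ext (by decide +kernel)

lemma D32_cocycleBasis : D32.comp cocycleBasis = 0 := hom_ext (by decide +kernel)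

lemma period_cocycleBasis : period.comp cocycleBasis = AddMonoidHom.id _ :=
  hom_ext (by decide +kernel)

lemma cocycleBasis_supp (q : ℕ) (x : Fin 16 → ℤ) (hx : ∀ i, dim16 i ≠ q → x i = 0) (k : Fin 32)
    (hk : dim32 k ≠ q) : cocycleBasis x k = 0 :=
  hom_supp cocycleBasis (dim16 · = q) (dim32 · = q) (fun j k hj hk => by
    have : ∀ j k, dim32 k ≠ dim16 j → cocycleBasis (Pi.single j 1) k = 0 := by decide +kernel
    exact this j k (hj ▸ hk)) x hx k hk

lemma homotopy32_supp (q : ℕ) (v : Fin 32 → ℤ) (hv : ∀ i, dim32 i ≠ q + 1 → v i = 0) (k : Fin 32)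
    (hk : dim32 k ≠ q) : homotopy32 v k = 0 :=
  hom_supp homotopy32 (dim32 · = q + 1) (dim32 · = q) (fun j k hj hk => by
    have : ∀ j k, dim32 k + 1 ≠ dim32 j → homotopy32 (Pi.single j 1) k = 0 := by decide +kernel
    exact this j k (by rw [hj]; omega)) v hv k hk

lemma period_supp (q : ℕ) (v : Fin 32 → ℤ) (hv : ∀ i, dim32 i ≠ q → v i = 0) (k : Fin 16)
    (hk : dim16 k ≠ q) : period v k = 0 :=
  hom_supp period (dim32 · = q) (dim16 · = q) (fun j k hj hk => by
    have : ∀ j k, dim16 k ≠ dim32 j → period (Pi.single j 1) k = 0 := by decide +kernel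
    exact this j k (hj ▸ hk)) v hv k hk

lemma homotopy32_zero (v : Fin 32 → ℤ) (hv : ∀ i, dim32 i ≠ 0 → v i = 0) : homotopy32 v = 0 :=
  funext fun k => hom_supp homotopy32 (dim32 · = 0) (fun _ => False) (fun j k hj _ => by
    have : ∀ j k, dim32 j = 0 → homotopy32 (Pi.single j 1) k = 0 := by decide +kernel
    exact this j k hj) v hv k id

lemma T32_D32 (v : Fin 32 → ℤ) : T32 (D32 v) = D32 (T32 v) := by
  change push (T (pull (push (Cubical.d (pull v))))) =
    push (Cubical.d (pull (push (T (pull v)))))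
  rw [pull_push (d_mem_periodic (pull_mem v)), pull_push (T_mem_periodic (pull_mem v)), T_d]

lemma dim_eq_dim32 (c : Fin 4 → ℤ) : dim32 (cls c) = Cubical.dim c := by
  rw [dim32, rep_cls, dim_sub]

/-- The cochains of degree `q` on the cubulation that are invariant under all translations. -/
def latticeInv (q : ℕ) : AddSubgroup ((Fin 4 → ℤ) → ℤ) where
  carrier := {f | (∀ c, Cubical.dim c ≠ q → f c = 0) ∧ f ∈ periodic}
  zero_mem' := ⟨fun _ _ => rfl, zero_mem _⟩
  add_mem' h h' := ⟨fun c hc => by rw [Pi.add_apply, h.1 c hc, h'.1 c hc, add_zero],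
    add_mem h.2 h'.2⟩
  neg_mem' h := ⟨fun c hc => by rw [Pi.neg_apply, h.1 c hc, neg_zero], neg_mem h.2⟩

lemma push_D32 {f : (Fin 4 → ℤ) → ℤ} (hf : f ∈ periodic) : push (Cubical.d f) = D32 (push f) := by
  conv_lhs => rw [← pull_push hf]
  rfl

lemma push_T32 {f : (Fin 4 → ℤ) → ℤ} (hf : f ∈ periodic) : push (T f) = T32 (push f) := by
  conv_lhs => rw [← pull_push hf]
  rfl

lemma d_pull (v : Fin 32 → ℤ) : Cubical.d (pull v) = pull (D32 v) :=
  (pull_push (d_mem_periodic (pull_mem v))).symm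

lemma pull_mem_latticeInv (q : ℕ) (v : Fin 32 → ℤ) (hv : ∀ i, dim32 i ≠ q → v i = 0) :
    pull v ∈ latticeInv q :=
  ⟨fun c hc => hv _ (by rwa [dim_eq_dim32]), pull_mem v⟩

lemma push_supp {q : ℕ} {f : (Fin 4 → ℤ) → ℤ} (hf : f ∈ latticeInv q) (k : Fin 32)
    (hk : dim32 k ≠ q) : push f k = 0 := hf.1 _ hk

lemma eq_add_of_mem_cocyc {q : ℕ} {f : (Fin 4 → ℤ) → ℤ}
    (hf : f ∈ cocyc latticeInv (fun _ => Cubical.d) q) :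
    push f = cocycleBasis (period (push f)) + D32 (homotopy32 (push f)) := by
  have h := DFunLike.congr_fun homotopy32_identity (push f)
  simp only [AddMonoidHom.add_apply, AddMonoidHom.comp_apply, AddMonoidHom.id_apply,
    ← push_D32 hf.1.2, show Cubical.d f = 0 from hf.2, map_zero, add_zero] at h
  exact h.symm

/-- The cohomology of the lattice in degree `q` is free, with the basis elements of degree `q` of
the list; the generator of the holonomy group acts by the matrix `A`. -/
lemma lattice_cohomology (q n o : ℕ) (ho : o + n ≤ 16)
    (hdim : ∀ i : Fin 16, dim16 i = q ↔ o ≤ i ∧ (i : ℕ) < o + n) (A : Matrix (Fin n) (Fin n) ℤ)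
    (hA : (Matrix.of fun i j : Fin n => period (T32 (cocycleBasis
      (Pi.single ((Fin.natAdd o j).castLE ho) 1))) ((Fin.natAdd o i).castLE ho)) = A) :
    SubquotientIso (cocyc latticeInv (fun _ => Cubical.d) q)
      (cobound latticeInv (fun _ => Cubical.d) q) T (⊤ : AddSubgroup (Fin n → ℤ)) ⊥
      A.mulVecLin.toAddMonoidHom := by
  -- The basis elements of degree q occupy the consecutive places o, …, o + n - 1; `r` cuts out this
  -- block and `s` puts it back.
  let r : (Fin 16 → ℤ) →+ (Fin n → ℤ) :=
    AddMonoidHom.mk' (fun x i => x ((Fin.natAdd o i).castLE ho)) fun _ _ => rfl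
  let s : (Fin n → ℤ) →+ (Fin 16 → ℤ) :=
    AddMonoidHom.mk' (fun x i => if h : o ≤ i ∧ (i : ℕ) < o + n then x ⟨i - o, by omega⟩ else 0)
      fun x y => by funext i; simp only [Pi.add_apply]; split_ifs <;> simp
  have hrs (x : Fin n → ℤ) : r (s x) = x := by
    funext i
    simp [r, s]
  have hsr (x : Fin 16 → ℤ) (hx : ∀ i, dim16 i ≠ q → x i = 0) : s (r x) = x := by
    funext i
    simp only [r, s, AddMonoidHom.mk'_apply]
    split_ifs with h
    · congr 1
      refine Fin.ext ?_
      change o + ((i : ℕ) - o) = i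
      omega
    · exact (hx i fun h' => h ((hdim i).1 h')).symm
  have hs (x : Fin n → ℤ) (i : Fin 16) (hi : dim16 i ≠ q) : s x i = 0 := by
    simp only [s, AddMonoidHom.mk'_apply]
    rw [dif_neg fun h => hi ((hdim i).2 h)]
  refine SubquotientIso.of_surjective (r.comp (period.comp push)) ?_ ?_ ?_ ?_
  · intro x
    refine ⟨pull (cocycleBasis (s x)), ⟨pull_mem_latticeInv q _
      (cocycleBasis_supp q _ (hs x)), ?_⟩, ?_⟩
    · change Cubical.d _ = 0
      rw [d_pull, show D32 (cocycleBasis (s x)) = 0 from DFunLike.congr_fun D32_cocycleBasis (s x),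
        map_zero]
    · simp only [AddMonoidHom.comp_apply, push_pull]
      rw [show period (cocycleBasis (s x)) = s x from
        DFunLike.congr_fun period_cocycleBasis (s x), hrs]
  · intro f hf
    have hsupp := push_supp hf.1
    constructor
    · intro h
      have h0 : period (push f) = 0 := by
        rw [← hsr _ (period_supp q _ hsupp)]
        change s ((r.comp (period.comp push)) f) = 0
        rw [h, map_zero]
      have h1 := eq_add_of_mem_cocyc hf
      rw [h0, map_zero, zero_add] at h1
      rcases q with _ | q
      · rw [homotopy32_zero _ hsupp, map_zero] at h1
        rw [mem_cobound_zero, ← pull_push hf.1.2, h1, map_zero]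
      · refine mem_cobound_succ _ _ |>.2 ⟨pull (homotopy32 (push f)),
          pull_mem_latticeInv q _ (homotopy32_supp q _ hsupp), ?_⟩
        rw [d_pull, ← h1, pull_push hf.1.2]
    · intro h
      rcases q with _ | q
      · rw [mem_cobound_zero] at h
        rw [h, map_zero]
      · obtain ⟨g, hg, rfl⟩ := h
        simp only [AddMonoidHom.comp_apply]
        rw [push_D32 hg.2, show period (D32 (push g)) = 0 from
          DFunLike.congr_fun period_D32 (push g), map_zero]
  · intro f hf
    refine ⟨⟨T_supp _ _ hf.1.1, T_mem_periodic hf.1.2⟩, ?_⟩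
    change Cubical.d (T f) = 0
    rw [← T_d, show Cubical.d f = 0 from hf.2, map_zero]
  · intro f hf
    have h1 := eq_add_of_mem_cocyc hf
    -- A cocycle differs from its basis representative by a coboundary. The rotation carries
    -- coboundaries to coboundaries, on which the periods vanish.
    have h2 : period (T32 (push f)) = period (T32 (cocycleBasis (period (push f)))) := by
      conv_lhs => rw [h1, map_add, map_add, T32_D32]
      rw [show period (D32 (T32 _)) = 0 from DFunLike.congr_fun period_D32 _, add_zero]
    simp only [AddMonoidHom.comp_apply]
    rw [push_T32 hf.1.2, h2]
    conv_lhs => rw [← hsr _ (period_supp q _ (push_supp hf.1))]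
    generalize r (period (push f)) = x
    let F : (Fin n → ℤ) →+ (Fin n → ℤ) :=
      r.comp (period.comp (T32.comp (cocycleBasis.comp s)))
    change F x = _
    congr 1
    refine hom_ext fun j i => ?_
    have hsj : s (Pi.single j 1) = Pi.single ((Fin.natAdd o j).castLE ho) 1 := by
      funext i
      simp only [s, AddMonoidHom.mk'_apply, Pi.single_apply, Fin.ext_iff, Fin.val_castLE,
        Fin.val_natAdd]
      split_ifs <;> first | rfl | omega
    change period (T32 (cocycleBasis (s _))) _ = A.mulVec (Pi.single j 1) i
    rw [hsj, ← hA, Matrix.mulVec_single_one, Matrix.col_apply]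
    rfl

/-- The action of the generator of the holonomy group on `H^1(ℤ⁴, ℤ)`. -/
def A1 : Matrix (Fin 4) (Fin 4) ℤ :=
  !![1, 0, 0, 2; 0, 1, 0, 1; 0, 0, -1, 0; -1, 0, 0, -1]

/-- The action of the generator of the holonomy group on `H^2(ℤ⁴, ℤ)`. -/
def A2 : Matrix (Fin 6) (Fin 6) ℤ :=
  !![-1, 0, -2, 0, 0, 0; 0, 1, 0, 0, 0, 0; 1, 0, 1, 0, 0, 0; 0, 0, 1, -1, 0, 0;
    0, 0, 0, 0, 1, -1; 0, 1, 0, 0, 2, -1]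

/-- The action of the generator of the holonomy group on `H^3(ℤ⁴, ℤ)`. -/
def A3 : Matrix (Fin 4) (Fin 4) ℤ :=
  !![-1, 1, -2, 0; 0, -1, 0, 0; 1, -1, 1, 0; 0, 0, 0, 1]

lemma lattice_cohomology_zero : SubquotientIso (cocyc latticeInv (fun _ => Cubical.d) 0)
    (cobound latticeInv (fun _ => Cubical.d) 0) T (⊤ : AddSubgroup (Fin 1 → ℤ)) ⊥
      (1 : Matrix (Fin 1) (Fin 1) ℤ).mulVecLin.toAddMonoidHom :=
  lattice_cohomology 0 1 0 (Nat.le_of_ble_eq_true rfl) (by decide +kernel) _ (by decide +kernel)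

lemma lattice_cohomology_one : SubquotientIso (cocyc latticeInv (fun _ => Cubical.d) 1)
    (cobound latticeInv (fun _ => Cubical.d) 1) T (⊤ : AddSubgroup (Fin 4 → ℤ)) ⊥
      A1.mulVecLin.toAddMonoidHom :=
  lattice_cohomology 1 4 1 (Nat.le_of_ble_eq_true rfl) (by decide +kernel) _ (by decide +kernel)

lemma lattice_cohomology_two : SubquotientIso (cocyc latticeInv (fun _ => Cubical.d) 2)
    (cobound latticeInv (fun _ => Cubical.d) 2) T (⊤ : AddSubgroup (Fin 6 → ℤ)) ⊥
      A2.mulVecLin.toAddMonoidHom :=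
  lattice_cohomology 2 6 5 (Nat.le_of_ble_eq_true rfl) (by decide +kernel) _ (by decide +kernel)

lemma lattice_cohomology_three : SubquotientIso (cocyc latticeInv (fun _ => Cubical.d) 3)
    (cobound latticeInv (fun _ => Cubical.d) 3) T (⊤ : AddSubgroup (Fin 4 → ℤ)) ⊥
      A3.mulVecLin.toAddMonoidHom :=
  lattice_cohomology 3 4 11 (Nat.le_of_ble_eq_true rfl) (by decide +kernel) _ (by decide +kernel)

lemma lattice_cohomology_four : SubquotientIso (cocyc latticeInv (fun _ => Cubical.d) 4)
    (cobound latticeInv (fun _ => Cubical.d) 4) T (⊤ : AddSubgroup (Fin 1 → ℤ)) ⊥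
      (-1 : Matrix (Fin 1) (Fin 1) ℤ).mulVecLin.toAddMonoidHom :=
  lattice_cohomology 4 1 15 (Nat.le_of_ble_eq_true rfl) (by decide +kernel) _ (by decide +kernel)

end Crystal

/-! ### The cohomology of the crystallographic group -/

namespace Crystal

/-- The part of a cochain of degree `n` in the column `p`. -/
def column (n p : ℕ) : (Fin 32 → ℤ) →+ (Fin 32 → ℤ) :=
  AddMonoidHom.mk' (fun v k => if p + dim32 k = n then v k else 0) fun v w => by
    funext k; simp only [Pi.add_apply]; split_ifs <;> simp

lemma column_apply (n p : ℕ) (v : Fin 32 → ℤ) (k : Fin 32) :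
    column n p v k = if p + dim32 k = n then v k else 0 := rfl

lemma T32_column (n p : ℕ) (v : Fin 32 → ℤ) : T32 (column n p v) = column n p (T32 v) := by
  have h : ∀ j k, dim32 k ≠ dim32 j → T32 (Pi.single j 1) k = 0 := by decide +kernel
  funext k
  rw [column_apply, hom_apply, hom_apply T32 v]
  split_ifs with hk
  · refine Finset.sum_congr rfl fun j _ => ?_
    by_cases hj : dim32 k = dim32 j
    · rw [column_apply, if_pos (by omega)]
    · rw [h j k hj, mul_zero, mul_zero]
  · refine Finset.sum_eq_zero fun j _ => ?_
    by_cases hj : dim32 k = dim32 j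
    · rw [column_apply, if_neg (by omega), zero_mul]
    · rw [h j k hj, mul_zero]

lemma D32_column (n p : ℕ) (v : Fin 32 → ℤ) :
    D32 (column n p v) = column (n + 1) p (D32 v) := by
  have h : ∀ j k, dim32 k ≠ dim32 j + 1 → D32 (Pi.single j 1) k = 0 := by decide +kernel
  funext k
  rw [column_apply, hom_apply, hom_apply D32 v]
  split_ifs with hk
  · refine Finset.sum_congr rfl fun j _ => ?_
    by_cases hj : dim32 k = dim32 j + 1
    · rw [column_apply, if_pos (by omega)]
    · rw [h j k hj, mul_zero, mul_zero]
  · refine Finset.sum_eq_zero fun j _ => ?_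
    by_cases hj : dim32 k = dim32 j + 1
    · rw [column_apply, if_neg (by omega), zero_mul]
    · rw [h j k hj, mul_zero]

lemma T_pull (v : Fin 32 → ℤ) : T (pull v) = pull (T32 v) :=
  (pull_push (T_mem_periodic (pull_mem v))).symm

/-- The invariant cochain of degree `n` of the product resolution with given values. -/
def spread (n : ℕ) : (Fin 32 → ℤ) →+ (PCell → ℤ) :=
  AddMonoidHom.mk' (fun v x => pull (column n x.1 v) x.2.2) fun v w => by
    funext x; simp

lemma slice_spread (n p : ℕ) (g : Holonomy) (v : Fin 32 → ℤ) :
    slice p g (spread n v) = pull (column n p v) := rfl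

/-- The values of an invariant cochain of degree `n` of the product resolution. -/
def gather (n : ℕ) : (PCell → ℤ) →+ (Fin 32 → ℤ) :=
  AddMonoidHom.mk' (fun φ k => if dim32 k ≤ n then φ (n - dim32 k, 1, rep k) else 0) fun φ ψ => by
    funext k; simp only [Pi.add_apply]; split_ifs <;> simp

/-- The differential of the product resolution on invariant cochains of degree `n`. -/
def invD (n : ℕ) : (Fin 32 → ℤ) →+ (Fin 32 → ℤ) :=
  AddMonoidHom.mk' (fun v k => if dim32 k = n + 1 then D32 v k else
    if Even (n - dim32 k) then T32 v k - v k - D32 v k else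
      v k + T32 v k + T32 (T32 v) k + T32 (T32 (T32 v)) k + D32 v k) fun v w => by
    funext k; simp only [Pi.add_apply, map_add]; split_ifs <;> ring

lemma invD_apply (n : ℕ) (v : Fin 32 → ℤ) (k : Fin 32) : invD n v k =
    if dim32 k = n + 1 then D32 v k else
    if Even (n - dim32 k) then T32 v k - v k - D32 v k else
      v k + T32 v k + T32 (T32 v) k + T32 (T32 (T32 v)) k + D32 v k := rfl

/-- In degree n the orbit k occurs only in column n - dim k, so one vector in ℤ³² records the whole
invariant cochain. Invariance makes all copies equal, and the periodic differentials become T - 1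
and the norm. The sign of D is that of the target column, and column 0 receives no periodic part. -/
lemma totalD_spread (n : ℕ) (v : Fin 32 → ℤ) :
    totalD (spread n v) = spread (n + 1) (invD n v) := by
  refine ext_slice fun p g => ?_
  rw [slice_spread]
  rcases p with _ | p
  · rw [slice_zero_totalD, slice_spread, d_pull, D32_column]
    congr 1
    funext k
    rw [column_apply, column_apply, zero_add]
    split_ifs with h
    · rw [invD_apply, if_pos h]
    · rfl
  · by_cases hp : Even p
    · rw [slice_succ_totalD_of_even hp]
      simp only [slice_spread, d_pull, T_pull, T32_column, D32_column, ← map_sub]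
      congr 1
      funext k
      simp only [Pi.sub_apply, column_apply, add_right_comm p 1, add_left_inj]
      split_ifs with h
      · rw [invD_apply, if_neg (by omega), if_pos (by rwa [← h, Nat.add_sub_cancel])]
      · simp
    · rw [slice_succ_totalD_of_odd hp]
      simp only [slice_spread, d_pull, T_pull, T32_column, D32_column, ← map_add]
      congr 1
      funext k
      simp only [Pi.add_apply, column_apply, add_right_comm p 1, add_left_inj]
      split_ifs with h
      · rw [invD_apply, if_neg (by omega), if_neg (by rwa [← h, Nat.add_sub_cancel])]
      · simp

lemma gather_spread (n : ℕ) (v : Fin 32 → ℤ) (hv : ∀ k, n < dim32 k → v k = 0) :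
    gather n (spread n v) = v := by
  funext k
  change (if dim32 k ≤ n then pull (column n (n - dim32 k) v) (rep k) else 0) = v k
  split_ifs with h
  · change column n (n - dim32 k) v (cls (rep k)) = v k
    rw [cls_rep, column_apply, if_pos (by omega)]
  · exact (hv k (by omega)).symm

lemma spread_mem (n : ℕ) (v : Fin 32 → ℤ) : spread n v ∈ productResolution.inv n := by
  refine ⟨fun x hx => ?_, fun γ => ext_slice fun p g => ?_⟩
  · change (if x.1 + dim32 (cls x.2.2) = n then v _ else 0) = 0
    rw [dim_eq_dim32]
    exact if_neg hx
  · change slice p g (action γ (spread n v)) = _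
    rw [slice_action, slice_spread, slice_spread]
    exact pull_mem _ _

/-- Invariance under the holonomy group makes all copies of the cubulation carry the same cochain,
and invariance under translations makes that cochain periodic. -/
lemma spread_gather (n : ℕ) {φ : PCell → ℤ} (hφ : φ ∈ productResolution.inv n) :
    spread n (gather n φ) = φ := by
  have h1 (p : ℕ) (g : Holonomy) : slice p g φ = slice p 1 φ := by
    have : slice p g (action (SemidirectProduct.inr g) φ) = slice p g φ :=
      congrArg _ (hφ.2 (SemidirectProduct.inr g))
    rw [slice_action, SemidirectProduct.left_inr, map_one, SemidirectProduct.right_inr,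
      inv_mul_cancel] at this
    exact this.symm.trans (shift_zero _)
  have h2 (p : ℕ) : slice p 1 φ ∈ periodic := fun l => by
    have : slice p 1 (action (SemidirectProduct.inl (.ofAdd l)) φ) = slice p 1 φ :=
      congrArg _ (hφ.2 (SemidirectProduct.inl (.ofAdd l)))
    rw [slice_action, SemidirectProduct.left_inl, inv_one, map_one, SemidirectProduct.right_inl,
      inv_one, one_mul] at this
    exact this
  refine ext_slice fun p g => ?_
  rw [h1 p g, slice_spread, ← pull_push (h2 p)]
  congr 1
  funext k
  rw [column_apply]
  change _ = φ (p, 1, rep k)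
  split_ifs with h
  · change (if dim32 k ≤ n then φ (n - dim32 k, 1, rep k) else 0) = _
    rw [if_pos (by omega), ← h, Nat.add_sub_cancel]
  · exact (hφ.1 (p, 1, rep k) h).symm

lemma gather_supp (n : ℕ) (φ : PCell → ℤ) (k : Fin 32) (hk : n < dim32 k) :
    gather n φ k = 0 := if_neg (by omega)

/-- Cubes have dimension at most 4, so from degree 4 on every orbit has a column and no coordinate
is lost. -/
lemma spread_eq_zero {n : ℕ} (hn : 4 ≤ n) {v : Fin 32 → ℤ} (h : spread n v = 0) : v = 0 := by
  have h4 : ∀ k, dim32 k ≤ 4 := by decide +kernel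
  rw [← gather_spread n v fun k hk => absurd (h4 k) (by omega), h, map_zero]

/-! ### Explicit integral matrices for the degree 4 cohomology of the crystallographic group -/

/-- The functionals on cocycles of degree `4` that detect the cohomology. -/
def period4 : (Fin 32 → ℤ) →+ (Fin 4 → ℤ) := sparse
  [[(1, 16)], [(1, 1)], [(1, 2), (1, 6), (-1, 18), (2, 24)],
   [(1, 5), (-1, 9), (-2, 11), (-1, 13), (-1, 23), (-1, 29), (1, 31)]]

/-- Cocycles of degree `4` that generate the cohomology. -/
def cocycleBasis4 : (Fin 4 → ℤ) →+ (Fin 32 → ℤ) := sparse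
  [[(1, 0)], [(1, 1)], [], [], [], [], [(1, 2)], [], [], [], [], [], [], [], [], [(-1, 3)],
   [(1, 0)], [(1, 1)], [], [], [], [], [(1, 2)], [], [], [], [], [], [], [], [], [(1, 3)]]

/-- Cochains of degree `3` whose coboundaries are multiples of the generators. -/
def primitive4 : (Fin 4 → ℤ) →+ (Fin 32 → ℤ) := sparse
  [[(1, 0)], [(-1, 1)], [], [], [], [], [], [(-1, 3)], [], [], [], [], [], [], [], [], [(1, 0)],
   [(-1, 1)], [], [], [], [], [(1, 2)], [(1, 3)], [], [], [], [], [], [], [(1, 2)], []]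

/-- A contraction of the invariant cochains of degree `4` to the cohomology. -/
def homotopy4 : (Fin 32 → ℤ) →+ (Fin 32 → ℤ) := sparse
  [[(-1, 24)], [], [(-1, 2), (-1, 24)], [], [(-1, 18), (-1, 20), (2, 24)], [], [],
   [(1, 5), (-1, 9), (-1, 23)], [], [], [], [], [], [(1, 5), (-1, 9), (-1, 13)], [], [], [],
   [(-1, 9)], [(1, 20), (-1, 24)], [], [], [(-1, 5), (1, 9)], [], [],
   [(1, 2), (1, 10), (1, 20)], [], [], [(-1, 5), (1, 9), (-1, 11), (-1, 29)], [], [(1, 11)],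
   [(1, 14)], []]

/-- A contraction of the invariant cochains of degree `5`, multiplied by four. -/
def homotopy5 : (Fin 32 → ℤ) →+ (Fin 32 → ℤ) := sparse
  [[(4, 24)], [], [], [(-4, 5), (4, 9)], [(-4, 18), (4, 24)], [], [],
   [(2, 3), (-4, 5), (4, 9), (2, 19), (-2, 23)],
   [(1, 10), (1, 12), (-2, 18), (2, 24), (-1, 26), (-1, 28)], [], [], [],
   [(1, 10), (-3, 12), (2, 18), (-2, 24), (-1, 26), (-1, 28)], [], [],
   [(-2, 11), (-2, 23), (-2, 29), (-4, 31)], [], [(4, 9)], [], [(-4, 9), (-4, 19)], [],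
   [(4, 3), (-4, 5)], [(4, 18), (-4, 22), (-4, 24)], [], [],
   [(2, 3), (-4, 9), (-2, 11), (-2, 19), (2, 29)], [(-2, 10), (2, 12), (-2, 26), (2, 28)],
   [(-2, 3), (4, 5), (-4, 9), (-2, 11), (-2, 19), (-2, 29)],
   [(-3, 10), (1, 12), (-2, 18), (2, 24), (-1, 26), (-1, 28)], [],
   [(1, 10), (-1, 12), (2, 14), (2, 22), (-1, 26), (1, 28)], []]

/-- The orders of the generators of the cohomology in degree `4`. -/
def order4 : Fin 4 → ℕ := ![4, 2, 2, 2]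

-- The factor 4 clears the denominators in the part of the contraction that starts in degree 5. On
-- cocycles that part drops out, and the factor is cancelled because ℤ³² is torsion free.
set_option maxRecDepth 10000 in
lemma homotopy4_identity : (4 : ℕ) • (cocycleBasis4.comp period4 + (invD 3).comp homotopy4) +
    homotopy5.comp (invD 4) = (4 : ℕ) • AddMonoidHom.id _ :=
  hom_ext (by decide +kernel)

lemma invD_cocycleBasis4 : (invD 4).comp cocycleBasis4 = 0 := hom_ext (by decide +kernel)

lemma period4_cocycleBasis4 : period4.comp cocycleBasis4 = AddMonoidHom.id _ :=
  hom_ext (by decide +kernel)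

/-- Upper bound for the orders: the prescribed multiples of the generators are coboundaries. -/
lemma invD_primitive4 (y : Fin 4 → ℤ) :
    invD 3 (primitive4 y) = cocycleBasis4 fun i => order4 i * y i := by
  let F : (Fin 4 → ℤ) →+ (Fin 4 → ℤ) :=
    AddMonoidHom.mk' (fun y i => order4 i * y i) fun x y => by funext i; simp [mul_add]
  have : (invD 3).comp primitive4 = cocycleBasis4.comp F := hom_ext (by decide +kernel)
  exact DFunLike.congr_fun this y

/-- Lower bound for the orders: the functionals stay well defined on cohomology modulo 4, 2, 2, 2.
Orbits of 4-dimensional cubes are excluded since they have no column in degree 3. -/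
lemma order4_dvd_period4 (v : Fin 32 → ℤ) (hv : ∀ k, 3 < dim32 k → v k = 0) (i : Fin 4) :
    (order4 i : ℤ) ∣ period4 (invD 3 v) i := by
  have h : ∀ j, dim32 j ≤ 3 → ∀ i, (order4 i : ℤ) ∣ period4 (invD 3 (Pi.single j 1)) i := by
    decide +kernel
  change _ ∣ (period4.comp (invD 3)) v i
  rw [hom_apply]
  refine Finset.dvd_sum fun j _ => ?_
  rcases le_or_gt (dim32 j) 3 with hj | hj
  · exact Dvd.dvd.mul_left (h j hj i) _
  · rw [hv j hj, zero_mul]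
    exact dvd_zero _

/-- The reduction of integral vectors modulo the orders of the generators. -/
def reduce4 : (Fin 4 → ℤ) →+ ZMod 4 × (Fin 3 → ZMod 2) :=
  AddMonoidHom.mk' (fun y => ((y 0 : ZMod 4), fun i => (y i.succ : ZMod 2))) fun x y => by
    ext <;> simp

lemma reduce4_eq_zero_iff (y : Fin 4 → ℤ) : reduce4 y = 0 ↔ ∀ i, (order4 i : ℤ) ∣ y i := by
  change ((y 0 : ZMod 4), fun i : Fin 3 => (y i.succ : ZMod 2)) = 0 ↔ _
  rw [Prod.mk_eq_zero, funext_iff, Fin.forall_fin_succ (P := fun i => (order4 i : ℤ) ∣ y i),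
    ZMod.intCast_zmod_eq_zero_iff_dvd]
  refine and_congr Iff.rfl (forall_congr' fun i => ?_)
  rw [Pi.zero_apply, ZMod.intCast_zmod_eq_zero_iff_dvd]
  fin_cases i <;> rfl

/-- The fourth cohomology of the invariant cochains of the product resolution. -/
theorem productResolution_cohomology : SubquotientIso
    (cocyc productResolution.inv (fun _ => productResolution.d) 4)
    (cobound productResolution.inv (fun _ => productResolution.d) 4) productResolution.T
    (⊤ : AddSubgroup (ZMod 4 × (Fin 3 → ZMod 2))) ⊥ (AddMonoidHom.id _) := by
  have hd : ∀ φ, productResolution.d φ = totalD φ := fun _ => rfl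
  have h4 : ∀ k, ¬4 < dim32 k := by decide +kernel
  refine SubquotientIso.of_surjective (reduce4.comp (period4.comp (gather 4))) ?_ ?_
    (fun _ h => h) (fun _ _ => rfl)
  · rintro ⟨a, b⟩
    obtain ⟨a, rfl⟩ := ZMod.intCast_surjective a
    obtain ⟨b, rfl⟩ : ∃ c : Fin 3 → ℤ, (fun i => (c i : ZMod 2)) = b :=
      ⟨fun i => (b i).cast, funext fun i => ZMod.intCast_zmod_cast _⟩
    refine ⟨spread 4 (cocycleBasis4 (Fin.cons a b)), ⟨spread_mem _ _, ?_⟩, ?_⟩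
    · change totalD _ = 0
      rw [totalD_spread, show invD 4 (cocycleBasis4 _) = 0 from
        DFunLike.congr_fun invD_cocycleBasis4 _, map_zero]
    · simp only [AddMonoidHom.comp_apply]
      rw [gather_spread _ _ fun k hk => (h4 k hk).elim,
        show period4 (cocycleBasis4 _) = _ from DFunLike.congr_fun period4_cocycleBasis4 _]
      rfl
  · intro φ hφ
    simp only [AddMonoidHom.comp_apply]
    rw [reduce4_eq_zero_iff, mem_cobound_succ]
    constructor
    · intro h
      choose y hy using h
      have h0 : invD 4 (gather 4 φ) = 0 := by
        refine spread_eq_zero (n := 5) (by omega) ?_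
        rw [← totalD_spread, spread_gather 4 hφ.1]
        exact hφ.2
      have h1 := DFunLike.congr_fun homotopy4_identity (gather 4 φ)
      simp only [AddMonoidHom.add_apply, AddMonoidHom.comp_apply, AddMonoidHom.smul_apply,
        AddMonoidHom.id_apply, h0, map_zero, add_zero] at h1
      -- Cancelling 4 gives the gathered cochain as the combination of generators prescribed by its
      -- periods plus an explicit coboundary. Periods divisible by the orders turn the first summand
      -- into a coboundary too.
      have h2 := smul_right_injective (Fin 32 → ℤ) (show (4 : ℕ) ≠ 0 by omega) h1
      rw [show period4 (gather 4 φ) = fun i => order4 i * y i from funext hy,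
        ← invD_primitive4, ← map_add] at h2
      refine ⟨spread 3 (primitive4 y + homotopy4 (gather 4 φ)), spread_mem _ _, ?_⟩
      rw [hd, totalD_spread, h2, spread_gather 4 hφ.1]
    · rintro ⟨ψ, hψ, rfl⟩ i
      rw [hd, ← spread_gather 3 hψ, totalD_spread, gather_spread _ _ fun k hk => (h4 k hk).elim]
      exact order4_dvd_period4 _ (gather_supp 3 ψ) i

theorem groupCohomology_crystGroup :
    Nonempty (groupCohomology (Rep.trivial ℤ CrystGroup ℤ) 4 ≃+ ZMod 4 × (Fin 3 → ZMod 2)) := by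
  obtain ⟨e, -⟩ := ((productResolution.subquotientIso_groupCohomology (MonoidHom.id _) rfl
    4).symm.trans productResolution_cohomology).exists_equiv
  exact ⟨e⟩

end Crystal

/-! ### The cohomology of the holonomy group -/

namespace Crystal

/-- The representation of the holonomy group in which the generator acts by a matrix. -/
def matrixRep {n : ℕ} (A : Matrix (Fin n) (Fin n) ℤ) (hA : A ^ 4 = 1) : Rep.{0} ℤ Holonomy :=
  Rep.of (X := Fin n → ℤ)
    { toFun := fun g => (A ^ g.toAdd.val).mulVecLin
      map_one' := by
        simp [Module.End.one_eq_id]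
      map_mul' := fun g h => by
        rw [toAdd_mul, ZMod.val_add]
        have : A ^ ((g.toAdd.val + h.toAdd.val) % 4) = A ^ g.toAdd.val * A ^ h.toAdd.val := by
          rw [← pow_add]
          conv_rhs => rw [← Nat.div_add_mod (g.toAdd.val + h.toAdd.val) 4, pow_add, pow_mul, hA,
            one_pow, one_mul]
        rw [this, Matrix.mulVecLin_mul]
        rfl }

section

variable {n : ℕ} (A : Matrix (Fin n) (Fin n) ℤ) (hA : A ^ 4 = 1)

lemma matrixRep_apply (g : Holonomy) (x : Fin n → ℤ) :
    (matrixRep A hA).ρ g x = (A ^ g.toAdd.val).mulVec x := rfl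

lemma matrixRep_gen (x : Fin n → ℤ) : (matrixRep A hA).ρ gen x = A.mulVec x := by
  rw [matrixRep_apply]
  change (A ^ 1).mulVec x = _
  rw [pow_one]

lemma matrixRep_norm (x : Fin n → ℤ) : (matrixRep A hA).ρ.norm x =
    x + A.mulVec x + A.mulVec (A.mulVec x) + A.mulVec (A.mulVec (A.mulVec x)) := by
  have h : (matrixRep A hA).ρ.norm x = ∑ g : Holonomy, (matrixRep A hA).ρ g x :=
    LinearMap.sum_apply _ _ _
  refine h.trans ?_
  change ∑ g : Fin 4, (A ^ (g : ℕ)).mulVec x = _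
  rw [Fin.sum_univ_four]
  change (A ^ 0).mulVec x + (A ^ 1).mulVec x + (A ^ 2).mulVec x + (A ^ 3).mulVec x = _
  simp only [Matrix.mulVec_mulVec, pow_zero, Matrix.one_mulVec, pow_succ, one_mul, mul_assoc]

lemma gen_generates (g : Holonomy) : g ∈ Subgroup.zpowers gen := by
  revert g
  refine forall_holonomy ?_ ?_ ?_ ?_
  · exact one_mem _
  · exact Subgroup.mem_zpowers _
  · exact mul_mem (Subgroup.mem_zpowers _) (Subgroup.mem_zpowers _)
  · exact mul_mem (mul_mem (Subgroup.mem_zpowers _) (Subgroup.mem_zpowers _))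
      (Subgroup.mem_zpowers _)

/-- Both groups are the quotient of K by the same kernel. -/
lemma nonempty_equiv_of_surjective {K H B : Type*} [AddCommGroup K] [AddCommGroup H]
    [AddCommGroup B] (π : K →+ H) (θ : K →+ B) (hπ : Function.Surjective π)
    (hθ : Function.Surjective θ) (h : ∀ x, π x = 0 ↔ θ x = 0) : Nonempty (H ≃+ B) := by
  have hker : π.ker = θ.ker := AddSubgroup.ext h
  exact ⟨(QuotientAddGroup.quotientKerEquivOfSurjective π hπ).symm.trans
    ((QuotientAddGroup.quotientAddEquivOfEq hker).trans
      (QuotientAddGroup.quotientKerEquivOfSurjective θ hθ))⟩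

/-- The cohomology of the holonomy group in even positive degrees. -/
lemma groupCohomology_even {B : Type} [AddCommGroup B] (θ : (Fin n → ℤ) →+ B) (i : ℕ) [NeZero i]
    (hi : Even i) (hθ : ∀ b, ∃ x, A.mulVec x = x ∧ θ x = b)
    (hker : ∀ x, A.mulVec x = x → (θ x = 0 ↔ ∃ y,
      y + A.mulVec y + A.mulVec (A.mulVec y) + A.mulVec (A.mulVec (A.mulVec y)) = x)) :
    Nonempty (groupCohomology (matrixRep A hA) i ≃+ B) := by
  have hmem (x : Fin n → ℤ) : (show matrixRep A hA from x) ∈ LinearMap.ker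
      (Rep.applyAsHom (matrixRep A hA) gen - 𝟙 (matrixRep A hA)).hom.toLinearMap ↔
      A.mulVec x = x := by
    have h : (x : matrixRep A hA) ∈ LinearMap.ker
        (Rep.applyAsHom (matrixRep A hA) gen - 𝟙 (matrixRep A hA)).hom.toLinearMap ↔
        (matrixRep A hA).ρ gen x - (show matrixRep A hA from x) = 0 := Iff.rfl
    exact h.trans (sub_eq_zero.trans (Iff.of_eq (congrArg (· = x) (matrixRep_gen A hA x))))
  refine nonempty_equiv_of_surjective
    (Rep.FiniteCyclicGroup.groupCohomologyπEven (matrixRep A hA) gen gen_generates i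
      hi).hom.toAddMonoidHom
    (θ.comp (Submodule.subtype _).toAddMonoidHom) ?_ ?_ ?_
  · exact (ModuleCat.epi_iff_surjective (Rep.FiniteCyclicGroup.groupCohomologyπEven
      (matrixRep A hA) gen gen_generates i hi)).1
      (epi_comp' (@IsIso.epi_of_iso _ _ _ _ _ (Iso.isIso_inv _))
        (epi_comp' inferInstance inferInstance))
  · intro b
    obtain ⟨x, hx, rfl⟩ := hθ b
    exact ⟨⟨x, (hmem x).2 hx⟩, rfl⟩
  · intro x
    refine (Rep.FiniteCyclicGroup.groupCohomologyπEven_eq_zero_iff (matrixRep A hA) gen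
      gen_generates i hi x).trans ?_
    refine Iff.trans ?_ (hker x.1 ((hmem x.1).1 x.2)).symm
    exact exists_congr fun y => Iff.of_eq (congrArg (· = x.1) (matrixRep_norm A hA y))

/-- The cohomology of the holonomy group in odd degrees. -/
lemma groupCohomology_odd {B : Type} [AddCommGroup B] (θ : (Fin n → ℤ) →+ B) (i : ℕ)
    (hi : Odd i) (hθ : ∀ b, ∃ x, x + A.mulVec x + A.mulVec (A.mulVec x) +
      A.mulVec (A.mulVec (A.mulVec x)) = 0 ∧ θ x = b)
    (hker : ∀ x, x + A.mulVec x + A.mulVec (A.mulVec x) + A.mulVec (A.mulVec (A.mulVec x)) = 0 →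
      (θ x = 0 ↔ ∃ y, A.mulVec y - y = x)) :
    Nonempty (groupCohomology (matrixRep A hA) i ≃+ B) := by
  have hmem (x : Fin n → ℤ) : (show matrixRep A hA from x) ∈ LinearMap.ker (matrixRep A hA).norm.hom.toLinearMap ↔
      x + A.mulVec x + A.mulVec (A.mulVec x) + A.mulVec (A.mulVec (A.mulVec x)) = 0 := by
    exact Iff.of_eq (congrArg (· = 0) (matrixRep_norm A hA x))
  refine nonempty_equiv_of_surjective
    (Rep.FiniteCyclicGroup.groupCohomologyπOdd (matrixRep A hA) gen gen_generates i
      hi).hom.toAddMonoidHom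
    (θ.comp (Submodule.subtype _).toAddMonoidHom) ?_ ?_ ?_
  · exact (ModuleCat.epi_iff_surjective (Rep.FiniteCyclicGroup.groupCohomologyπOdd
      (matrixRep A hA) gen gen_generates i hi)).1
      (epi_comp' (@IsIso.epi_of_iso _ _ _ _ _ (Iso.isIso_inv _))
        (epi_comp' inferInstance inferInstance))
  · intro b
    obtain ⟨x, hx, rfl⟩ := hθ b
    exact ⟨⟨x, (hmem x).2 hx⟩, rfl⟩
  · intro x
    refine (Rep.FiniteCyclicGroup.groupCohomologyπOdd_eq_zero_iff (matrixRep A hA) gen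
      gen_generates i hi x).trans ?_
    refine Iff.trans ?_ (hker x.1 ((hmem x.1).1 x.2)).symm
    exact exists_congr fun y => Iff.of_eq
      (congrArg (fun z : Fin n → ℤ => z - (show Fin n → ℤ from y) = x.1) (matrixRep_gen A hA y))

/-- The cohomology of the holonomy group in degree zero. -/
lemma groupCohomology_zero_subsingleton (h : ∀ x, A.mulVec x = x → x = 0) :
    Subsingleton (groupCohomology (matrixRep A hA) 0) := by
  have : Subsingleton (LinearMap.ker
      (Rep.applyAsHom (matrixRep A hA) gen - 𝟙 (matrixRep A hA)).hom.toLinearMap) := by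
    refine subsingleton_of_forall_eq 0 fun x => Subtype.ext (h x.1 ?_)
    exact (matrixRep_gen A hA x.1).symm.trans (sub_eq_zero.1 (LinearMap.mem_ker.1 x.2))
  exact (Rep.FiniteCyclicGroup.groupCohomologyIso₀ (matrixRep A hA) gen
    gen_generates).toLinearEquiv.toEquiv.subsingleton

/-- An isomorphism of abelian groups is linear over the integers. -/
def intLinearEquiv {M N : Type*} [AddCommGroup M] [AddCommGroup N] [Module ℤ M] [Module ℤ N]
    (e : M ≃+ N) : M ≃ₗ[ℤ] N :=
  { e with map_smul' := fun c b => map_intCast_smul e ℤ ℤ c b }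

/-- A module over the holonomy group is determined by the action of the generator. -/
lemma groupCohomology_equiv_matrixRep (B : Rep.{0} ℤ Holonomy) (e : B ≃+ (Fin n → ℤ))
    (he : ∀ b, e (B.ρ gen b) = A.mulVec (e b)) (i : ℕ) :
    Nonempty (groupCohomology B i ≃+ groupCohomology (matrixRep A hA) i) := by
  have key : ∀ g : Holonomy, ∀ b, e (B.ρ g b) = (matrixRep A hA).ρ g (e b) := by
    have hmul (g h : Holonomy) (hg : ∀ b, e (B.ρ g b) = (matrixRep A hA).ρ g (e b))
        (hh : ∀ b, e (B.ρ h b) = (matrixRep A hA).ρ h (e b)) (b : B) :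
        e (B.ρ (g * h) b) = (matrixRep A hA).ρ (g * h) (e b) := by
      rw [map_mul, map_mul]
      exact (hg _).trans (congrArg _ (hh b))
    have h1 : ∀ b, e (B.ρ gen b) = (matrixRep A hA).ρ gen (e b) := fun b => by
      rw [he, matrixRep_gen]
    refine forall_holonomy (fun b => ?_) h1 (hmul _ _ h1 h1) (hmul _ _ (hmul _ _ h1 h1) h1)
    rw [map_one, map_one]
    rfl
  exact ⟨(groupCohomology.mapIso (B := B) (A := matrixRep A hA) (MulEquiv.refl Holonomy)
    (@intLinearEquiv B (Fin n → ℤ) _ _ B.hV2 _ e) (fun g => DFunLike.ext _ _ fun b => key g b)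
    i).toLinearEquiv.toAddEquiv⟩

end

/-! ### Holonomy cohomology with coefficients in the cohomology of the lattice -/

lemma A1_pow : A1 ^ 4 = 1 := by decide +kernel

lemma A2_pow : A2 ^ 4 = 1 := by decide +kernel

lemma A3_pow : A3 ^ 4 = 1 := by decide +kernel

lemma A1_mulVec (x : Fin 4 → ℤ) :
    A1.mulVec x = ![x 0 + 2 * x 3, x 1 + x 3, -x 2, -x 0 - x 3] := by
  funext i
  fin_cases i <;> simp [A1, Matrix.mulVec, dotProduct, Fin.sum_univ_succ]
  ring

lemma A2_mulVec (x : Fin 6 → ℤ) : A2.mulVec x =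
    ![-x 0 - 2 * x 2, x 1, x 0 + x 2, x 2 - x 3, x 4 - x 5, x 1 + 2 * x 4 - x 5] := by
  funext i
  fin_cases i <;> simp [A2, Matrix.mulVec, dotProduct, Fin.sum_univ_succ] <;> ring

lemma A3_mulVec (x : Fin 4 → ℤ) :
    A3.mulVec x = ![-x 0 + x 1 - 2 * x 2, -x 1, x 0 - x 1 + x 2, x 3] := by
  funext i
  fin_cases i <;> simp [A3, Matrix.mulVec, dotProduct, Fin.sum_univ_succ] <;> ring

/-- The reduction of a linear functional modulo `m`. -/
def modHom {n : ℕ} (m : ℕ) (c : Fin n → ℤ) : (Fin n → ℤ) →+ ZMod m :=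
  AddMonoidHom.mk' (fun x => ((c ⬝ᵥ x : ℤ) : ZMod m)) fun x y => by simp

lemma modHom_eq_zero_iff {n : ℕ} (m : ℕ) (c x : Fin n → ℤ) :
    modHom m c x = 0 ↔ (m : ℤ) ∣ c ⬝ᵥ x := ZMod.intCast_zmod_eq_zero_iff_dvd _ _

/-- A functional that takes the value 1 on a vector already hits every residue on its multiples, so
one admissible vector settles surjectivity. -/
lemma exists_modHom {n : ℕ} {m : ℕ} {c : Fin n → ℤ} {P : (Fin n → ℤ) → Prop} (y : Fin n → ℤ)
    (hP : ∀ a : ℤ, P (a • y)) (hy : c ⬝ᵥ y = 1) (b : ZMod m) : ∃ x, P x ∧ modHom m c x = b := by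
  obtain ⟨a, rfl⟩ := ZMod.intCast_surjective b
  refine ⟨a • y, hP a, ?_⟩
  change ((c ⬝ᵥ (a • y) : ℤ) : ZMod m) = _
  rw [dotProduct_smul, hy, smul_eq_mul, mul_one]

lemma holonomy_cohomology_four_zero :
    Nonempty (groupCohomology (matrixRep (1 : Matrix (Fin 1) (Fin 1) ℤ) (one_pow 4)) 4 ≃+
      ZMod 4) := by
  refine groupCohomology_even _ _ (modHom 4 ![1]) 4 (by decide) (exists_modHom ![1] ?_ rfl) ?_
  · exact fun a => Matrix.one_mulVec _
  · intro x _
    rw [modHom_eq_zero_iff]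
    simp only [Matrix.one_mulVec, dotProduct, funext_iff, Fin.forall_fin_one, Pi.add_apply,
      Fin.sum_univ_one, Matrix.cons_val]
    constructor
    · rintro ⟨y, hy⟩
      exact ⟨![y], by simp only [Matrix.cons_val]; omega⟩
    · rintro ⟨y, hy⟩
      omega

/-- Coordinate 2 is a sign representation, where the norm vanishes and A - 1 is multiplication by
-2; it contributes ℤ/2. On the other coordinates the norm kernel is x₀ = 2 x₁, which is exactly the
image of A - 1. -/
lemma holonomy_cohomology_three_one :
    Nonempty (groupCohomology (matrixRep A1 A1_pow) 3 ≃+ ZMod 2) := by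
  refine groupCohomology_odd _ _ (modHom 2 ![0, 0, 1, 0]) 3 (by decide)
    (exists_modHom ![0, 0, 1, 0] ?_ (by decide)) ?_
  · intro a
    funext i
    fin_cases i <;> simp [A1_mulVec]
  · intro x hx
    rw [modHom_eq_zero_iff]
    simp only [A1_mulVec, dotProduct, funext_iff, Fin.forall_fin_succ, Fin.sum_univ_four,
      Pi.add_apply, Pi.sub_apply, Pi.zero_apply, Matrix.cons_val, IsEmpty.forall_iff, and_true,
      Fin.succ_zero_eq_one, Fin.succ_one_eq_two, Fin.reduceSucc] at hx ⊢
    constructor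
    · rintro ⟨y, hy⟩
      exact ⟨![-x 3 - 2 * x 1, 0, -y, x 1], by simp only [Matrix.cons_val]; omega⟩
    · rintro ⟨y, hy⟩
      omega

/-- The fixed vectors are the multiples of (0, -2, 0, 0, 1, 0). The norm of the basis vector 1 is
(0, 4, 0, 0, -2, 0), so norms are the even multiples. -/
lemma holonomy_cohomology_two_two :
    Nonempty (groupCohomology (matrixRep A2 A2_pow) 2 ≃+ ZMod 2) := by
  refine groupCohomology_even _ _ (modHom 2 ![0, 0, 0, 0, 1, 0]) 2 (by decide)
    (exists_modHom ![0, -2, 0, 0, 1, 0] ?_ (by decide)) ?_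
  · intro a
    funext i
    fin_cases i <;> simp [A2_mulVec]
    ring
  · intro x hx
    rw [modHom_eq_zero_iff]
    simp only [A2_mulVec, dotProduct, funext_iff, Fin.forall_fin_succ, Fin.sum_univ_six,
      Pi.add_apply, Matrix.cons_val, IsEmpty.forall_iff, and_true,
      Fin.succ_zero_eq_one, Fin.succ_one_eq_two, Fin.reduceSucc] at hx ⊢
    constructor
    · rintro ⟨y, hy⟩
      exact ⟨![0, -y, 0, 0, 0, 0], by simp only [Matrix.cons_val]; omega⟩
    · rintro ⟨y, hy⟩
      omega

/-- The norm kernel is x₃ = 0. The image of A - 1 has index 4 in it and is cut out by 4 ∣ 2 x₀ + x₁;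
the witness below solves the resulting triangular system. -/
lemma holonomy_cohomology_one_three :
    Nonempty (groupCohomology (matrixRep A3 A3_pow) 1 ≃+ ZMod 4) := by
  refine groupCohomology_odd _ _ (modHom 4 ![2, 1, 0, 0]) 1 (by decide)
    (exists_modHom ![0, 1, 0, 0] ?_ (by decide)) ?_
  · intro a
    funext i
    fin_cases i <;> simp [A3_mulVec] <;> ring
  · intro x hx
    rw [modHom_eq_zero_iff]
    simp only [A3_mulVec, dotProduct, funext_iff, Fin.forall_fin_succ, Fin.sum_univ_four,
      Pi.add_apply, Pi.sub_apply, Pi.zero_apply, Matrix.cons_val, IsEmpty.forall_iff, and_true,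
      Fin.succ_zero_eq_one, Fin.succ_one_eq_two, Fin.reduceSucc] at hx ⊢
    constructor
    · rintro ⟨y, hy⟩
      exact ⟨![x 2 - (2 * y - x 0), -(2 * y - x 0), y - x 0 - x 2, 0], by
        simp only [Matrix.cons_val]; omega⟩
    · rintro ⟨y, hy⟩
      omega

lemma neg_one_pow_four : (-1 : Matrix (Fin 1) (Fin 1) ℤ) ^ 4 = 1 := by decide

lemma holonomy_cohomology_zero_four :
    Subsingleton (groupCohomology (matrixRep (-1 : Matrix (Fin 1) (Fin 1) ℤ) neg_one_pow_four)
      0) := by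
  refine groupCohomology_zero_subsingleton _ _ fun x hx => ?_
  rw [Matrix.neg_mulVec, Matrix.one_mulVec] at hx
  funext i
  have := congrFun hx i
  simp only [Pi.neg_apply, Pi.zero_apply] at this ⊢
  omega

/-! ### The cohomology of the lattice as a module over the holonomy group -/

lemma cubicalResolution_inv {H S : Type*} [Group H] [MulAction H S] (lat : H →* TransLattice)
    (hlat : Function.Surjective lat) (pos : TransLattice → S) (hpos) (frame : S → H) (hframe)
    (tS : S → S) (β : H → H) (htS) (hβ) (q : ℕ) :
    (cubicalResolution lat pos hpos frame hframe tS β htS hβ).inv q = latticeInv q := by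
  ext f
  refine and_congr Iff.rfl ⟨fun h l => ?_, fun h x => h _⟩
  obtain ⟨x, hx⟩ := hlat (.ofAdd l)
  have := h x
  change shift (lat x).toAdd f = f at this
  rwa [hx] at this

lemma holonomyAction_gen (l : TransLattice) :
    holonomyAction gen l = .ofAdd (holonomyMatrix.mulVec l.toAdd) := by
  change Multiplicative.ofAdd ((holonomyMatrix ^ (1 : ZMod 4).val).mulVec _) = _
  rw [show (1 : ZMod 4).val = 1 from rfl, pow_one]

lemma mulVec_holonomyAction_gen_inv (l : TransLattice) :
    holonomyMatrix.mulVec (holonomyAction gen⁻¹ l).toAdd = l.toAdd := by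
  have h : holonomyAction gen (holonomyAction gen⁻¹ l) = l := by
    rw [← MulAut.mul_apply, ← map_mul, mul_inv_cancel, map_one, MulAut.one_apply]
  rw [holonomyAction_gen] at h
  exact congrArg Multiplicative.toAdd h

/-- The cohomology of the lattice, as a module over the holonomy group. -/
theorem cohomologyRep_equiv {q n : ℕ} (A : Matrix (Fin n) (Fin n) ℤ)
    (h : SubquotientIso (cocyc latticeInv (fun _ => Cubical.d) q)
      (cobound latticeInv (fun _ => Cubical.d) q) T (⊤ : AddSubgroup (Fin n → ℤ)) ⊥
      A.mulVecLin.toAddMonoidHom) :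
    ∃ e : cohomologyRep holonomyAction q ≃+ (Fin n → ℤ),
      ∀ b, e ((cohomologyRep holonomyAction q).ρ gen b) = A.mulVec (e b) := by
  -- The lattice acts on itself. The endomorphism of tuples is induced by gen⁻¹ because in
  -- `cohomologyRep` an element g acts by pullback along g⁻¹; on cubical cochains it corresponds to
  -- `T`.
  let R : CellResolution TransLattice TransLattice (Fin 4 → ℤ) :=
    cubicalResolution (MonoidHom.id _) id (fun _ _ => rfl) id (fun _ _ => rfl)
      (holonomyAction gen⁻¹) (holonomyAction gen⁻¹) (fun h s => map_mul _ h s)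
      mulVec_holonomyAction_gen_inv
  have hR : R.inv = latticeInv := funext fun q =>
    cubicalResolution_inv _ Function.surjective_id _ _ _ _ _ _ _ _ q
  have h1 := R.subquotientIso_groupCohomology (holonomyAction gen⁻¹).toMonoidHom rfl q
  rw [hR] at h1
  exact (h1.symm.trans h).exists_equiv

end Crystal

/-! ### The second page of the Lyndon–Hochschild–Serre spectral sequence -/

/-- The differential of the inhomogeneous cochains of a representation. -/
def repD {k Q : Type} [CommRing k] [Group Q] (V : Rep.{0} k Q) (p : ℕ) :
    ((Fin p → Q) → V) →+ ((Fin (p + 1) → Q) → V) :=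
  (inhomogeneousCochains.d V p).hom.toAddMonoidHom

lemma repD_apply {k Q : Type} [CommRing k] [Group Q] (V : Rep.{0} k Q) (p : ℕ) (f : (Fin p → Q) → V)
    (g : Fin (p + 1) → Q) : repD V p f g = V.ρ (g 0) (f fun i => g i.succ) +
      ∑ j : Fin (p + 1), (-1 : k) ^ ((j : ℕ) + 1) • f (Fin.contractNth j (· * ·) g) := rfl

lemma subquotientIso_repD {k Q : Type} [CommRing k] [Group Q] (V : Rep.{0} k Q) (p : ℕ) :
    SubquotientIso (cocyc (fun n => (⊤ : AddSubgroup ((Fin n → Q) → V))) (repD V) p)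
      (cobound (fun n => (⊤ : AddSubgroup ((Fin n → Q) → V))) (repD V) p) (AddMonoidHom.id _)
      (⊤ : AddSubgroup (groupCohomology V p)) ⊥ (AddMonoidHom.id _) := by
  have hd : complexD (groupCohomology.inhomogeneousCochains V) = repD V := by
    funext n
    exact congrArg (fun f : (_ ⟶ _) => (ModuleCat.Hom.hom f).toAddMonoidHom)
      (groupCohomology.inhomogeneousCochains.d_def (A := V) n)
  have := CochainComplex.subquotientIso_homology (groupCohomology.inhomogeneousCochains V) (𝟙 _) p
  rw [hd, HomologicalComplex.homologyMap_id] at this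
  exact this

namespace LHS

variable {k Γ : Type} [CommRing k] [Group Γ] (A : Rep.{0} k Γ) (N : Subgroup Γ) [N.Normal]

lemma exists_single (p q : ℕ) (c : K A N p q) : ∃ x : Tot A N, x p q = c ∧
    ∀ p' q', (p' ≠ p ∨ q' ≠ q) → x p' q' = 0 := by
  classical
  refine ⟨fun p' q' => if h : p = p' ∧ q = q' then h.1 ▸ h.2 ▸ c else 0,
    dif_pos ⟨rfl, rfl⟩, fun p' q' h => dif_neg fun h' => ?_⟩
  exact h.elim (fun h => h h'.1.symm) fun h => h h'.2.symm

/-- In total degree n the only component in column p sits in row q, so its vanishing raises the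
filtration. -/
lemma mem_fil_succ {p q : ℕ} {n : ℤ} {x : Tot A N} (hn : (p : ℤ) + q = n)
    (hdeg : x ∈ (filtered A N).deg n) (hfil : x ∈ (filtered A N).fil p) (h : x p q = 0) :
    x ∈ (filtered A N).fil (p + 1) := by
  intro p' q' hp'
  rcases eq_or_ne p' p with rfl | hp
  · rcases eq_or_ne q' q with rfl | hq
    · exact h
    · exact hdeg p' q' (by omega)
  · exact hfil p' q' (by omega)

lemma filtered_D_apply (x : Tot A N) (p q : ℕ) :
    (filtered A N).D x p q = totH A N x p q + totV A N x p q := rfl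

lemma D_apply_of_mem_fil {p : ℕ} {x : Tot A N} (hfil : x ∈ (filtered A N).fil p) (q : ℕ) :
    (filtered A N).D x p (q + 1) = (-1 : k) ^ p • dv A N p q (x p q) := by
  rw [filtered_D_apply, totH_eq_zero A N x p _ fun p' hp' => hfil p' _ (by omega), zero_add,
    totV_succ]

lemma neg_one_pow_smul_smul {k M : Type*} [CommRing k] [AddCommGroup M] [Module k M] (p : ℕ) (x : M) :
    (-1 : k) ^ p • (-1 : k) ^ p • x = x := by
  rw [smul_smul, ← mul_pow]
  simp

lemma neg_one_pow_smul_eq_zero {k M : Type*} [CommRing k] [AddCommGroup M] [Module k M] {p : ℕ}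
    {x : M}
    (h : (-1 : k) ^ p • x = 0) : x = 0 := by
  rw [← neg_one_pow_smul_smul (k := k) p x, h, smul_zero]

/-- The cocycles of degree `q` of the complex of `N`-equivariant cochains. -/
noncomputable def barCocycles (q : ℕ) : Submodule k (barHomInv A N q) :=
  LinearMap.ker (barInvD A N q).hom.toLinearMap

/-- The coboundaries of degree `q` of the complex of `N`-equivariant cochains. -/
noncomputable def barCoboundaries : ∀ q : ℕ, Submodule k (barHomInv A N q)
  | 0 => ⊥
  | q + 1 => LinearMap.range (barInvD A N q).hom.toLinearMap

lemma mem_barCocycles {q : ℕ} {z : barHomInv A N q} :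
    z ∈ barCocycles A N q ↔ (barInvD A N q).hom z = 0 := Iff.rfl

lemma dv_eq_zero_iff {p q : ℕ} {x : K A N p q} :
    dv A N p q x = 0 ↔ ∀ g, x g ∈ barCocycles A N q := funext_iff

lemma dh_mem_barCocycles {p q : ℕ} {x : K A N p q} (hx : ∀ g, x g ∈ barCocycles A N q) (g) :
    dh A N p q x g ∈ barCocycles A N q := by
  have h := dh_dv A N p q x
  rw [(dv_eq_zero_iff A N).2 hx, map_zero] at h
  exact (dv_eq_zero_iff A N).1 h.symm g

/-- An element of the total complex with a given vertical coboundary. -/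
lemma exists_totV (p q : ℕ) (c : K A N p q) (hc : ∀ g, c g ∈ barCoboundaries A N q) :
    ∃ y : Tot A N, y ∈ (filtered A N).deg (p + q - 1) ∧ y ∈ (filtered A N).fil p ∧
      totV A N y p q = c := by
  rcases q with _ | q
  · refine ⟨0, zero_mem _, zero_mem _, ?_⟩
    rw [map_zero]
    exact (funext hc : c = 0).symm
  · choose b hb using hc
    obtain ⟨y, hy, hy'⟩ := exists_single A N p q ((-1 : k) ^ p • b)
    refine ⟨y, fun p' q' h => hy' p' q' ?_, fun p' q' h => hy' p' q' (Or.inl (by omega)), ?_⟩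
    · push_cast at h
      by_contra! h'
      exact h (by rw [h'.1, h'.2]; ring)
    · rw [totV_succ, hy, map_smul]
      refine (neg_one_pow_smul_smul p _).trans (funext hb)

/-! ### Identification of the second page, given a model of the vertical cohomology -/

section

variable {q : ℕ} (V : Rep.{0} k (Γ ⧸ N)) (θ : barCocycles A N q →ₗ[k] V)
  (hsurj : ∀ v, ∃ z, θ z = v)
  (hker : ∀ z, θ z = 0 ↔ (z : barHomInv A N q) ∈ barCoboundaries A N q)
  (hequiv : ∀ (γ : Γ ⧸ N) (z w : barCocycles A N q),
    (w : barHomInv A N q) = (barHomInv A N q).ρ γ z → θ w = V.ρ γ (θ z))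

-- Equivariance of θ carries the horizontal differential to the cochain differential of the quotient
-- group with values in the vertical cohomology.
include hequiv in
lemma repD_of_dh {p : ℕ} {x : K A N p q} (hx : ∀ g, x g ∈ barCocycles A N q)
    {f : (Fin p → Γ ⧸ N) → V} (hf : ∀ g, θ ⟨x g, hx g⟩ = f g) (g : Fin (p + 1) → Γ ⧸ N) :
    θ ⟨dh A N p q x g, dh_mem_barCocycles A N hx g⟩ = repD V p f g := by
  have hρ : (barHomInv A N q).ρ (g 0) (x fun i => g i.succ) ∈ barCocycles A N q := by
    rw [mem_barCocycles, Rep.hom_comm_apply, (mem_barCocycles A N).1 (hx _), map_zero]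
  have : (⟨dh A N p q x g, dh_mem_barCocycles A N hx g⟩ : barCocycles A N q) =
      ⟨_, hρ⟩ + ∑ j : Fin (p + 1), (-1 : k) ^ ((j : ℕ) + 1) •
        (⟨_, hx (Fin.contractNth j (· * ·) g)⟩ : barCocycles A N q) := by
    refine Subtype.ext ?_
    simp only [Submodule.coe_add, AddSubmonoidClass.coe_finsetSum, Submodule.coe_smul]
    rfl
  rw [this, map_add, map_sum, repD_apply, hequiv (g 0) ⟨_, hx _⟩ ⟨_, hρ⟩ rfl, hf]
  simp only [map_smul, hf]

include hker hequiv in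
lemma repD_eq_zero {p : ℕ} {x : Tot A N} (hx : ∀ g, x p q g ∈ barCocycles A N q)
    {f : (Fin p → Γ ⧸ N) → V} (hf : ∀ g, θ ⟨x p q g, hx g⟩ = f g)
    (h : ∀ g, dh A N p q (x p q) g ∈ barCoboundaries A N q) :
    repD V p f = 0 := by
  funext g
  rw [← repD_of_dh A N V θ hequiv hx hf g]
  exact (hker _).2 (h g)

lemma totV_mem_barCoboundaries (x : Tot A N) (p : ℕ) (g) :
    totV A N x p q g ∈ barCoboundaries A N q := by
  rcases q with _ | q
  · exact zero_mem _
  · exact Submodule.smul_mem _ _ ⟨x p q g, rfl⟩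

/-- The coboundary of x has no component in column p, and on that column it is the vertical
differential alone, since x vanishes further left. -/
lemma mem_barCocycles_of_mem_Z {p : ℕ} {n : ℤ} {x : Tot A N}
    (hx : x ∈ (filtered A N).Z 1 p n) (g) : x p q g ∈ barCocycles A N q := by
  have h : (filtered A N).D x p (q + 1) = 0 := hx.2 p (q + 1) (by omega)
  rw [D_apply_of_mem_fil A N hx.1.2] at h
  exact (dv_eq_zero_iff A N).1 (neg_one_pow_smul_eq_zero h) g

lemma Z_le {r r' p n : ℤ} (h : r' ≤ r) : (filtered A N).Z r p n ≤ (filtered A N).Z r' p n :=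
  fun _ hx => ⟨hx.1, (filtered A N).fil_anti (by omega) hx.2⟩

lemma D_succ_apply {p : ℕ} {x : Tot A N} (q : ℕ) :
    (filtered A N).D x (p + 1) q = dh A N p q (x p q) + totV A N x (p + 1) q := rfl

include hsurj in
/-- A lift of a cochain with values in the cohomology to the total complex. -/
lemma exists_lift (p : ℕ) (f : (Fin p → Γ ⧸ N) → V) :
    ∃ x : Tot A N, ∃ hx : ∀ g, x p q g ∈ barCocycles A N q, (∀ g, θ ⟨x p q g, hx g⟩ = f g) ∧
      ∀ p' q', (p' ≠ p ∨ q' ≠ q) → x p' q' = 0 := by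
  choose z hz using fun g => hsurj (f g)
  obtain ⟨x, h, h'⟩ := exists_single A N p q fun g => (z g : barHomInv A N q)
  refine ⟨x, fun g => ?_, fun g => ?_, h'⟩
  · rw [h]
    exact (z g).2
  · rw [← hz g]
    congr 1
    exact Subtype.ext (congrFun h g)

lemma mem_deg_of_single {p : ℕ} {n : ℤ} (hn : (p : ℤ) + q = n) {x : Tot A N}
    (hx : ∀ p' q', (p' ≠ p ∨ q' ≠ q) → x p' q' = 0) : x ∈ (filtered A N).deg n :=
  fun p' q' h => hx p' q' (by by_contra! h'; exact h (by rw [h'.1, h'.2, hn]))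

lemma mem_fil_of_single {p : ℕ} {x : Tot A N}
    (hx : ∀ p' q', (p' ≠ p ∨ q' ≠ q) → x p' q' = 0) : x ∈ (filtered A N).fil p :=
  fun p' q' h => hx p' q' (Or.inl (by omega))

/-- An element of `F^p` whose component in the column `p` is a coboundary is in `F^(p+1)` up to a
coboundary. -/
lemma exists_sub_D_mem {p : ℕ} {n : ℤ} (hn : (p : ℤ) + q = n) {x : Tot A N}
    (hdeg : x ∈ (filtered A N).deg n) (hfil : x ∈ (filtered A N).fil p)
    (hx : ∀ g, x p q g ∈ barCoboundaries A N q) :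
    ∃ y ∈ (filtered A N).deg (n - 1), y ∈ (filtered A N).fil p ∧
      x - (filtered A N).D y ∈ (filtered A N).fil (p + 1) := by
  obtain ⟨y, hy, hy', hy''⟩ := exists_totV A N p q (x p q) hx
  rw [hn] at hy
  refine ⟨y, hy, hy', mem_fil_succ A N hn (sub_mem hdeg ?_) (sub_mem hfil
    ((filtered A N).D_fil _ _ hy')) ?_⟩
  · simpa using (filtered A N).D_deg _ _ hy
  · change x p q - (filtered A N).D y p q = 0
    rw [filtered_D_apply, hy'', totH_eq_zero A N y p q fun p' hp' => hy' p' q (by omega), zero_add,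
      sub_self]

lemma Tot.sub_apply (x y : Tot A N) (p q : ℕ) : (x - y) p q = x p q - y p q := rfl

-- The coboundary of x also vanishes in column p + 1, so the horizontal differential of the leading
-- term is minus a vertical coboundary, which θ kills.
include hker hequiv in
lemma repD_eq_zero_of_mem_Z {p : ℕ} {n : ℤ} {x : Tot A N} (hx : x ∈ (filtered A N).Z 2 p n)
    {f : (Fin p → Γ ⧸ N) → V} (hx1 : ∀ g, x p q g ∈ barCocycles A N q)
    (hf : ∀ g, θ ⟨x p q g, hx1 g⟩ = f g) : repD V p f = 0 := by
  refine repD_eq_zero A N V θ hker hequiv hx1 hf fun g => ?_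
  have h0 : (filtered A N).D x (p + 1) q = 0 := hx.2 (p + 1) q (by push_cast; omega)
  rw [D_succ_apply, add_eq_zero_iff_eq_neg] at h0
  rw [h0]
  exact neg_mem (totV_mem_barCoboundaries A N x (p + 1) g)

lemma D_mem_fil_of_single {p : ℕ} {n : ℤ} (hn : (p : ℤ) + q = n) {x : Tot A N}
    (hx : ∀ g, x p q g ∈ barCocycles A N q)
    (hx' : ∀ p' q', (p' ≠ p ∨ q' ≠ q) → x p' q' = 0) :
    (filtered A N).D x ∈ (filtered A N).fil (p + 1 : ℕ) := by
  have hfil := mem_fil_of_single A N hx'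
  have := mem_fil_succ A N (q := q + 1) (n := n + 1) (by push_cast; omega)
    ((filtered A N).D_deg _ _ (mem_deg_of_single A N hn hx')) ((filtered A N).D_fil _ _ hfil)
    (by rw [D_apply_of_mem_fil A N hfil, (dv_eq_zero_iff A N).2 hx, smul_zero])
  exact_mod_cast this

-- A lift of f concentrated in one bidegree has a horizontal differential that θ kills, that is, a
-- vertical coboundary. Subtracting an element of column p + 1 removes it and leaves the leading
-- term untouched.
include hsurj hker hequiv in
lemma exists_mem_Z {p : ℕ} {n : ℤ} (hn : (p : ℤ) + q = n) {f : (Fin p → Γ ⧸ N) → V}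
    (hf : repD V p f = 0) : ∃ x ∈ (filtered A N).Z 2 p n,
      ∀ g, ∃ h : x p q g ∈ barCocycles A N q, θ ⟨x p q g, h⟩ = f g := by
  obtain ⟨x, hx, hxf, hx'⟩ := exists_lift A N V θ hsurj p f
  have hdeg := mem_deg_of_single A N hn hx'
  have hfil := mem_fil_of_single A N hx'
  have h1 := D_mem_fil_of_single A N hn hx hx'
  have h2 : ∀ g, (filtered A N).D x (p + 1) q g ∈ barCoboundaries A N q := by
    intro g
    refine add_mem ((hker ⟨_, dh_mem_barCocycles A N hx g⟩).1 ?_)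
      (totV_mem_barCoboundaries A N x (p + 1) g)
    rw [repD_of_dh A N V θ hequiv hx hxf g]
    exact congrFun hf g
  obtain ⟨y, hy, hy', hy''⟩ := exists_sub_D_mem A N (p := p + 1) (n := n + 1)
    (by push_cast; omega) ((filtered A N).D_deg _ _ hdeg) h1 h2
  rw [add_sub_cancel_right] at hy
  have hyp : y p q = 0 := hy' p q (by push_cast; omega)
  have hxy : (x - y) p q = x p q := by rw [Tot.sub_apply, hyp, sub_zero]
  refine ⟨x - y, ⟨⟨sub_mem hdeg hy, sub_mem hfil
    ((filtered A N).fil_anti (by push_cast; omega) hy')⟩, ?_⟩, fun g => ?_⟩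
  · rw [SetLike.mem_coe, Submodule.mem_comap, map_sub]
    have : ((p + 1 : ℕ) : ℤ) + 1 = p + 2 := by push_cast; ring
    rwa [this] at hy''
  · rw [hxy]
    exact ⟨hx g, hxf g⟩

-- Modulo terms in later columns, x is D w. Its component in column p is the horizontal differential
-- of w up to a vertical coboundary, so f is the coboundary of the class of w; for p = 0 only the
-- vertical part is present.
include hker hequiv in
lemma mem_cobound_of_mem_B {p : ℕ} {n : ℤ} {x : Tot A N}
    (hx1 : ∀ g, x p q g ∈ barCocycles A N q) {f : (Fin p → Γ ⧸ N) → V}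
    (hf : ∀ g, θ ⟨x p q g, hx1 g⟩ = f g) (hB : x ∈ (filtered A N).B 2 p n) :
    f ∈ cobound (fun n => (⊤ : AddSubgroup ((Fin n → Γ ⧸ N) → V))) (repD V) p := by
  obtain ⟨z, hz, _, ⟨w, hw, rfl⟩, rfl⟩ := Submodule.mem_sup.1 hB
  have hz0 : z p q = 0 := hz.1.2 p q (by omega)
  have hxw : (z + (filtered A N).D w) p q = (filtered A N).D w p q := by
    rw [Tot.add_apply, hz0, zero_add]
  rcases p with _ | p
  · rw [mem_cobound_zero]
    funext g
    rw [← hf g]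
    refine (hker _).2 ?_
    have : (z + (filtered A N).D w) 0 q g = totV A N w 0 q g := by
      rw [hxw, filtered_D_apply, totH_zero, zero_add]
    exact (congrArg (· ∈ barCoboundaries A N q) this).mpr (totV_mem_barCoboundaries A N w 0 g)
  · have hw' : w ∈ (filtered A N).Z 1 (p : ℕ) (n - 1) := by
      have : ((p + 1 : ℕ) : ℤ) - 2 + 1 = p := by push_cast; ring
      rw [this] at hw
      exact hw
    have hwK := fun g => mem_barCocycles_of_mem_Z A N (q := q) hw' g
    refine (mem_cobound_succ _ _).2 ⟨fun g => θ ⟨_, hwK g⟩, trivial, funext fun g => ?_⟩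
    rw [← hf g, ← repD_of_dh A N V θ hequiv hwK (fun g => rfl) g, ← sub_eq_zero, ← map_sub]
    refine (hker _).2 ?_
    have : dh A N p q (w p q) g - (z + (filtered A N).D w) (p + 1) q g =
        -totV A N w (p + 1) q g := by
      rw [hxw, D_succ_apply, Pi.add_apply, sub_add_cancel_left]
    exact (congrArg (· ∈ barCoboundaries A N q) this).mpr
      (neg_mem (totV_mem_barCoboundaries A N w (p + 1) g))

lemma mem_B_of_sub_D_mem {p : ℕ} {n : ℤ} {x w : Tot A N} (hx : x ∈ (filtered A N).Z 2 p n)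
    (hw : w ∈ (filtered A N).Z 1 (p - 1) (n - 1))
    (hw' : x - (filtered A N).D w ∈ (filtered A N).fil (p + 1)) : x ∈ (filtered A N).B 2 p n := by
  have h := (filtered A N).D_deg _ _ hw.1.1
  rw [sub_add_cancel] at h
  refine Submodule.mem_sup.2 ⟨x - (filtered A N).D w, ⟨⟨sub_mem hx.1.1 h, hw'⟩, ?_⟩,
    (filtered A N).D w, ⟨w, ?_, rfl⟩, sub_add_cancel _ _⟩
  · rw [SetLike.mem_coe, Submodule.mem_comap, map_sub, (filtered A N).D_D, sub_zero]
    have := hx.2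
    rwa [show (p : ℤ) + 1 + (2 - 1) = p + 2 by ring]
  · rw [show (p : ℤ) - 2 + 1 = p - 1 by ring]
    exact hw

-- If f bounds f', then subtracting D of a lift of f' leaves a leading term that is a vertical
-- coboundary. A second correction within the same column moves the rest into the next column. For p
-- = 0 the second correction suffices.
include hsurj hker hequiv in
lemma mem_B_of_mem_cobound {p : ℕ} {n : ℤ} (hn : (p : ℤ) + q = n) {x : Tot A N}
    (hx : x ∈ (filtered A N).Z 2 p n)
    (hx1 : ∀ g, x p q g ∈ barCocycles A N q) {f : (Fin p → Γ ⧸ N) → V}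
    (hf : ∀ g, θ ⟨x p q g, hx1 g⟩ = f g)
    (hc : f ∈ cobound (fun n => (⊤ : AddSubgroup ((Fin n → Γ ⧸ N) → V))) (repD V) p) :
    x ∈ (filtered A N).B 2 p n := by
  rcases p with _ | p
  · rw [mem_cobound_zero] at hc
    obtain ⟨y, hy, hy', hy''⟩ := exists_sub_D_mem A N hn hx.1.1 hx.1.2 fun g =>
      (hker ⟨_, hx1 g⟩).1 ((hf g).trans (congrFun hc g))
    exact mem_B_of_sub_D_mem A N hx ⟨⟨hy, (filtered A N).fil_anti (by omega) hy'⟩,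
      (filtered A N).fil_anti (by omega) ((filtered A N).D_fil _ _ hy')⟩ hy''
  · obtain ⟨f', -, hf'⟩ := (mem_cobound_succ _ _).1 hc
    obtain ⟨w, hw, hwf, hw'⟩ := exists_lift A N V θ hsurj p f'
    have hn' : (p : ℤ) + q = n - 1 := by push_cast at hn; omega
    have hdeg := mem_deg_of_single A N hn' hw'
    have hfil := mem_fil_of_single A N hw'
    have h1 := D_mem_fil_of_single A N hn' hw hw'
    have h2 := (filtered A N).D_deg _ _ hdeg
    rw [sub_add_cancel] at h2
    obtain ⟨y, hy, hy', hy''⟩ := exists_sub_D_mem A N hn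
      (x := x - (filtered A N).D w) (sub_mem hx.1.1 h2) (sub_mem hx.1.2 h1) fun g => by
        have : (x - (filtered A N).D w) (p + 1) q g =
            (x (p + 1) q g - dh A N p q (w p q) g) - totV A N w (p + 1) q g := by
          rw [Tot.sub_apply, Pi.sub_apply, D_succ_apply, Pi.add_apply, sub_add_eq_sub_sub]
        rw [this]
        refine sub_mem ((hker (⟨_, hx1 g⟩ - ⟨_, dh_mem_barCocycles A N hw g⟩)).1 ?_)
          (totV_mem_barCoboundaries A N w (p + 1) g)
        rw [map_sub, hf, repD_of_dh A N V θ hequiv hw hwf, hf', sub_self]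
    have e : ((p + 1 : ℕ) : ℤ) - 1 = p := by push_cast; ring
    have e' : ((p + 1 : ℕ) : ℤ) = (p : ℤ) + 1 := by push_cast; ring
    refine mem_B_of_sub_D_mem A N (w := w + y) hx ?_ ?_
    · rw [e]
      refine ⟨⟨add_mem hdeg hy, add_mem hfil ((filtered A N).fil_anti (by omega) hy')⟩, ?_⟩
      rw [SetLike.mem_coe, Submodule.mem_comap, map_add, ← e']
      exact add_mem h1 ((filtered A N).D_fil _ _ hy')
    · rw [map_add, ← sub_sub]
      exact hy''

include hsurj hker hequiv

/-- The term `E_2^{p,q}` is the cohomology of `Γ ⧸ N` with values in the cohomology of `N`. -/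
lemma subquotientIso_secondPage (p : ℕ) {n : ℤ} (hn : (p : ℤ) + q = n) :
    SubquotientIso ((filtered A N).Z 2 p n).toAddSubgroup ((filtered A N).B 2 p n).toAddSubgroup
      (AddMonoidHom.id _) (cocyc (fun n => (⊤ : AddSubgroup ((Fin n → Γ ⧸ N) → V))) (repD V) p)
      (cobound (fun n => (⊤ : AddSubgroup ((Fin n → Γ ⧸ N) → V))) (repD V) p)
      (AddMonoidHom.id _) := by
  have hZ {x : Tot A N} (hx : x ∈ (filtered A N).Z 2 p n) (g) : x p q g ∈ barCocycles A N q :=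
    mem_barCocycles_of_mem_Z A N (Z_le A N (by omega) hx) g
  -- An element of Z₂ is related to the cochain of vertical cohomology classes of its leading term.
  refine ⟨⟨⟨⟨{x | x.1 ∈ (filtered A N).Z 2 p n ∧
    ∀ g, ∃ h : x.1 p q g ∈ barCocycles A N q, θ ⟨x.1 p q g, h⟩ = x.2 g}, ?_⟩, ?_⟩, ?_⟩,
    ?_, ?_, ?_, ?_, ?_⟩
  · rintro ⟨x, f⟩ ⟨x', f'⟩ ⟨hx, h⟩ ⟨hx', h'⟩
    refine ⟨add_mem hx hx', fun g => ?_⟩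
    obtain ⟨h1, h2⟩ := h g
    obtain ⟨h3, h4⟩ := h' g
    exact ⟨add_mem h1 h3, (map_add θ ⟨_, h1⟩ ⟨_, h3⟩).trans (congrArg₂ (· + ·) h2 h4)⟩
  · exact ⟨zero_mem _, fun g => ⟨zero_mem _, map_zero θ⟩⟩
  · rintro ⟨x, f⟩ ⟨hx, h⟩
    refine ⟨neg_mem hx, fun g => ?_⟩
    obtain ⟨h1, h2⟩ := h g
    exact ⟨neg_mem h1, (map_neg θ ⟨_, h1⟩).trans (congrArg _ h2)⟩
  · rintro x f ⟨hx, h⟩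
    exact ⟨hx, trivial, repD_eq_zero_of_mem_Z A N V θ hker hequiv hx (hZ hx) fun g => (h g).2⟩
  · intro x hx
    exact ⟨fun g => θ ⟨_, hZ hx g⟩, hx, fun g => ⟨_, rfl⟩⟩
  · rintro f ⟨-, hf⟩
    obtain ⟨x, hx, h⟩ := exists_mem_Z A N V θ hsurj hker hequiv hn hf
    exact ⟨x, hx, h⟩
  · rintro x f ⟨hx, h⟩
    exact ⟨mem_cobound_of_mem_B A N V θ hker hequiv (hZ hx) fun g => (h g).2,
      mem_B_of_mem_cobound A N V θ hsurj hker hequiv hn hx (hZ hx) fun g => (h g).2⟩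
  · exact fun _ _ h => h

/-- The term `E_2^{p,q}` of the Lyndon–Hochschild–Serre spectral sequence. -/
theorem secondPage_equiv (p : ℕ) {n : ℤ} (hn : (p : ℤ) + q = n) :
    Nonempty (E A N 2 p n ≃+ groupCohomology V p) := by
  obtain ⟨φ, hφ, hφ0, -⟩ := ((subquotientIso_secondPage A N V θ hsurj hker hequiv p hn).trans
    (subquotientIso_repD V p)).exists_hom
  refine Crystal.nonempty_equiv_of_surjective
    (K := (filtered A N).Z 2 p n) (H := E A N 2 p n)
    (Submodule.mkQ (((filtered A N).B 2 p n).comap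
      ((filtered A N).Z 2 p n).subtype)).toAddMonoidHom φ
    (Submodule.mkQ_surjective _) hφ fun x => ?_
  exact (Submodule.Quotient.mk_eq_zero _).trans (hφ0 x).symm

end

end LHS

/-! ### The second page for the crystallographic group -/

namespace Crystal

open CellResolution

/-- The translations are the lattice. -/
noncomputable def translationsEquiv : TransLattice ≃* translations :=
  MonoidHom.ofInjective SemidirectProduct.inl_injective

lemma translationsEquiv_coe (l : TransLattice) :
    (translationsEquiv l : CrystGroup) = SemidirectProduct.inl l := rfl

lemma coe_eq_inl (h : translations) :
    (h : CrystGroup) = SemidirectProduct.inl (translationsEquiv.symm h) := by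
  rw [← translationsEquiv_coe, MulEquiv.apply_symm_apply]

/-- The homogeneous cochains of the crystallographic group that are invariant under translations
compute the cohomology of the lattice. -/
lemma subquotientIso_translations (q : ℕ) :
    SubquotientIso (cocyc (tupleInv translations CrystGroup) (tupleD CrystGroup ℤ) q)
      (cobound (tupleInv translations CrystGroup) (tupleD CrystGroup ℤ) q)
      (tupleMap (fun γ => (SemidirectProduct.inr gen)⁻¹ * γ) q)
      (cocyc latticeInv (fun _ => Cubical.d) q) (cobound latticeInv (fun _ => Cubical.d) q) T := by
  -- Tuples have entries in all of Γ, as in the LHS double complex, but only translations act; the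
  -- translation part of an element is the frame. Left multiplication by the inverse of the lifted
  -- generator induces the action of that generator on equivariant functions.
  have h := (cubicalResolution (H := translations) (S := CrystGroup)
    translationsEquiv.symm.toMonoidHom SemidirectProduct.inl
    (fun h l => by
      rw [map_mul, Subgroup.smul_def, coe_eq_inl h]
      rfl)
    (fun γ => translationsEquiv γ.left)
    (fun h γ => by
      rw [Subgroup.smul_def, coe_eq_inl h, smul_eq_mul, SemidirectProduct.mul_left,
        SemidirectProduct.left_inl, SemidirectProduct.right_inl, map_one, MulAut.one_apply, map_mul,
        MulEquiv.apply_symm_apply])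
    (fun γ => (SemidirectProduct.inr gen)⁻¹ * γ)
    (fun h => translationsEquiv (holonomyAction gen⁻¹ (translationsEquiv.symm h)))
    (fun h γ => by
      rw [Subgroup.smul_def, Subgroup.smul_def, translationsEquiv_coe, SemidirectProduct.inl_aut,
        coe_eq_inl h, smul_eq_mul, smul_eq_mul]
      simp only [map_inv, inv_inv, mul_assoc, mul_inv_cancel_left])
    (fun h => by
      change holonomyMatrix.mulVec (translationsEquiv.symm (translationsEquiv _)).toAdd = _
      rw [MulEquiv.symm_apply_apply]
      exact mulVec_holonomyAction_gen_inv _)).cohomology q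
  rwa [show CellResolution.inv _ = latticeInv from funext fun q =>
    cubicalResolution_inv _ translationsEquiv.symm.surjective _ _ _ _ _ _ _ _ q] at h

/-- The quotient by the translations is the holonomy group. -/
noncomputable def holonomyEquiv : CrystGroup ⧸ translations ≃* Holonomy :=
  (QuotientGroup.quotientMulEquivOfEq SemidirectProduct.range_inl_eq_ker_rightHom).trans
    (QuotientGroup.quotientKerEquivOfSurjective _ SemidirectProduct.rightHom_surjective)

section

variable {n : ℕ} (A : Matrix (Fin n) (Fin n) ℤ) (hA : A ^ 4 = 1)

/-- The representation of the quotient by the translations in which the generator acts by a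
matrix. -/
noncomputable def quotientMatrixRep : Rep.{0} ℤ (CrystGroup ⧸ translations) :=
  Rep.of (X := Fin n → ℤ) ((matrixRep A hA).ρ.comp holonomyEquiv.toMonoidHom)

lemma groupCohomology_quotientMatrixRep (p : ℕ) :
    Nonempty (groupCohomology (quotientMatrixRep A hA) p ≃+ groupCohomology (matrixRep A hA) p) :=
  ⟨(groupCohomology.mapIso (B := quotientMatrixRep A hA) (A := matrixRep A hA) holonomyEquiv
    (LinearEquiv.refl ℤ _) (fun _ => rfl) p).toLinearEquiv.toAddEquiv⟩

open LHS

lemma barHomInv_mem {q : ℕ} (z : barHomInv (Rep.trivial ℤ CrystGroup ℤ) translations q) :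
    (show (Fin (q + 1) → CrystGroup) → ℤ from z.1) ∈ tupleInv translations CrystGroup q := by
  intro h x
  have := congrFun (z.2 h⁻¹) x
  refine Eq.trans ?_ this
  change _ = (show (Fin (q + 1) → CrystGroup) → ℤ from z.1) fun i => ((h⁻¹ : translations) : CrystGroup)⁻¹ * x i
  simp [Subgroup.smul_def]

lemma exists_barHomInv {q : ℕ} {φ : (Fin (q + 1) → CrystGroup) → ℤ}
    (hφ : φ ∈ tupleInv translations CrystGroup q) :
    ∃ z : barHomInv (Rep.trivial ℤ CrystGroup ℤ) translations q, z.1 = φ :=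
  ⟨⟨φ, fun h => funext fun x => hφ h⁻¹ x⟩, rfl⟩

lemma barInvD_coe {q : ℕ} (z : barHomInv (Rep.trivial ℤ CrystGroup ℤ) translations q) :
    ((barInvD (Rep.trivial ℤ CrystGroup ℤ) translations q).hom z).1 = tupleD CrystGroup ℤ q z.1 :=
  rfl

lemma barInvD_eq_zero {q : ℕ} {z : barHomInv (Rep.trivial ℤ CrystGroup ℤ) translations q} :
    (barInvD (Rep.trivial ℤ CrystGroup ℤ) translations q).hom z = 0 ↔
      tupleD CrystGroup ℤ q z.1 = 0 := by
  rw [← barInvD_coe]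
  exact Subtype.ext_iff

lemma mem_barCocycles_iff {q : ℕ} {z : barHomInv (Rep.trivial ℤ CrystGroup ℤ) translations q} :
    z ∈ barCocycles (Rep.trivial ℤ CrystGroup ℤ) translations q ↔
      (show (Fin (q + 1) → CrystGroup) → ℤ from z.1) ∈
        cocyc (tupleInv translations CrystGroup) (tupleD CrystGroup ℤ) q :=
  barInvD_eq_zero.trans (and_iff_right (barHomInv_mem z)).symm

lemma mem_barCoboundaries_iff {q : ℕ}
    {z : barHomInv (Rep.trivial ℤ CrystGroup ℤ) translations q} :
    z ∈ barCoboundaries (Rep.trivial ℤ CrystGroup ℤ) translations q ↔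
      (show (Fin (q + 1) → CrystGroup) → ℤ from z.1) ∈
        cobound (tupleInv translations CrystGroup) (tupleD CrystGroup ℤ) q := by
  rcases q with _ | q
  · exact Subtype.ext_iff
  · constructor
    · rintro ⟨y, rfl⟩
      exact ⟨y.1, barHomInv_mem y, rfl⟩
    · rintro ⟨φ, hφ, h⟩
      obtain ⟨y, rfl⟩ := exists_barHomInv hφ
      exact ⟨y, Subtype.ext h⟩

/-- Equivariance under the quotient need be checked only on the lifted generator of the holonomy
group. -/
lemma forall_quotient {P : CrystGroup ⧸ translations → Prop} (h1 : P 1)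
    (hgen : P (SemidirectProduct.inr gen : CrystGroup)) (hmul : ∀ a b, P a → P b → P (a * b))
    (γ : CrystGroup ⧸ translations) : P γ := by
  have key : ∀ g : Holonomy, P (SemidirectProduct.inr g : CrystGroup) := by
    refine forall_holonomy ?_ hgen ?_ ?_
    · rwa [map_one]
    · rw [map_mul]
      exact hmul _ _ hgen hgen
    · rw [map_mul, map_mul]
      exact hmul _ _ (hmul _ _ hgen hgen) hgen
  have : γ = (SemidirectProduct.inr (holonomyEquiv γ) : CrystGroup) :=
    holonomyEquiv.injective rfl
  rw [this]
  exact key _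

/-- The term `E_2^{p,q}` for the crystallographic group and its translations. -/
theorem secondPage_equiv_matrixRep {q : ℕ}
    (h : SubquotientIso (cocyc latticeInv (fun _ => Cubical.d) q)
      (cobound latticeInv (fun _ => Cubical.d) q) T (⊤ : AddSubgroup (Fin n → ℤ)) ⊥
      A.mulVecLin.toAddMonoidHom) (p : ℕ) {m : ℤ} (hm : (p : ℤ) + q = m) :
    Nonempty (E (Rep.trivial ℤ CrystGroup ℤ) translations 2 p m ≃+
      groupCohomology (matrixRep A hA) p) := by
  obtain ⟨θ, h1, h2, h3⟩ := ((subquotientIso_translations q).trans h).exists_hom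
  let ι (z : barCocycles (Rep.trivial ℤ CrystGroup ℤ) translations q) :
      cocyc (tupleInv translations CrystGroup) (tupleD CrystGroup ℤ) q :=
    ⟨z.1.1, mem_barCocycles_iff.1 z.2⟩
  let θ' : barCocycles (Rep.trivial ℤ CrystGroup ℤ) translations q →+ quotientMatrixRep A hA :=
    AddMonoidHom.mk' (fun z => θ (ι z)) fun z w => map_add θ (ι z) (ι w)
  let θ'' : barCocycles (Rep.trivial ℤ CrystGroup ℤ) translations q →ₗ[ℤ] quotientMatrixRep A hA :=
    { θ' with map_smul' := fun c z => map_intCast_smul θ' ℤ ℤ c z }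
  suffices h : Nonempty (E (Rep.trivial ℤ CrystGroup ℤ) translations 2 p m ≃+
      groupCohomology (quotientMatrixRep A hA) p) by
    obtain ⟨e⟩ := h
    obtain ⟨e'⟩ := groupCohomology_quotientMatrixRep A hA p
    exact ⟨e.trans e'⟩
  refine secondPage_equiv (Rep.trivial ℤ CrystGroup ℤ) translations (quotientMatrixRep A hA)
    θ'' ?_ ?_ ?_ p hm
  · intro v
    obtain ⟨⟨φ, hφ⟩, hv⟩ := h1 v
    obtain ⟨z, rfl⟩ := exists_barHomInv hφ.1
    exact ⟨⟨z, mem_barCocycles_iff.2 hφ⟩, hv⟩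
  · intro z
    exact (h2 (ι z)).trans mem_barCoboundaries_iff.symm
  · refine forall_quotient ?_ ?_ ?_
    · intro z w hw
      rw [map_one] at hw ⊢
      exact congrArg _ (Subtype.ext hw)
    · intro z w hw
      exact (h3 (ι z) (ι w) (congrArg Subtype.val hw)).trans (matrixRep_gen A hA _).symm
    · intro a b ha hb z w hw
      rw [map_mul] at hw ⊢
      have hbz : (barHomInv (Rep.trivial ℤ CrystGroup ℤ) translations q).ρ b z ∈
          barCocycles (Rep.trivial ℤ CrystGroup ℤ) translations q := by
        rw [mem_barCocycles, Rep.hom_comm_apply, (mem_barCocycles _ _).1 z.2, map_zero]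
      exact (ha ⟨_, hbz⟩ w hw).trans (congrArg _ (hb z ⟨_, hbz⟩ rfl))

end

end Crystal

/-! ### Exactness of the rows -/

section Contraction

variable {k Q : Type} [CommRing k] [Group Q] (V : Rep.{0} k Q)

lemma contractNth_zero_cons {p : ℕ} (a : Q) (g : Fin (p + 1) → Q) :
    Fin.contractNth 0 (· * ·) (Fin.cons a g : Fin (p + 2) → Q) =
      Fin.cons (a * g 0) (Fin.tail g) := by
  funext i
  refine Fin.cases ?_ (fun i => ?_) i
  · simp [Fin.contractNth]
  · simp [Fin.contractNth, Fin.tail]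

lemma contractNth_succ_cons {p : ℕ} (j : Fin (p + 1)) (a : Q) (g : Fin (p + 1) → Q) :
    Fin.contractNth j.succ (· * ·) (Fin.cons a g : Fin (p + 2) → Q) =
      Fin.cons a (Fin.contractNth j (· * ·) g) := by
  funext i
  refine Fin.cases ?_ (fun i => ?_) i
  · simp [Fin.contractNth]
  · simp [Fin.contractNth]

/-- The cochains with values in a representation are acyclic if functions with values in it can be
glued equivariantly. -/
lemma exists_repD_eq (glue : (Q → V) →ₗ[k] V) (glue_const : ∀ v, glue (fun _ => v) = v)
    (glue_ρ : ∀ g f, V.ρ g (glue f) = glue fun c => V.ρ g (f (g⁻¹ * c))) {p : ℕ}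
    (φ : (Fin (p + 1) → Q) → V) (hφ : repD V (p + 1) φ = 0) : ∃ ψ, repD V p ψ = φ := by
  -- For each c, prepending c⁻¹ and acting by c contracts the complex but is not compatible with the
  -- action. Letting c vary and gluing the results restores compatibility.
  refine ⟨fun g => glue fun c => V.ρ c (φ (Fin.cons c⁻¹ g)), funext fun g => ?_⟩
  rw [repD_apply, glue_ρ]
  simp only [← map_smul, ← map_sum, ← map_add]
  refine (congrArg glue (funext fun c => ?_)).trans (glue_const (φ g))
  have h := congrFun hφ (Fin.cons c⁻¹ g)
  rw [repD_apply, Fin.sum_univ_succ, contractNth_zero_cons] at h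
  simp only [contractNth_succ_cons, Fin.cons_zero, Fin.cons_succ, Fin.val_zero, Fin.val_succ,
    zero_add, pow_one, neg_smul, one_smul, Pi.zero_apply] at h
  -- The cocycle identity on the tuple with c⁻¹ in front, solved for its leading term.
  have h2 : V.ρ c⁻¹ (φ g) = φ (Fin.cons (c⁻¹ * g 0) (Fin.tail g)) +
      ∑ j : Fin (p + 1), (-1 : k) ^ ((j : ℕ) + 1) • φ (Fin.cons c⁻¹ (Fin.contractNth j (· * ·) g)) := by
    simp only [pow_succ _ (_ + 1), mul_neg_one, neg_smul, Finset.sum_neg_distrib] at h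
    rw [← sub_eq_zero, ← h]
    abel
  have h3 : φ g = V.ρ c (V.ρ c⁻¹ (φ g)) := by
    rw [← Module.End.mul_apply, ← map_mul, mul_inv_cancel, map_one, Module.End.one_apply]
  rw [h3, h2, map_add, map_sum]
  simp only [Pi.add_apply, Finset.sum_apply, Pi.smul_apply, map_smul, mul_inv_rev, inv_inv]
  rw [← Module.End.mul_apply, ← map_mul, mul_inv_cancel_left]
  rfl

end Contraction

namespace LHS

variable {k Γ : Type} [CommRing k] [Group Γ] (A : Rep.{0} k Γ) (N : Subgroup Γ) [N.Normal]

/-- The `N`-equivariant cochain that is given by `v c` on the tuples with first entry in the coset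
`c`. -/
noncomputable def barGlue (q : ℕ) : (Γ ⧸ N → barHomInv A N q) →ₗ[k] barHomInv A N q where
  toFun v := ⟨fun x => (v (x 0)).1 x, fun n => funext fun x => by
    have h := congrFun ((v (x 0)).2 n) x
    have hx : (((n : Γ)⁻¹ * x 0 : Γ) : Γ ⧸ N) = x 0 := by
      rw [QuotientGroup.mk_mul, QuotientGroup.mk_inv, (QuotientGroup.eq_one_iff _).2 n.2, inv_one,
        one_mul]
    refine Eq.trans ?_ h
    change A.ρ n ((v (((n : Γ)⁻¹ * x 0 : Γ) : Γ ⧸ N)).1 _) = A.ρ n ((v (x 0)).1 _)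
    rw [hx]⟩
  map_add' _ _ := rfl
  map_smul' _ _ := rfl

lemma barGlue_const (q : ℕ) (v : barHomInv A N q) : barGlue A N q (fun _ => v) = v := rfl

lemma barGlue_ρ (q : ℕ) (g : Γ ⧸ N) (f : Γ ⧸ N → barHomInv A N q) :
    (barHomInv A N q).ρ g (barGlue A N q f) =
      barGlue A N q fun c => (barHomInv A N q).ρ g (f (g⁻¹ * c)) := by
  induction g using QuotientGroup.induction_on with
  | H γ => rfl

/-- The rows of the double complex are exact. -/
lemma exists_dh_eq {p q : ℕ} {x : K A N (p + 1) q} (hx : dh A N (p + 1) q x = 0) :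
    ∃ y, dh A N p q y = x :=
  exists_repD_eq (barHomInv A N q) (barGlue A N q) (barGlue_const A N q) (barGlue_ρ A N q) x hx

/-- An element of total degree `n` whose coboundary is supported on the first column is cohomologous
to an element supported on the first column. -/
lemma exists_sub_D_apply_eq_zero {n : ℤ} {x : Tot A N} (hx : x ∈ (filtered A N).deg n)
    (hD : ∀ p q, (filtered A N).D x (p + 1) q = 0) :
    ∃ y ∈ (filtered A N).deg (n - 1), ∀ p q, 0 < p → (x - (filtered A N).D y) p q = 0 := by
  -- The components are cleared from the right: after m steps nothing is left in columns beyond both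
  -- 0 and n - m. The start is automatic, since total degree n has no columns beyond n.
  suffices h : ∀ m : ℕ, ∃ y ∈ (filtered A N).deg (n - 1), ∀ p q : ℕ, n.toNat < p + m → 0 < p →
      (x - (filtered A N).D y) p q = 0 by
    obtain ⟨y, hy, h⟩ := h (n.toNat + 1)
    exact ⟨y, hy, fun p q hp => h p q (by omega) hp⟩
  intro m
  induction m with
  | zero =>
    refine ⟨0, zero_mem _, fun p q hp hp0 => ?_⟩
    rw [map_zero, sub_zero]
    exact hx p q (by omega)
  | succ m ih =>
    obtain ⟨y, hy, h⟩ := ih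
    by_cases hm : n.toNat ≤ m
    · exact ⟨y, hy, fun p q hp hp0 => h p q (by omega) hp0⟩
    obtain ⟨p, hp⟩ : ∃ p, n.toNat = p + 1 + m := ⟨n.toNat - 1 - m, by omega⟩
    have hx' : x - (filtered A N).D y ∈ (filtered A N).deg n := by
      have := (filtered A N).D_deg _ _ hy
      rw [sub_add_cancel] at this
      exact sub_mem hx this
    -- The next column is already clear, so the vanishing of the coboundary there reduces to
    -- horizontal closedness of the last remaining component.
    have hrow : dh A N (p + 1) m ((x - (filtered A N).D y) (p + 1) m) = 0 := by
      have h0 : (filtered A N).D (x - (filtered A N).D y) (p + 1 + 1) m = 0 := by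
        rw [map_sub, (filtered A N).D_D, sub_zero]
        exact hD _ _
      rwa [D_succ_apply, totV_eq_zero A N _ _ _ fun q' _ => h _ q' (by omega) (by omega),
        add_zero] at h0
    obtain ⟨w, hw⟩ := exists_dh_eq A N hrow
    obtain ⟨z, hz, hz'⟩ := exists_single A N p m w
    refine ⟨y + z, add_mem hy (mem_deg_of_single A N (by omega) hz'), fun p' q' hp' hp0' => ?_⟩
    rw [map_add, ← sub_sub, Tot.sub_apply]
    obtain ⟨p', rfl⟩ : ∃ p'', p' = p'' + 1 := ⟨p' - 1, by omega⟩
    rw [D_succ_apply, totV_eq_zero A N _ _ _ fun q'' _ => hz' _ q'' (Or.inl (by omega)), add_zero]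
    rcases eq_or_ne p' p with rfl | hne
    · rcases eq_or_ne q' m with rfl | hne'
      · rw [hz, hw, sub_self]
      · rw [hz' p' q' (Or.inr hne'), map_zero, sub_zero]
        exact hx' _ _ (by push_cast; omega)
    · rw [hz' p' q' (Or.inl hne), map_zero, sub_zero]
      exact h _ _ (by omega) hp0'

end LHS

/-! ### The abutment of the spectral sequence -/

lemma repD_zero_eq_zero_iff {k Q : Type} [CommRing k] [Group Q] (V : Rep.{0} k Q)
    (f : (Fin 0 → Q) → V) :
    repD V 0 f = 0 ↔ ∀ g, V.ρ g (f finZeroElim) = f finZeroElim := by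
  have key (g : Fin 1 → Q) : repD V 0 f g = V.ρ (g 0) (f finZeroElim) - f finZeroElim := by
    rw [repD_apply, Fin.sum_univ_one, Subsingleton.elim (fun i : Fin 0 => g i.succ) finZeroElim,
      Subsingleton.elim (Fin.contractNth 0 (· * ·) g) finZeroElim]
    simp [sub_eq_add_neg]
  constructor
  · intro h g
    have := congrFun h fun _ => g
    rw [key] at this
    exact sub_eq_zero.1 this
  · intro h
    funext g
    rw [key, h, sub_self]
    rfl

namespace LHS

open CellResolution

lemma D_zero_succ_apply {k Γ : Type} [CommRing k] [Group Γ] (A : Rep.{0} k Γ) (N : Subgroup Γ)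
    [N.Normal] (x : Tot A N) (q : ℕ) : (filtered A N).D x 0 (q + 1) = dv A N 0 q (x 0 q) := by
  rw [filtered_D_apply, totH_zero, zero_add, totV_succ, pow_zero, one_smul]

variable {Γ : Type} [Group Γ] (N : Subgroup Γ) [N.Normal]

/-- An element of the total complex is the image of a homogeneous cochain in the first column. -/
def IsEdge {n : ℕ} (φ : (Fin (n + 1) → Γ) → ℤ) (x : Tot (Rep.trivial ℤ Γ ℤ) N) : Prop :=
  (∀ g, (x 0 n g).1 = φ) ∧ ∀ p q, (p ≠ 0 ∨ q ≠ n) → x p q = 0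

variable {N} {n : ℕ}

lemma IsEdge.add {φ ψ : (Fin (n + 1) → Γ) → ℤ} {x y : Tot (Rep.trivial ℤ Γ ℤ) N}
    (h : IsEdge N φ x) (h' : IsEdge N ψ y) : IsEdge N (φ + ψ) (x + y) :=
  ⟨fun g => congrArg₂ (· + ·) (h.1 g) (h'.1 g), fun p q hpq => by
    rw [Tot.add_apply, h.2 p q hpq, h'.2 p q hpq, add_zero]⟩

lemma IsEdge.neg {φ : (Fin (n + 1) → Γ) → ℤ} {x : Tot (Rep.trivial ℤ Γ ℤ) N}
    (h : IsEdge N φ x) : IsEdge N (-φ) (-x) :=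
  ⟨fun g => congrArg (- ·) (h.1 g), fun p q hpq => by
    rw [Tot.neg_apply, h.2 p q hpq, neg_zero]⟩

lemma IsEdge.cochain_ext {φ ψ : (Fin (n + 1) → Γ) → ℤ} {x : Tot (Rep.trivial ℤ Γ ℤ) N}
    (h : IsEdge N φ x) (h' : IsEdge N ψ x) : φ = ψ :=
  (h.1 finZeroElim).symm.trans (h'.1 finZeroElim)

lemma IsEdge.ext {φ : (Fin (n + 1) → Γ) → ℤ} {x y : Tot (Rep.trivial ℤ Γ ℤ) N}
    (h : IsEdge N φ x) (h' : IsEdge N φ y) : x = y := by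
  funext p q
  by_cases hpq : p = 0 ∧ q = n
  · obtain ⟨rfl, rfl⟩ := hpq
    exact funext fun g => Subtype.ext ((h.1 g).trans (h'.1 g).symm)
  · rw [h.2 p q (by tauto), h'.2 p q (by tauto)]

lemma IsEdge.mem_deg {φ : (Fin (n + 1) → Γ) → ℤ} {x : Tot (Rep.trivial ℤ Γ ℤ) N}
    (h : IsEdge N φ x) : x ∈ (filtered (Rep.trivial ℤ Γ ℤ) N).deg n :=
  mem_deg_of_single _ N (p := 0) (q := n) (by simp) h.2

lemma exists_isEdge {φ : (Fin (n + 1) → Γ) → ℤ} (hφ : φ ∈ tupleInv Γ Γ n) :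
    ∃ x : Tot (Rep.trivial ℤ Γ ℤ) N, IsEdge N φ x := by
  obtain ⟨x, h, h'⟩ := exists_single (Rep.trivial ℤ Γ ℤ) N 0 n
    fun _ => ⟨φ, fun m => funext fun y => hφ (m : Γ)⁻¹ y⟩
  exact ⟨x, fun g => congrArg Subtype.val (congrFun h g), h'⟩

/-- A 0-cochain is closed exactly when its value is fixed by Γ/N, and a fixed N-invariant function
is a Γ-invariant one. -/
lemma IsEdge.dh_eq_zero_iff {φ : (Fin (n + 1) → Γ) → ℤ} {x : Tot (Rep.trivial ℤ Γ ℤ) N}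
    (h : IsEdge N φ x) : dh (Rep.trivial ℤ Γ ℤ) N 0 n (x 0 n) = 0 ↔ φ ∈ tupleInv Γ Γ n := by
  have key' (γ : Γ) (y : Fin (n + 1) → Γ) : ((barHomInv (Rep.trivial ℤ Γ ℤ) N n).ρ
      (γ : Γ ⧸ N) (x 0 n finZeroElim)).1 y = φ fun i => γ⁻¹ * y i :=
    congrFun (h.1 finZeroElim) fun i => γ⁻¹ * y i
  refine (repD_zero_eq_zero_iff _ _).trans ⟨fun h0 γ y => ?_, fun hφ => ?_⟩
  · have h1 := congrFun (congrArg Subtype.val (h0 (γ⁻¹ : Γ))) y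
    rw [key', h.1] at h1
    simpa using h1
  · refine QuotientGroup.mk_surjective.forall.2 fun γ => Subtype.ext (funext fun y => ?_)
    rw [key', h.1]
    exact hφ γ⁻¹ y

lemma IsEdge.D {φ : (Fin (n + 1) → Γ) → ℤ} {x : Tot (Rep.trivial ℤ Γ ℤ) N}
    (h : IsEdge N φ x) (hφ : φ ∈ tupleInv Γ Γ n) :
    IsEdge N (tupleD Γ ℤ n φ) ((filtered (Rep.trivial ℤ Γ ℤ) N).D x) := by
  refine ⟨fun g => ?_, fun p q hpq => ?_⟩
  · rw [D_zero_succ_apply, ← h.1 g]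
    rfl
  · rcases p with _ | p
    · rw [filtered_D_apply, totH_zero, zero_add]
      exact totV_eq_zero _ N _ _ _ fun q' hq' => h.2 _ _ (by omega)
    · rw [D_succ_apply, totV_eq_zero _ N _ _ _ fun q' _ => h.2 _ _ (by omega), add_zero]
      by_cases hp : p = 0 ∧ q = n
      · obtain ⟨rfl, rfl⟩ := hp
        exact h.dh_eq_zero_iff.2 hφ
      · rw [h.2 p q (by omega), map_zero]

/-- An element of total degree `n` whose coboundary is supported on the first column is cohomologous
to an invariant homogeneous cochain in the first column. -/
lemma exists_isEdge_sub {x : Tot (Rep.trivial ℤ Γ ℤ) N} (hx : x ∈ (filtered (Rep.trivial ℤ Γ ℤ) N).deg n)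
    (hD : ∀ p q, (filtered (Rep.trivial ℤ Γ ℤ) N).D x (p + 1) q = 0) :
    ∃ y ∈ (filtered (Rep.trivial ℤ Γ ℤ) N).deg (n - 1), ∃ φ ∈ tupleInv Γ Γ n, IsEdge N φ (x - (filtered (Rep.trivial ℤ Γ ℤ) N).D y) := by
  obtain ⟨y, hy, h⟩ := exists_sub_D_apply_eq_zero _ N hx hD
  have hdeg := (filtered (Rep.trivial ℤ Γ ℤ) N).D_deg _ _ hy
  rw [sub_add_cancel] at hdeg
  have hE : IsEdge N ((x - (filtered (Rep.trivial ℤ Γ ℤ) N).D y) 0 n finZeroElim).1 (x - (filtered (Rep.trivial ℤ Γ ℤ) N).D y) := by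
    refine ⟨fun g => by rw [Subsingleton.elim g finZeroElim], fun p q hpq => ?_⟩
    rcases p with _ | p
    · exact sub_mem hx hdeg 0 q (by simp at hpq ⊢; omega)
    · exact h _ _ (by omega)
  refine ⟨y, hy, _, hE.dh_eq_zero_iff.1 ?_, hE⟩
  have h0 : (filtered (Rep.trivial ℤ Γ ℤ) N).D (x - (filtered (Rep.trivial ℤ Γ ℤ) N).D y) (0 + 1) n = 0 := by
    rw [map_sub, (filtered (Rep.trivial ℤ Γ ℤ) N).D_D, sub_zero]
    exact hD _ _
  rwa [D_succ_apply, totV_eq_zero _ N _ _ _ fun q' _ => h _ _ (by omega), add_zero] at h0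

variable (N)

/-- The total complex computes the cohomology of the group. -/
theorem subquotientIso_tot (m : ℕ) :
    SubquotientIso (cocyc (tupleInv Γ Γ) (tupleD Γ ℤ) (m + 1))
      (cobound (tupleInv Γ Γ) (tupleD Γ ℤ) (m + 1)) (AddMonoidHom.id _)
      ((filtered (Rep.trivial ℤ Γ ℤ) N).deg (m + 1 : ℕ) ⊓ LinearMap.ker (filtered (Rep.trivial ℤ Γ ℤ) N).D).toAddSubgroup
      (((filtered (Rep.trivial ℤ Γ ℤ) N).deg m).map (filtered (Rep.trivial ℤ Γ ℤ) N).D).toAddSubgroup (AddMonoidHom.id _) := by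
  have hm : ((m + 1 : ℕ) : ℤ) - 1 = m := by push_cast; ring
  -- A homogeneous cocycle of Γ is related to every total cocycle cohomologous to its copy in the
  -- first column.
  refine ⟨⟨⟨⟨{a | (a.1 ∈ cocyc (tupleInv Γ Γ) (tupleD Γ ℤ) (m + 1) ∧
    a.2 ∈ (filtered (Rep.trivial ℤ Γ ℤ) N).deg (m + 1 : ℕ) ⊓ LinearMap.ker (filtered (Rep.trivial ℤ Γ ℤ) N).D) ∧
    ∃ y ∈ (filtered (Rep.trivial ℤ Γ ℤ) N).deg m, IsEdge N a.1 (a.2 - (filtered (Rep.trivial ℤ Γ ℤ) N).D y)}, ?_⟩, ?_⟩, ?_⟩,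
    ?_, ?_, ?_, ?_, ?_⟩
  · rintro ⟨φ, x⟩ ⟨ψ, x'⟩ ⟨⟨h1, h2⟩, y, hy, h⟩ ⟨⟨h1', h2'⟩, y', hy', h'⟩
    refine ⟨⟨add_mem h1 h1', add_mem h2 h2'⟩, y + y', add_mem hy hy', ?_⟩
    rw [map_add, Prod.mk_add_mk, add_sub_add_comm]
    exact h.add h'
  · refine ⟨⟨zero_mem _, zero_mem _⟩, 0, zero_mem _, ?_⟩
    rw [map_zero, sub_zero]
    exact ⟨fun _ => rfl, fun _ _ _ => rfl⟩
  · rintro ⟨φ, x⟩ ⟨⟨h1, h2⟩, y, hy, h⟩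
    refine ⟨⟨neg_mem h1, neg_mem h2⟩, -y, neg_mem hy, ?_⟩
    rw [map_neg, Prod.neg_mk, neg_sub_neg, ← neg_sub]
    exact h.neg
  · exact fun φ x h => h.1
  · intro φ hφ
    obtain ⟨x, hx⟩ := exists_isEdge (N := N) hφ.1
    have hDx := hx.D hφ.1
    rw [hφ.2] at hDx
    refine ⟨x, ⟨hφ, hx.mem_deg, hDx.ext ⟨fun _ => rfl, fun _ _ _ => rfl⟩⟩, 0, zero_mem _, ?_⟩
    rw [map_zero, sub_zero]
    exact hx
  · rintro x ⟨hx, hx0⟩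
    obtain ⟨y, hy, φ, hφ, h⟩ := exists_isEdge_sub hx fun p q => congrFun (congrFun hx0 _) _
    rw [hm] at hy
    refine ⟨φ, ⟨⟨hφ, ?_⟩, hx, hx0⟩, y, hy, h⟩
    have hDx := h.D hφ
    rw [map_sub, (filtered (Rep.trivial ℤ Γ ℤ) N).D_D, sub_zero, LinearMap.mem_ker.1 hx0] at hDx
    exact hDx.cochain_ext ⟨fun _ => rfl, fun _ _ _ => rfl⟩
  · rintro φ x ⟨⟨h1, h2⟩, y, hy, h⟩
    constructor
    · intro hφ
      obtain ⟨ψ, hψ, rfl⟩ := (mem_cobound_succ _ _).1 hφ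
      obtain ⟨w, hw⟩ := exists_isEdge (N := N) hψ
      refine ⟨w + y, add_mem hw.mem_deg hy, ?_⟩
      rw [map_add, (hw.D hψ).ext h, sub_add_cancel]
    · rintro ⟨w, hw, rfl⟩
      rw [← map_sub] at h
      -- The coboundary of w - y lies in the first column, so w - y may itself be moved there
      -- without changing that coboundary; it becomes an invariant primitive.
      obtain ⟨z, -, ψ, hψ, h'⟩ := exists_isEdge_sub (sub_mem hw hy) fun p q => h.2 _ _ (by omega)
      refine (mem_cobound_succ _ _).2 ⟨ψ, hψ, ?_⟩
      have hD := h'.D hψ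
      rw [map_sub _ (w - y), (filtered (Rep.trivial ℤ Γ ℤ) N).D_D, sub_zero] at hD
      exact hD.cochain_ext h
  · exact fun _ _ h => h

/-- The group cohomology as a quotient of the cocycles of the total complex. -/
theorem exists_hom_groupCohomology (m : ℕ) :
    ∃ θ : ((filtered (Rep.trivial ℤ Γ ℤ) N).deg (m + 1 : ℕ) ⊓ LinearMap.ker (filtered (Rep.trivial ℤ Γ ℤ) N).D : Submodule ℤ _) →+
      groupCohomology (Rep.trivial ℤ Γ ℤ) (m + 1), Function.Surjective θ ∧
      ∀ z, θ z = 0 ↔ ∃ w ∈ (filtered (Rep.trivial ℤ Γ ℤ) N).deg m, (filtered (Rep.trivial ℤ Γ ℤ) N).D w = z := by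
  have h1 := subquotientIso_dehomogenize (MonoidHom.id Γ) (m + 1)
  have h2 := subquotientIso_groupCohomology (MonoidHom.id Γ) (m + 1)
  rw [groupCohomology.map_id] at h2
  obtain ⟨θ, hθ, hθ0, -⟩ := (((subquotientIso_tot N m).symm.trans h1).trans h2).exists_hom
  exact ⟨θ, hθ, hθ0⟩

end LHS

/-! ### Degenerate spectral sequences -/

namespace FilteredCochains

variable {R : Type*} [CommRing R] {M : Type*} [AddCommGroup M] [Module R M]
  (C : FilteredCochains R M)

lemma Z_mono {r p r' p' n : ℤ} (hp : p' ≤ p) (hr : p' + r' ≤ p + r) : C.Z r p n ≤ C.Z r' p' n :=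
  fun _ hx => ⟨⟨hx.1.1, C.fil_anti hp hx.1.2⟩, C.fil_anti hr hx.2⟩

lemma mem_Z_of_D_eq_zero {r p n : ℤ} {x : M} (hdeg : x ∈ C.deg n) (hfil : x ∈ C.fil p)
    (h : C.D x = 0) : x ∈ C.Z r p n :=
  ⟨⟨hdeg, hfil⟩, (congrArg (· ∈ C.fil (p + r)) h).mpr (zero_mem _)⟩

/-- Vanishing of d_r on the class of x means that D x agrees with the coboundary of a term of higher
filtration up to one further filtration step. Subtracting that term lifts x to the next page. -/
lemma exists_sub_mem_of_d_eq_zero {r p n : ℤ} (h : C.d r p n = 0) {x : M} (hx : x ∈ C.Z r p n) :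
    ∃ v ∈ C.Z (r - 1) (p + 1) n, C.D x - C.D v ∈ C.fil (p + r + 1) := by
  have h1 : (⟨C.D x, C.D_mem_Z r p n x hx⟩ : C.Z r (p + r) (n + 1)) ∈
      (C.B r (p + r) (n + 1)).comap (C.Z r (p + r) (n + 1)).subtype :=
    (Submodule.Quotient.mk_eq_zero _).1 (LinearMap.congr_fun h (Submodule.Quotient.mk ⟨x, hx⟩))
  obtain ⟨u, hu, _, ⟨v, hv, rfl⟩, huv⟩ := Submodule.mem_sup.1 h1
  replace huv : u + C.D v = C.D x := huv
  rw [show p + r - r + 1 = p + 1 by ring, show n + 1 - 1 = n by ring] at hv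
  refine ⟨v, hv, ?_⟩
  rw [← huv, add_sub_cancel_right]
  exact hu.1.2

/-- The filtration of the cohomology. -/
def filCohomology {n : ℤ} {H : Type*} [AddCommGroup H]
    (θ : (C.deg n ⊓ LinearMap.ker C.D : Submodule R M) →+ H) (p : ℤ) : AddSubgroup H :=
  ((C.fil p).comap (C.deg n ⊓ LinearMap.ker C.D : Submodule R M).subtype).toAddSubgroup.map θ

variable (hd : ∀ r p n, 2 ≤ r → C.d r p n = 0)

include hd

/-- Elements of Z₂ survive from page to page after corrections of higher filtration. When the
filtration of the coboundary exceeds its degree, it is zero and an actual cocycle is reached. -/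
lemma exists_sub_cocycle (hfin : ∀ n, ∀ x ∈ C.deg n, x ∈ C.fil (n + 1) → x = 0) {r p n : ℤ}
    (hr : 2 ≤ r) {x : M} (hx : x ∈ C.Z r p n) :
    ∃ v ∈ C.Z 1 (p + 1) n, C.D (x - v) = 0 := by
  obtain ⟨m, hm⟩ : ∃ m : ℕ, n + 2 ≤ p + r + m := ⟨(n + 2 - p - r).toNat, by omega⟩
  induction m generalizing r x with
  | zero =>
    refine ⟨0, zero_mem _, ?_⟩
    rw [sub_zero]
    exact hfin _ _ (C.D_deg _ _ hx.1.1) (C.fil_anti (by omega) hx.2)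
  | succ m ih =>
    obtain ⟨v, hv, h⟩ := C.exists_sub_mem_of_d_eq_zero (hd r p n hr) hx
    have hxv : x - v ∈ C.Z (r + 1) p n := by
      refine ⟨sub_mem hx.1 ⟨hv.1.1, C.fil_anti (by omega) hv.1.2⟩, ?_⟩
      rw [SetLike.mem_coe, Submodule.mem_comap, map_sub, ← add_assoc]
      exact h
    obtain ⟨w, hw, h'⟩ := ih (by omega) hxv (by push_cast at hm; omega)
    refine ⟨v + w, add_mem (C.Z_mono (by omega) (by omega) hv) hw, ?_⟩
    rwa [← sub_sub]

/-- Coboundaries arriving from far to the left contribute nothing beyond B₂: the vanishing of d_r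
lets w be replaced by an element one column further right, up to terms in F^{p+1}, until it lies in
column p - 1. -/
lemma D_mem_B_of_mem_Z {r : ℕ} {s p n : ℤ} (hs : s + (r + 1) = p) {w : M}
    (hw : w ∈ C.Z (r + 1) s (n - 1)) : C.D w ∈ C.B 2 p n := by
  induction r generalizing s w with
  | zero =>
    obtain rfl : s = p - 2 + 1 := by push_cast at hs; omega
    exact Submodule.mem_sup_right ⟨w, C.Z_mono le_rfl (by push_cast; omega) hw, rfl⟩
  | succ r ih =>
    obtain ⟨v, hv, h⟩ := C.exists_sub_mem_of_d_eq_zero (hd _ _ _ (by push_cast; omega)) hw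
    have hdeg : C.D w - C.D v ∈ C.deg n := by
      have := sub_mem (C.D_deg _ _ hw.1.1) (C.D_deg _ _ hv.1.1)
      rwa [sub_add_cancel] at this
    rw [hs] at h
    rw [← sub_add_cancel (C.D w) (C.D v)]
    refine add_mem (Submodule.mem_sup_left (C.mem_Z_of_D_eq_zero hdeg h ?_))
      (ih (s := s + 1) (by push_cast at hs ⊢; omega)
        (C.Z_mono le_rfl (by push_cast; omega) hv))
    rw [map_sub, C.D_D, C.D_D, sub_zero]

/-- The graded pieces of the cohomology are the terms of the second page. -/
lemma card_filCohomology (hfin : ∀ n, ∀ x ∈ C.deg n, x ∈ C.fil (n + 1) → x = 0)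
    (hfil : ∀ n, C.deg n ≤ C.fil 0) {n : ℤ} {H : Type*} [AddCommGroup H]
    (θ : (C.deg n ⊓ LinearMap.ker C.D : Submodule R M) →+ H)
    (hθ0 : ∀ z, θ z = 0 ↔ ∃ w ∈ C.deg (n - 1), C.D w = z) (p : ℕ) :
    Nat.card (C.filCohomology θ p) =
      Nat.card (C.E 2 p n) * Nat.card (C.filCohomology θ (p + 1)) := by
  have hle : C.filCohomology θ (p + 1) ≤ C.filCohomology θ p :=
    AddSubgroup.map_mono (fun z hz => C.fil_anti (by omega) hz)
  let G := C.filCohomology θ p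
  let L : AddSubgroup G := (C.filCohomology θ (p + 1)).addSubgroupOf G
  -- Every primitive lies in F⁰, hence in F⁻¹. Starting from -1 makes the required length p + 1
  -- positive also for p = 0.
  have hB {w : M} (hw : w ∈ C.deg (n - 1)) (hDw : C.D w ∈ C.fil p) : C.D w ∈ C.B 2 p n :=
    C.D_mem_B_of_mem_Z hd (r := p) (s := -1) (by omega)
      ⟨⟨hw, C.fil_anti (by omega) (hfil _ hw)⟩, C.fil_anti (by omega) hDw⟩
  let K : Submodule R M := C.deg n ⊓ LinearMap.ker C.D ⊓ C.fil p
  let π : K →+ G := AddMonoidHom.mk' (fun z => ⟨θ ⟨z, z.2.1⟩, ⟨z, z.2.1⟩, z.2.2, rfl⟩)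
    fun z w => Subtype.ext (map_add θ ⟨z, z.2.1⟩ ⟨w, w.2.1⟩)
  let ι : K →+ C.Z 2 p n := AddMonoidHom.mk'
    (fun z => ⟨z, C.mem_Z_of_D_eq_zero z.2.1.1 z.2.2 z.2.1.2⟩) fun _ _ => rfl
  have hπ : Function.Surjective π := by
    rintro ⟨_, z, hz, rfl⟩
    exact ⟨⟨z, z.2, hz⟩, rfl⟩
  suffices h : Nonempty (G ⧸ L ≃+ C.E 2 p n) by
    obtain ⟨e⟩ := h
    rw [← Nat.card_congr e.toEquiv,
      ← Nat.card_congr (AddSubgroup.addSubgroupOfEquivOfLe hle).toEquiv]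
    exact AddSubgroup.card_eq_card_quotient_mul_card_addSubgroup L
  -- Both the graded piece of cohomology and the E₂ term are quotients of the cocycles in F^p, and
  -- the two kernels are compared.
  refine Crystal.nonempty_equiv_of_surjective ((QuotientAddGroup.mk' L).comp π)
    ((Submodule.mkQ ((C.B 2 p n).comap (C.Z 2 p n).subtype)).toAddMonoidHom.comp ι)
    ((QuotientAddGroup.mk'_surjective L).comp hπ) ?_ ?_
  · intro y
    obtain ⟨⟨x, hx⟩, rfl⟩ := Submodule.mkQ_surjective _ y
    obtain ⟨v, hv, h⟩ := C.exists_sub_cocycle hd hfin le_rfl hx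
    refine ⟨⟨x - v, ⟨sub_mem hx.1.1 hv.1.1, h⟩,
      sub_mem hx.1.2 (C.fil_anti (by omega) hv.1.2)⟩, ?_⟩
    refine (Submodule.Quotient.eq _).2 (Submodule.mem_sup_left ?_)
    change x - v - x ∈ _
    rw [sub_sub_cancel_left]
    exact neg_mem hv
  · intro x
    refine (QuotientAddGroup.eq_zero_iff _).trans (Iff.trans ?_
      (Submodule.Quotient.mk_eq_zero _).symm)
    constructor
    · rintro ⟨z, hz, hzx⟩
      obtain ⟨w, hw, h⟩ := (hθ0 (⟨x, x.2.1⟩ - z)).1 (by rw [map_sub, hzx]; exact sub_self _)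
      have hDw : C.D w = (x : M) - z := h
      have hx : (x : M) = z + C.D w := by rw [hDw, add_sub_cancel]
      change (x : M) ∈ C.B 2 p n
      rw [hx]
      refine add_mem (Submodule.mem_sup_left (C.mem_Z_of_D_eq_zero z.2.1 hz z.2.2)) (hB hw ?_)
      rw [hDw]
      exact sub_mem x.2.2 (C.fil_anti (by omega) hz)
    · intro h
      obtain ⟨u, hu, _, ⟨w, hw, rfl⟩, hx⟩ := Submodule.mem_sup.1 h
      have hx : u + C.D w = x := hx
      refine ⟨⟨u, hu.1.1, ?_⟩, hu.1.2, ?_⟩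
      · have hDx : C.D (x : M) = 0 := x.2.1.2
        rwa [← hx, map_add, C.D_D, add_zero] at hDx
      · refine (sub_eq_zero.1 ?_).symm
        refine (map_sub θ ⟨x, x.2.1⟩ _).symm.trans ((hθ0 _).2 ⟨w, hw.1.1, ?_⟩)
        change C.D w = (x : M) - u
        rw [← hx, add_sub_cancel_left]

/-- If all differentials from the second page on vanish, the order of the cohomology is the product
of the orders of the terms of the second page. -/
theorem card_eq_prod (hfin : ∀ n, ∀ x ∈ C.deg n, x ∈ C.fil (n + 1) → x = 0)
    (hfil : ∀ n, C.deg n ≤ C.fil 0) {n : ℕ} {H : Type*} [AddCommGroup H]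
    (θ : (C.deg n ⊓ LinearMap.ker C.D : Submodule R M) →+ H) (hθ : Function.Surjective θ)
    (hθ0 : ∀ z, θ z = 0 ↔ ∃ w ∈ C.deg (n - 1), C.D w = z) :
    Nat.card H = ∏ p ∈ Finset.range (n + 1), Nat.card (C.E 2 p n) := by
  have key (m : ℕ) : Nat.card H =
      (∏ p ∈ Finset.range m, Nat.card (C.E 2 p n)) * Nat.card (C.filCohomology θ m) := by
    induction m with
    | zero =>
      have : C.filCohomology θ (0 : ℕ) = ⊤ := (AddSubgroup.eq_top_iff' _).2 fun b => by
        obtain ⟨z, rfl⟩ := hθ b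
        exact ⟨z, hfil _ z.2.1, rfl⟩
      rw [this, Finset.prod_range_zero, one_mul]
      exact (Nat.card_congr AddSubgroup.topEquiv.toEquiv).symm
    | succ m ih =>
      rw [ih, C.card_filCohomology hd hfin hfil θ hθ0 m, Finset.prod_range_succ, mul_assoc]
      rfl
  have : C.filCohomology θ (n + 1 : ℕ) = ⊥ := (AddSubgroup.eq_bot_iff_forall _).2 fun b => by
    rintro ⟨z, hz, rfl⟩
    obtain rfl : z = 0 := Subtype.ext (hfin n z z.2.1 (by exact_mod_cast hz))
    exact map_zero θ
  rw [key (n + 1), this, AddSubgroup.card_bot, mul_one]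

end FilteredCochains

/-! ### The main theorem -/

lemma nonempty_directSum_antidiagonal_equiv (M : Finset.HasAntidiagonal.antidiagonal (4 : ℕ) → Type)
    [∀ i, AddCommGroup (M i)] (h0 : Subsingleton (M ⟨(0, 4), by decide⟩))
    (h1 : Nonempty (M ⟨(1, 3), by decide⟩ ≃+ ZMod 4))
    (h2 : Nonempty (M ⟨(2, 2), by decide⟩ ≃+ ZMod 2))
    (h3 : Nonempty (M ⟨(3, 1), by decide⟩ ≃+ ZMod 2))
    (h4 : Nonempty (M ⟨(4, 0), by decide⟩ ≃+ ZMod 4)) :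
    Nonempty ((⨁ i, M i) ≃+ (Fin 2 → ZMod 4) × (Fin 2 → ZMod 2)) := by
  classical
  obtain ⟨e1⟩ := h1
  obtain ⟨e2⟩ := h2
  obtain ⟨e3⟩ := h3
  obtain ⟨e4⟩ := h4
  refine ⟨(DirectSum.addEquivProd M).trans (AddEquiv.ofBijective (AddMonoidHom.mk' (fun f : ∀ i, M i =>
    (![e1 (f ⟨(1, 3), by decide⟩), e4 (f ⟨(4, 0), by decide⟩)],
      ![e2 (f ⟨(2, 2), by decide⟩), e3 (f ⟨(3, 1), by decide⟩)])) fun f g => by simp) ⟨?_, ?_⟩)⟩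
  · rw [injective_iff_map_eq_zero]
    intro f hf
    simp only [AddMonoidHom.mk'_apply, Prod.mk_eq_zero, Matrix.cons_eq_zero_iff,
      EmbeddingLike.map_eq_zero_iff, Matrix.zero_empty, and_true] at hf
    funext ⟨⟨i, j⟩, hij⟩
    have : i = 0 ∧ j = 4 ∨ i = 1 ∧ j = 3 ∨ i = 2 ∧ j = 2 ∨ i = 3 ∧ j = 1 ∨ i = 4 ∧ j = 0 := by
      have := Finset.HasAntidiagonal.mem_antidiagonal.1 hij
      simp only at this
      omega
    rcases this with ⟨rfl, rfl⟩ | ⟨rfl, rfl⟩ | ⟨rfl, rfl⟩ | ⟨rfl, rfl⟩ | ⟨rfl, rfl⟩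
    · exact Subsingleton.elim _ _
    · exact hf.1.1
    · exact hf.2.1
    · exact hf.2.2
    · exact hf.1.2
  · rintro ⟨a, b⟩
    refine ⟨Pi.single ⟨(1, 3), by decide⟩ (e1.symm (a 0)) +
      Pi.single ⟨(4, 0), by decide⟩ (e4.symm (a 1)) +
      Pi.single ⟨(2, 2), by decide⟩ (e2.symm (b 0)) +
      Pi.single ⟨(3, 1), by decide⟩ (e3.symm (b 1)), ?_⟩
    refine Prod.ext (funext fun i => ?_) (funext fun i => ?_) <;> fin_cases i <;> simp

namespace LHS

variable {k Γ : Type} [CommRing k] [Group Γ] (A : Rep.{0} k Γ) (N : Subgroup Γ) [N.Normal]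

lemma deg_le_fil_zero (n : ℤ) : (filtered A N).deg n ≤ (filtered A N).fil 0 :=
  fun _ _ p q hp => by omega

lemma eq_zero_of_mem_fil {n : ℤ} {x : Tot A N} (hx : x ∈ (filtered A N).deg n)
    (hx' : x ∈ (filtered A N).fil (n + 1)) : x = 0 := by
  funext p q
  by_cases h : (p : ℤ) + q = n
  · exact hx' p q (by omega)
  · exact hx p q h

/-- If all differentials from the second page on vanish, the order of the cohomology of the group is
the product of the orders of the terms of the second page. -/
theorem card_groupCohomology_of_d_eq_zero
    (hd : ∀ r p n : ℤ, 2 ≤ r → d (Rep.trivial ℤ Γ ℤ) N r p n = 0) (m : ℕ) :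
    Nat.card (groupCohomology (Rep.trivial ℤ Γ ℤ) (m + 1)) =
      ∏ p ∈ Finset.range (m + 2), Nat.card (E (Rep.trivial ℤ Γ ℤ) N 2 p (m + 1 : ℕ)) := by
  obtain ⟨θ, hθ, hθ0⟩ := exists_hom_groupCohomology N m
  refine (filtered (Rep.trivial ℤ Γ ℤ) N).card_eq_prod (n := m + 1)
    (fun r p n hr => congrArg ModuleCat.Hom.hom (hd r p n hr)) (fun n x => eq_zero_of_mem_fil _ N)
    (deg_le_fil_zero _ N) θ hθ ?_
  rwa [show ((m + 1 : ℕ) : ℤ) - 1 = m by push_cast; ring]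

end LHS

namespace Crystal

open LHS

section

variable {q n p : ℕ} {B : Type} [AddCommGroup B] (A : Matrix (Fin n) (Fin n) ℤ) (hA : A ^ 4 = 1)
  (hq : SubquotientIso (cocyc latticeInv (fun _ => Cubical.d) q)
    (cobound latticeInv (fun _ => Cubical.d) q) T (⊤ : AddSubgroup (Fin n → ℤ)) ⊥
    A.mulVecLin.toAddMonoidHom)
  (hB : Nonempty (groupCohomology (matrixRep A hA) p ≃+ B))

include hq hB

lemma nonempty_equiv_cohomologyRep :
    Nonempty (groupCohomology (cohomologyRep holonomyAction q) p ≃+ B) := by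
  obtain ⟨e, he⟩ := cohomologyRep_equiv A hq
  obtain ⟨e1⟩ := groupCohomology_equiv_matrixRep A hA _ e he p
  obtain ⟨e2⟩ := hB
  exact ⟨e1.trans e2⟩

lemma nonempty_equiv_secondPage {m : ℤ} (hm : (p : ℤ) + q = m) :
    Nonempty (LHS.E (Rep.trivial ℤ CrystGroup ℤ) translations 2 p m ≃+ B) := by
  obtain ⟨e1⟩ := secondPage_equiv_matrixRep A hA hq p hm
  obtain ⟨e2⟩ := hB
  exact ⟨e1.trans e2⟩

end

/-- The spectral sequence of the crystallographic group does not degenerate. -/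
theorem exists_d_ne_zero :
    ∃ r p n : ℤ, 2 ≤ r ∧ LHS.d (Rep.trivial ℤ CrystGroup ℤ) translations r p n ≠ 0 := by
  by_contra! h
  have hcard := card_groupCohomology_of_d_eq_zero translations h 3
  obtain ⟨e⟩ := groupCohomology_crystGroup
  rw [Nat.card_congr e.toEquiv] at hcard
  have key {p : ℕ} {B : Type} [AddCommGroup B] (h : Nonempty
      (LHS.E (Rep.trivial ℤ CrystGroup ℤ) translations 2 p (3 + 1 : ℕ) ≃+ B)) :
      Nat.card (LHS.E (Rep.trivial ℤ CrystGroup ℤ) translations 2 p (3 + 1 : ℕ)) = Nat.card B := by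
    obtain ⟨e⟩ := h
    exact Nat.card_congr e.toEquiv
  rw [Finset.prod_range_succ, Finset.prod_range_succ, Finset.prod_range_succ,
    Finset.prod_range_succ, Finset.prod_range_one,
    key (nonempty_equiv_secondPage _ neg_one_pow_four lattice_cohomology_four ⟨AddEquiv.refl _⟩ rfl),
    @Nat.card_unique _ _ holonomy_cohomology_zero_four,
    key (nonempty_equiv_secondPage _ A3_pow lattice_cohomology_three holonomy_cohomology_one_three rfl),
    key (nonempty_equiv_secondPage _ A2_pow lattice_cohomology_two holonomy_cohomology_two_two rfl),
    key (nonempty_equiv_secondPage _ A1_pow lattice_cohomology_one holonomy_cohomology_three_one rfl),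
    key (nonempty_equiv_secondPage _ (one_pow 4) lattice_cohomology_zero holonomy_cohomology_four_zero rfl)] at hcard
  -- The count reads 32 = 1 · 4 · 2 · 2 · 4.
  simp at hcard

end Crystal

open Crystal

theorem mainTheorem6 :
    Nonempty (groupCohomology (Rep.trivial ℤ CrystGroup ℤ) 4 ≃+ ZMod 4 × (Fin 3 → ZMod 2)) ∧
    Nonempty ((⨁ ij : Finset.HasAntidiagonal.antidiagonal (4 : ℕ),
        groupCohomology (cohomologyRep holonomyAction ij.1.2) ij.1.1) ≃+
      (Fin 2 → ZMod 4) × (Fin 2 → ZMod 2)) ∧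
    Nonempty ((⨁ ij : Finset.HasAntidiagonal.antidiagonal (4 : ℕ),
        LHS.E (Rep.trivial ℤ CrystGroup ℤ) translations 2 ij.1.1 4) ≃+
      (Fin 2 → ZMod 4) × (Fin 2 → ZMod 2)) ∧
    ∃ r p n : ℤ, 2 ≤ r ∧ LHS.d (Rep.trivial ℤ CrystGroup ℤ) translations r p n ≠ 0 := by
  refine ⟨groupCohomology_crystGroup, ?_, ?_, exists_d_ne_zero⟩
  · refine nonempty_directSum_antidiagonal_equiv
      (fun ij => groupCohomology (cohomologyRep holonomyAction ij.1.2) ij.1.1) ?_ ?_ ?_ ?_ ?_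
    · obtain ⟨e⟩ := nonempty_equiv_cohomologyRep (p := 0) _ neg_one_pow_four lattice_cohomology_four
        ⟨AddEquiv.refl _⟩
      have := holonomy_cohomology_zero_four
      exact e.toEquiv.subsingleton
    · exact nonempty_equiv_cohomologyRep _ A3_pow lattice_cohomology_three
        holonomy_cohomology_one_three
    · exact nonempty_equiv_cohomologyRep _ A2_pow lattice_cohomology_two
        holonomy_cohomology_two_two
    · exact nonempty_equiv_cohomologyRep _ A1_pow lattice_cohomology_one
        holonomy_cohomology_three_one
    · exact nonempty_equiv_cohomologyRep _ (one_pow 4) lattice_cohomology_zero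
        holonomy_cohomology_four_zero
  · refine nonempty_directSum_antidiagonal_equiv
      (fun ij => LHS.E (Rep.trivial ℤ CrystGroup ℤ) translations 2 ij.1.1 4) ?_ ?_ ?_ ?_ ?_
    · obtain ⟨e⟩ := nonempty_equiv_secondPage (p := 0) (m := 4) _ neg_one_pow_four
        lattice_cohomology_four ⟨AddEquiv.refl _⟩ rfl
      have := holonomy_cohomology_zero_four
      exact e.toEquiv.subsingleton
    · exact nonempty_equiv_secondPage _ A3_pow lattice_cohomology_three
        holonomy_cohomology_one_three rfl
    · exact nonempty_equiv_secondPage _ A2_pow lattice_cohomology_two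
        holonomy_cohomology_two_two rfl
    · exact nonempty_equiv_secondPage _ A1_pow lattice_cohomology_one
        holonomy_cohomology_three_one rfl
    · exact nonempty_equiv_secondPage _ (one_pow 4) lattice_cohomology_zero
        holonomy_cohomology_four_zero rfl
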